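/- **Setting.** A rack is a set $R$ with a binary operation $*$ such that every map $\bullet * a$ is bijective and $(a*b)*c=(a*c)*(b*c)$; it is a quandle if moreover $a*a=a$. The kink map $\iota:R\to R$ is defined by $\iota(a)*a=a$, and the associated quandle $Q_R$ is the set $R$ with the operation $a*^{\iota}b=\iota(a)*b$. A surface-knot is a closed connected oriented surface $\Sigma$ smoothly embedded in $\mathbb R^4$. A diagram $D$ of it without branch points is its image under the projection to $\mathbb R^3$, assumed to be an immersion with normal crossings (regular points, transverse double points and transverse triple points only), together with the information which of the two disks along each double point curve is lower; the orientation is represented by the unit normal of the sheets. Breaking $\Sigma$ along the double point curves in the lower disks gives the sheets of $D$. A rack coloring of $D$ by $R$ assigns to each sheet an element of $R$ such that, along each double point curve, $c(x_k)=c(x_i)*c(x_j)$ whenever $x_j$ is the over-sheet and its normal points from the under-sheet $x_i$ to the under-sheet $x_k$; $\mathrm{Col}_R(D)$ is the set of these colorings. A set $L$ of oriented immersed curves on $D$ is a finite set of smoothly immersed oriented closed curves on $\Sigma$ that intersect themselves and each other transversely and in double points only, intersect the double point curves of $D$ transversely, and miss the triple points. The normal direction $\vec n$ of a curve with velocity $\vec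 v$ is the one for which $(\vec v,\vec n)$ is positive on $\Sigma$. Cutting the sheets of $D$ further along $L$ gives the sheets of $(D,L)$, and $\mathrm{Col}_R(D,L)$ is the set of maps $c$ from these sheets to $R$ that satisfy the relation above along the double point curves and $c(x_j)=\iota(c(x_i))$ along the curves of $L$, whenever the normal direction of the curve points from $x_i$ to $x_j$. **Theorem.** Let $D$ be a surface-knot diagram without branch points. Then, for every $\varepsilon>0$, there is a set $L$ of oriented immersed curves on $D$ which is a push-off of the double point curves of $D$ of size less than $\varepsilon$: $L$ is obtained by pushing each double point curve, on the under-sheet, in the direction opposite to the normal direction of the over-sheet, with all points and velocities moved by less than $\varepsilon$, and oriented so that the normal direction of $L$ matches that of the over-sheet. For this $L$ there is, for every rack $R$, a bijection between $\mathrm{Col}_{Q_R}(D)$ and $\mathrm{Col}_R(D,L)$. -/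

import Mathlib

open Set Filter
open scoped Manifold ContDiff Topology Quandles RealInnerProductSpace

universe u v

/-! ### Racks and the associated quandle

Mathlib writes a rack with the left action `b ◃ a`; the product `a * b` of the right-action
convention is `b ◃ a`. -/

section Racks

variable {R : Type v} [Rack R]

/-- The kink map `ι` of a rack: `ι(a)` is the unique element with `ι(a) * a = a`. -/
def rackKink (a : R) : R := a ◃⁻¹ a

theorem act_rackKink (a : R) : a ◃ rackKink a = a := Rack.act_invAct_eq a a

theorem rackKink_unique {a b : R} (h : a ◃ b = a) : b = rackKink a :=
  (Rack.left_cancel a).1 (h.trans (act_rackKink a).symm)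

theorem rackKink_act (a b : R) : b ◃ rackKink a = rackKink (b ◃ a) := by
  apply rackKink_unique
  rw [← Rack.self_distrib, act_rackKink]

theorem rackKink_self_act (a : R) : rackKink (a ◃ a) = a :=
  (rackKink_unique Rack.self_act_act_eq).symm

theorem self_act_rackKink (a : R) : rackKink a ◃ rackKink a = a :=
  (Rack.self_invAct_act_eq (x := a)).trans (act_rackKink a)

theorem rackKink_left (a b : R) : rackKink b ◃ a = b ◃ a := Rack.self_invAct_act_eq

theorem assoc_distrib (x y z : R) :
    x ◃ rackKink (y ◃ rackKink z) = (x ◃ rackKink y) ◃ rackKink (x ◃ rackKink z) := by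
  simp only [rackKink_act, rackKink_left]
  rw [Rack.self_distrib]

end Racks

/-- The quandle structure on the set `R` whose product of `a` and `b` is `ι(a) * b`, where `*` is the
product of the rack `R`. -/
@[reducible] def assocQuandleStructure (R : Type v) [Rack R] : Quandle R where
  act b a := b ◃ rackKink a
  self_distrib {x y z} := assoc_distrib x y z
  invAct b a := (b ◃⁻¹ a) ◃ (b ◃⁻¹ a)
  left_inv b a := by
    change (b ◃⁻¹ b ◃ rackKink a) ◃ (b ◃⁻¹ b ◃ rackKink a) = a
    rw [Rack.invAct_act_eq, self_act_rackKink]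
  right_inv b a := by
    change b ◃ rackKink ((b ◃⁻¹ a) ◃ (b ◃⁻¹ a)) = a
    rw [rackKink_self_act, Rack.act_invAct_eq]
  fix {a} := act_rackKink a

/-- The associated quandle `Q_R` of a rack `R`: the set `R` with the product `ι(a) * b`. -/
def AssocQuandle (R : Type v) : Type v := R

instance AssocQuandle.instQuandle (R : Type v) [Rack R] : Quandle (AssocQuandle R) :=
  assocQuandleStructure R

/-! ### Surface-knot diagrams without branch points -/

/-- The space `ℝ³`. -/
abbrev E3 : Type := EuclideanSpace ℝ (Fin 3)

/-- The cross product of `ℝ³`. -/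
noncomputable def cross3 (a b : E3) : E3 := WithLp.toLp 2 (crossProduct a.ofLp b.ofLp)

/-- A diagram without branch points of an oriented surface-knot.

The surface-knot is the smooth embedding `x ↦ (proj x, height x)` of the closed surface `M` into
`ℝ³ × ℝ = ℝ⁴`, and `proj` is its projection to `ℝ³`.  The projection is generic and has no branch
point, that is, it is an immersion with normal crossings: at every point of `ℝ³` the sheets of the
image through that point are in general position (their normals are linearly independent), so that
the image consists of regular points, transverse double points and transverse triple points.
The orientation is given by the unit normal field of the immersed surface: a basis `(v₁, v₂)` of a
tangent plane is positive when `(v₁, v₂, normal)` is a positive basis of `ℝ³`. -/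
structure RegularDiagram (M : Type u) [TopologicalSpace M]
    [ChartedSpace (EuclideanSpace ℝ (Fin 2)) M] where
  /-- the first three coordinates of the surface-knot -/
  proj : M → E3
  /-- the fourth coordinate of the surface-knot -/
  height : M → ℝ
  contMDiff_proj : ContMDiff (𝓡 2) 𝓘(ℝ, E3) ∞ proj
  contMDiff_height : ContMDiff (𝓡 2) 𝓘(ℝ, ℝ) ∞ height
  injective : Function.Injective fun x => (proj x, height x)
  immersion : ∀ x, Function.Injective (mvfderiv (𝓡 2) proj x)
  /-- the normal directions representing the orientation -/
  normal : M → E3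
  continuous_normal : Continuous normal
  norm_normal : ∀ x, ‖normal x‖ = 1
  normal_perp : ∀ x (v : TangentSpace (𝓡 2) x),
    ⟪normal x, mvfderiv (𝓡 2) proj x v⟫ = 0
  normal_crossings : ∀ q : E3, LinearIndependent ℝ fun x : proj ⁻¹' {q} => normal x

namespace RegularDiagram

variable {M : Type u} [TopologicalSpace M] [ChartedSpace (EuclideanSpace ℝ (Fin 2)) M]
  (D : RegularDiagram M)

/-- `x` and `y` lie over the same point of `ℝ³`, with `x` in the lower and `y` in the upper disk. -/
def IsUnderOver (x y : M) : Prop := D.proj x = D.proj y ∧ D.height x < D.height y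

/-- `x` and `y` are the lower and the upper preimage of a double point that is not a triple
point. -/
def IsDoublePoint (x y : M) : Prop :=
  D.IsUnderOver x y ∧ ∀ z, D.proj z = D.proj x → z = x ∨ z = y

/-- The points of the surface that lie in the lower disk along some double point curve. The diagram
is broken along this set. -/
def lowerSet : Set M := {x | ∃ y, D.IsUnderOver x y}

/-- What is left of the surface after it is broken along the double point curves (in the lower
disks) and cut along the set `S`. -/
def cutSurface (S : Set M) : Set M := (D.lowerSet ∪ S)ᶜ

/-- The sheets of the diagram cut along `S`: the connected components of the cut surface. They are
the interiors of the compact surfaces obtained by removing thin neighbourhoods of the cuts.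
`D.Sheet ∅` is the set of sheets of `D` itself. -/
def Sheet (S : Set M) : Type u :=
  {A : Set M // ∃ p ∈ D.cutSurface S, A = connectedComponentIn (D.cutSurface S) p}

/-- The set `A` is adjacent to the point `x` on the side to which the direction `ν` of `ℝ³` points:
some arc on the surface leaves `x` with a velocity on that side and enters `A` at once. -/
def AdjacentOnSide (A : Set M) (x : M) (ν : E3) : Prop :=
  ∃ (δ : ℝ → M) (w : E3), δ 0 = x ∧ ContinuousAt δ 0 ∧ HasDerivAt (fun t => D.proj (δ t)) w 0 ∧
    0 < ⟪w, ν⟫ ∧ ∀ᶠ t in 𝓝[>] (0 : ℝ), δ t ∈ A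

/-- The coloring relation along the double point curves, for a map on the sheets of the diagram cut
along `S`: if `xj` is the over-sheet and the normal direction of `xj` points from the under-sheet
`xi` to the under-sheet `xk`, then `c xk = c xi * c xj`. -/
def DoubleCurveRelation (S : Set M) {R : Type v} [Rack R] (c : D.Sheet S → R) : Prop :=
  ∀ x y, D.IsDoublePoint x y → x ∉ S → y ∉ S → ∀ xi xj xk : D.Sheet S,
    y ∈ xj.1 → D.AdjacentOnSide xi.1 x (-D.normal y) → D.AdjacentOnSide xk.1 x (D.normal y) →
      c xk = c xj ◃ c xi

/-- `Col_R(D)`: the rack colorings of `D` by `R`. -/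
def Coloring (R : Type v) [Rack R] : Type (max u v) :=
  {c : D.Sheet ∅ → R // D.DoubleCurveRelation ∅ c}

/-- Two parameters `(i, s)` and `(j, t)` name the same point of a disjoint union of `n` circles
`ℝ / ℤ`. -/
def SameParam {n : ℕ} (i : Fin n) (s : ℝ) (j : Fin n) (t : ℝ) : Prop :=
  i = j ∧ ∃ m : ℤ, t = s + m

/-- A (finite, possibly empty) set of oriented closed immersed curves on the diagram. The curves
intersect themselves and each other transversely, in double points only; they intersect the double
point curves of the diagram transversely and miss its triple points. -/
structure ImmersedCurves where
  /-- the number of curves -/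
  n : ℕ
  /-- the curves, with their orientations, parametrized by `ℝ / ℤ` -/
  curve : Fin n → ℝ → M
  contMDiff : ∀ i, ContMDiff 𝓘(ℝ, ℝ) (𝓡 2) ∞ (curve i)
  periodic : ∀ i, Function.Periodic (curve i) 1
  immersed : ∀ i t, deriv (fun r => D.proj (curve i r)) t ≠ 0
  self_transverse : ∀ i s j t, curve i s = curve j t → SameParam i s j t ∨
    LinearIndependent ℝ
      ![deriv (fun r => D.proj (curve i r)) s, deriv (fun r => D.proj (curve j r)) t]
  no_triple : ∀ i s j t k r, curve i s = curve j t → curve j t = curve k r →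
    SameParam i s j t ∨ SameParam j t k r ∨ SameParam i s k r
  double_transverse : ∀ i t y, y ≠ curve i t → D.proj y = D.proj (curve i t) →
    ⟪deriv (fun r => D.proj (curve i r)) t, D.normal y⟫ ≠ 0
  misses_triple : ∀ i t y z, y ≠ curve i t → z ≠ curve i t →
    D.proj y = D.proj (curve i t) → D.proj z = D.proj (curve i t) → y = z

namespace ImmersedCurves

variable {D} (L : D.ImmersedCurves)

/-- The velocity in `ℝ³` of the `i`-th curve. -/
noncomputable def velocity (i : Fin L.n) (t : ℝ) : E3 := deriv (fun r => D.proj (L.curve i r)) t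

/-- The normal direction of the `i`-th curve in the surface: the pair (velocity, normal direction)
is positive for the orientation of the surface. -/
noncomputable def normalDir (i : Fin L.n) (t : ℝ) : E3 :=
  cross3 (D.normal (L.curve i t)) (L.velocity i t)

/-- The union of the curves. -/
def support : Set M := {p | ∃ i t, L.curve i t = p}

/-- The coloring relation along the curves: if the normal direction of the curve points from the
sheet `xi` to the sheet `xj`, then `c xj = ι (c xi)`. -/
def CurveRelation {R : Type v} [Rack R] (c : D.Sheet L.support → R) : Prop :=
  ∀ i t, L.curve i t ∉ D.lowerSet →
    (∀ j s, L.curve j s = L.curve i t → SameParam j s i t) → ∀ xi xj : D.Sheet L.support,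
      D.AdjacentOnSide xi.1 (L.curve i t) (-L.normalDir i t) →
      D.AdjacentOnSide xj.1 (L.curve i t) (L.normalDir i t) → c xj = rackKink (c xi)

/-- `Col_R(D, L)`: the rack colorings by `R` of `D` with the immersed curves `L`. -/
def Coloring (R : Type v) [Rack R] : Type (max u v) :=
  {c : D.Sheet L.support → R // D.DoubleCurveRelation L.support c ∧ L.CurveRelation c}

end ImmersedCurves

/-- The closed curves `t ↦ (low i t, up i t)`, for `i : Fin n`, are a regular parametrization of
all double point curves of `D`, by pairs of a lower and an upper preimage; each pair is run through
exactly once. -/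
structure ParametrizesDoubleCurves {n : ℕ} (low up : Fin n → ℝ → M) : Prop where
  contMDiff_low : ∀ i, ContMDiff 𝓘(ℝ, ℝ) (𝓡 2) ∞ (low i)
  contMDiff_up : ∀ i, ContMDiff 𝓘(ℝ, ℝ) (𝓡 2) ∞ (up i)
  periodic_low : ∀ i, Function.Periodic (low i) 1
  periodic_up : ∀ i, Function.Periodic (up i) 1
  regular : ∀ i t, deriv (fun r => D.proj (low i r)) t ≠ 0
  isUnderOver : ∀ i t, D.IsUnderOver (low i t) (up i t)
  surjective : ∀ x y, D.IsUnderOver x y → ∃ i t, low i t = x ∧ up i t = y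
  injective : ∀ i s j t, low i s = low j t → up i s = up j t → SameParam i s j t

/-- `L` is a push-off, of size less than `ε`, of the double point curves of `D`: each curve of `L`
arises from one double point curve by a smooth homotopy `H` (with time `s ∈ [0, 1]`) on the
under-sheet that pushes always in the direction opposite to the normal direction of the over-sheet;
the points move by less than `ε` in `ℝ³` and in height, the velocity of the curve changes by
less than `ε`, and the normal direction of `L` matches that of the over-sheet. -/
def IsPushOff (L : D.ImmersedCurves) (ε : ℝ) : Prop :=
  ∃ low up : Fin L.n → ℝ → M, D.ParametrizesDoubleCurves low up ∧
    ∀ i, ∃ H : ℝ → ℝ → M,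
      ContMDiffOn 𝓘(ℝ, ℝ × ℝ) (𝓡 2) ∞ (fun q : ℝ × ℝ => H q.1 q.2) (univ ×ˢ Icc 0 1) ∧
      (∀ s ∈ Icc (0 : ℝ) 1, Function.Periodic (fun t => H t s) 1) ∧
      (∀ t, H t 0 = low i t) ∧
      (∀ t, H t 1 = L.curve i t) ∧
      (∀ t, ∀ s ∈ Icc (0 : ℝ) 1,
        ⟪derivWithin (fun r => D.proj (H t r)) (Icc 0 1) s, D.normal (up i t)⟫ < 0 ∧
        dist (D.proj (H t s)) (D.proj (low i t)) < ε ∧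
        dist (D.height (H t s)) (D.height (low i t)) < ε) ∧
      (∀ t, ‖L.velocity i t - deriv (fun r => D.proj (low i r)) t‖ < ε) ∧
      (∀ t, 0 < ⟪L.normalDir i t, D.normal (up i t)⟫)

end RegularDiagram

/-! Everything rests on one integer-valued function on the surface. Pushing the lower curves into
`L` sweeps out immersed annuli, the strips, which leave the lower curves at time `0` and reach `L`
at time `δ`. Let `count p` be the number of strip parameters over `p`. It is locally constant away
from the lower curves and `L`. A coloring `c` of `D` by the associated quandle and a rack coloring
`c'` of `(D, L)` correspond to each other when `c' = ι ^ count · c` at every point where both are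
defined.

The two sets of relations then match. The normal direction of `L` points back into the strip, so
crossing `L` in that direction raises the count by one: `c'` changes by `ι` while `c` stays the
same, which is the relation along `L`. Along a double point curve the strip lies on the negative
side of the over-sheet, so the count is `m + 1` on the under-sheet `x_i` and `m` on the under-sheet
`x_k`. Since `ι` is an automorphism and `ι(b)` acts in the same way as `b`, the rack relation for
`ι^m c_k`, `ι^(m+1) c_i` and `ι^k c_j` is equivalent to `c_k = ι(c_i) * c_j`, the relation of the
quandle (`kinkPerm_pow_relation_iff`).

From `c` to `c'` it suffices that the count is locally constant (`count_eventually_eq`). In the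
other direction, `ι ^ (-count) · c'` has to extend over `L`: at simple points of `L` this is the
relation along `L`, and at crossings it holds because a punctured disc is connected
(`exists_hasColor`). At a double point that lies on `L` the coloring `c'` satisfies no relation.
Transversality isolates such points on the double point curve, so the relation for `c` is carried
over from a neighbouring double point (`doubleCurveRelation_symm`).

The existence of `L` uses the linear independence of the normals three times. It makes the set of
pairs (lower, upper preimage) a compact one-dimensional set with a canonical unit direction, which
therefore consists of finitely many closed curves (`exists_closed_curves`). It provides, at each
point, a tangent vector that has negative inner product with the normals of all other sheets there.
Bump functions and composition turn these vectors into a family of self-maps of the surface that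
starts at the identity and moves every lower point strictly against its upper normals
(`exists_push`). Finally it yields transversality: for small positive times the images of the lower
curves satisfy all requirements on `L`, because each of them follows from an open condition at time
`0` and compactness (`exists_pushOff`). Moving the whole surface by injective maps ensures that the
curves of `L` meet only where the lower curves do, that is, at images of bottom points of triple
points. -/

/-! ### Smooth local inverses and tubular neighbourhoods of the sheets -/

theorem exists_smooth_local_inverse {E F : Type*} [NormedAddCommGroup E] [NormedSpace ℝ E]
    [FiniteDimensional ℝ E] [NormedAddCommGroup F] [NormedSpace ℝ F] [FiniteDimensional ℝ F]
    {f : E → F} {a : E} (hf : ∀ᶠ x in 𝓝 a, ContDiffAt ℝ ∞ f x)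
    (hinj : Function.Injective (fderiv ℝ f a))
    (hd : Module.finrank ℝ E = Module.finrank ℝ F) :
    ∃ ψ : F → E, ψ (f a) = a ∧ (∀ᶠ x in 𝓝 a, ψ (f x) = x) ∧ (∀ᶠ z in 𝓝 (f a), f (ψ z) = z) ∧
      ∀ᶠ z in 𝓝 (f a), ContDiffAt ℝ ∞ ψ z := by
  have hfa := hf.self_of_nhds
  have : CompleteSpace E := FiniteDimensional.complete ℝ E
  let e : E ≃L[ℝ] F := ((fderiv ℝ f a : E →ₗ[ℝ] F).linearEquivOfInjective hinj hd).toContinuousLinearEquiv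
  have he : (e : E →L[ℝ] F) = fderiv ℝ f a := by ext v; rfl
  have hne : (∞ : WithTop ℕ∞) ≠ 0 := by simp
  have hd : HasFDerivAt f (e : E →L[ℝ] F) a := by
    rw [he]; exact (hfa.differentiableAt hne).hasFDerivAt
  let Φ := hfa.toOpenPartialHomeomorph f hd hne
  have hΦ : ∀ x, Φ x = f x := fun x => rfl
  have hsrc : a ∈ Φ.source := hfa.mem_toOpenPartialHomeomorph_source hd hne
  have htgt : f a ∈ Φ.target := hfa.image_mem_toOpenPartialHomeomorph_target hd hne
  have hback : Φ.symm (f a) = a := Φ.left_inv hsrc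
  refine ⟨Φ.symm, hback, ?_, ?_, ?_⟩
  · filter_upwards [Φ.open_source.mem_nhds hsrc] with x hx using Φ.left_inv hx
  · filter_upwards [Φ.open_target.mem_nhds htgt] with x hx using Φ.right_inv hx
  · have hcont : ContinuousAt Φ.symm (f a) := Φ.continuousAt_symm htgt
    -- The inverse has to be smooth at all nearby points and not only at `f a`; the derivative stays
    -- invertible there because the invertible operators form an open set.
    have hinv : ∀ᶠ x in 𝓝 a, ∃ e' : E ≃L[ℝ] F, (e' : E →L[ℝ] F) = fderiv ℝ f x := by
      have hc : ContinuousAt (fderiv ℝ f) a :=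
        (hfa.fderiv_right (m := 0) (by simp)).continuousAt
      have := hc.eventually (p := fun A => A ∈ range ((↑) : (E ≃L[ℝ] F) → E →L[ℝ] F))
        (by rw [← he]; exact ContinuousLinearEquiv.nhds e)
      exact this
    have h1 : ∀ᶠ z in 𝓝 (f a), ContDiffAt ℝ ∞ f (Φ.symm z) ∧
        ∃ e' : E ≃L[ℝ] F, (e' : E →L[ℝ] F) = fderiv ℝ f (Φ.symm z) := by
      have := hcont.tendsto
      rw [hback] at this
      exact this.eventually (hf.and hinv)
    filter_upwards [h1, Φ.open_target.mem_nhds htgt] with z hz hzt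
    obtain ⟨hz1, e', he'⟩ := hz
    refine Φ.contDiffAt_symm hzt (f₀' := e') ?_ hz1
    rw [he']
    exact (hz1.differentiableAt hne).hasFDerivAt

namespace RegularDiagram

variable {M : Type u} [TopologicalSpace M] [ChartedSpace (EuclideanSpace ℝ (Fin 2)) M]
  (D : RegularDiagram M)

theorem continuous_proj : Continuous D.proj := D.contMDiff_proj.continuous

theorem continuous_height : Continuous D.height := D.contMDiff_height.continuous

theorem inner_normal_self (x : M) : ⟪D.normal x, D.normal x⟫ = 1 := by
  rw [real_inner_self_eq_norm_sq, D.norm_normal]; norm_num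

variable {E : Type*} [NormedAddCommGroup E] [NormedSpace ℝ E]

theorem fderiv_proj_comp {f : E → M} {e : E} (hf : MDifferentiableAt 𝓘(ℝ, E) (𝓡 2) f e) (v : E) :
    fderiv ℝ (fun e => D.proj (f e)) e v =
      mvfderiv (𝓡 2) D.proj (f e) (mfderiv 𝓘(ℝ, E) (𝓡 2) f e v) := by
  have hp : MDifferentiableAt (𝓡 2) 𝓘(ℝ, E3) D.proj (f e) :=
    D.contMDiff_proj.mdifferentiableAt (by simp)
  have h := mfderiv_comp e hp hf
  have h2 : mfderiv 𝓘(ℝ, E) 𝓘(ℝ, E3) (fun e => D.proj (f e)) e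
      = fderiv ℝ (fun e => D.proj (f e)) e := mfderiv_eq_fderiv
  rw [← h2]
  change mfderiv 𝓘(ℝ, E) 𝓘(ℝ, E3) (D.proj ∘ f) e v = _
  rw [h]
  rfl

theorem inner_normal_fderiv {f : E → M} {e : E} (hf : MDifferentiableAt 𝓘(ℝ, E) (𝓡 2) f e)
    (v : E) : ⟪D.normal (f e), fderiv ℝ (fun e => D.proj (f e)) e v⟫ = 0 := by
  rw [D.fderiv_proj_comp hf]
  exact D.normal_perp _ _

theorem contDiffAt_proj_comp {f : E → M} {e : E} {n : ℕ∞ω} (hn : n ≤ ∞)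
    (hf : ContMDiffAt 𝓘(ℝ, E) (𝓡 2) n f e) :
    ContDiffAt ℝ n (fun e => D.proj (f e)) e := by
  rw [← contMDiffAt_iff_contDiffAt]
  exact (D.contMDiff_proj.of_le hn).contMDiffAt.comp e hf

/-- A tubular neighbourhood of a sheet near a point, in the direction of the normal at that
point. -/
theorem exists_sheet_retraction [IsManifold (𝓡 2) ∞ M] (x₀ : M) :
    ∃ (r : E3 → M) (g : E3 → ℝ), r (D.proj x₀) = x₀ ∧
      (∀ᶠ z in 𝓝 (D.proj x₀), ContMDiffAt 𝓘(ℝ, E3) (𝓡 2) ∞ r z ∧ ContDiffAt ℝ ∞ g z ∧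
        D.proj (r z) + g z • D.normal x₀ = z) ∧
      ∀ᶠ q : M × ℝ in 𝓝 (x₀, 0), r (D.proj q.1 + q.2 • D.normal x₀) = q.1 ∧
        g (D.proj q.1 + q.2 • D.normal x₀) = q.2 := by
  set φ := extChartAt (𝓡 2) x₀ with hφ
  set e₀ := φ x₀ with he₀
  set n := D.normal x₀ with hn
  have hback : φ.symm e₀ = x₀ := extChartAt_to_inv x₀
  have htgt : ∀ᶠ e in 𝓝 e₀, e ∈ φ.target := extChartAt_target_mem_nhds x₀
  have hsm : ∀ e ∈ φ.target, ContMDiffAt 𝓘(ℝ, EuclideanSpace ℝ (Fin 2)) (𝓡 2) ∞ φ.symm e := by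
    intro e he
    exact (contMDiffOn_extChartAt_symm x₀).contMDiffAt ((isOpen_extChartAt_target x₀).mem_nhds he)
  have hP : ∀ e ∈ φ.target, ContDiffAt ℝ ∞ (fun e => D.proj (φ.symm e)) e := fun e he =>
    D.contDiffAt_proj_comp le_rfl (hsm e he)
  have he₀t : e₀ ∈ φ.target := mem_extChartAt_target x₀
  -- Chart coordinates on the sheet together with the displacement along the fixed vector `n`. The
  -- derivative is injective because the sheet is immersed and its tangent plane at `x₀` is
  -- orthogonal to `n`.
  let F : EuclideanSpace ℝ (Fin 2) × ℝ → E3 := fun q => D.proj (φ.symm q.1) + q.2 • n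
  have hFs : ∀ q : EuclideanSpace ℝ (Fin 2) × ℝ, q.1 ∈ φ.target → ContDiffAt ℝ ∞ F q := by
    intro q hq
    exact ((hP q.1 hq).comp q contDiffAt_fst).add (contDiffAt_snd.smul contDiffAt_const)
  have hF0 : F (e₀, 0) = D.proj x₀ := by simp [F, hback]
  have hFd : HasFDerivAt F ((fderiv ℝ (fun e => D.proj (φ.symm e)) e₀).comp
      (ContinuousLinearMap.fst ℝ (EuclideanSpace ℝ (Fin 2)) ℝ) +
      (ContinuousLinearMap.snd ℝ (EuclideanSpace ℝ (Fin 2)) ℝ).smulRight n) (e₀, 0) := by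
    have h1 : HasFDerivAt (fun e => D.proj (φ.symm e))
      (fderiv ℝ (fun e => D.proj (φ.symm e)) e₀) (e₀, (0 : ℝ)).1 :=
      ((hP e₀ he₀t).differentiableAt (by simp)).hasFDerivAt
    exact (h1.comp (e₀, (0:ℝ)) hasFDerivAt_fst).add
      ((hasFDerivAt_snd (p := (e₀, (0:ℝ)))).smul_const n)
  have hmd := (hsm e₀ he₀t).mdifferentiableAt (by simp)
  have hinj : Function.Injective (fderiv ℝ F (e₀, 0)) := by
    rw [hFd.fderiv, injective_iff_map_eq_zero]
    rintro ⟨v, τ⟩ h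
    simp only [add_apply, ContinuousLinearMap.comp_apply,
      ContinuousLinearMap.coe_fst', ContinuousLinearMap.smulRight_apply,
      ContinuousLinearMap.coe_snd'] at h
    have hperp := D.inner_normal_fderiv hmd v
    rw [hback, ← hn] at hperp
    have hτ : τ = 0 := by
      have := congrArg (fun w => ⟪n, w⟫) h
      rwa [inner_add_right, hperp, zero_add, inner_smul_right, hn, D.inner_normal_self, mul_one,
        inner_zero_right] at this
    subst hτ
    rw [zero_smul, add_zero, D.fderiv_proj_comp hmd] at h
    have h2 := (injective_iff_map_eq_zero _).1 (D.immersion (φ.symm e₀)) _ h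
    -- The derivative of the chart is a left inverse of that of `φ.symm`, so `v` vanishes along with
    -- its image.
    have hA := mfderiv_extChartAt_comp_mfderivWithin_extChartAt_symm (I := 𝓡 2) he₀t
    rw [ModelWithCorners.range_eq_univ, mfderivWithin_univ] at hA
    have hv := congrArg (fun A => A v) hA
    change mfderiv (𝓡 2) _ _ _ (mfderiv _ _ φ.symm e₀ v) = v at hv
    rw [h2, map_zero] at hv
    rw [← hv]; rfl
  obtain ⟨ψ, hψ0, hψl, hψr, hψs⟩ := exists_smooth_local_inverse
    (a := (e₀, (0 : ℝ))) (f := F)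
    (by
      have : ∀ᶠ q : EuclideanSpace ℝ (Fin 2) × ℝ in 𝓝 (e₀, 0), q.1 ∈ φ.target :=
        continuousAt_fst.eventually htgt
      filter_upwards [this] with q hq using hFs q hq) hinj (by simp)
  rw [hF0] at hψ0 hψr hψs
  have hψc : ContinuousAt ψ (D.proj x₀) := hψs.self_of_nhds.continuousAt
  have hψt : ∀ᶠ z in 𝓝 (D.proj x₀), (ψ z).1 ∈ φ.target := by
    have : ContinuousAt (fun z => (ψ z).1) (D.proj x₀) := continuousAt_fst.comp hψc
    have := this.tendsto
    rw [hψ0] at this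
    exact this.eventually htgt
  refine ⟨fun z => φ.symm (ψ z).1, fun z => (ψ z).2, by simp [hψ0, hback], ?_, ?_⟩
  · filter_upwards [hψt, hψr, hψs] with z h1 h2 h3
    refine ⟨?_, h3.snd, h2⟩
    exact (hsm _ h1).comp z (contMDiffAt_iff_contDiffAt.2 h3.fst)
  · have h1 : ∀ᶠ q : M × ℝ in 𝓝 (x₀, 0), ψ (F (φ q.1, q.2)) = (φ q.1, q.2) := by
      have hc : ContinuousAt (fun q : M × ℝ => (φ q.1, q.2)) (x₀, 0) :=
        (ContinuousAt.comp (f := Prod.fst) (x := (x₀, (0 : ℝ))) (continuousAt_extChartAt x₀)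
          continuousAt_fst).prodMk continuousAt_snd
      exact hc.eventually hψl
    have h2 : ∀ᶠ q : M × ℝ in 𝓝 (x₀, 0), q.1 ∈ φ.source :=
      continuousAt_fst.eventually (extChartAt_source_mem_nhds x₀)
    filter_upwards [h1, h2] with q h1 h2
    have h3 : φ.symm (φ q.1) = q.1 := φ.left_inv h2
    simp only [F, h3] at h1
    simp [h1, h3]

end RegularDiagram

/-! ### Cross products in ℝ³ -/

section CrossProduct

theorem inner_eq_sum_three (a b : E3) : ⟪a, b⟫ = a 0 * b 0 + a 1 * b 1 + a 2 * b 2 := by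
  simp [PiLp.inner_apply, Fin.sum_univ_three]; ring

@[simp] theorem cross3_apply_zero (a b : E3) : cross3 a b 0 = a 1 * b 2 - a 2 * b 1 := by
  simp [cross3, cross_apply]

@[simp] theorem cross3_apply_one (a b : E3) : cross3 a b 1 = a 2 * b 0 - a 0 * b 2 := by
  simp [cross3, cross_apply]

@[simp] theorem cross3_apply_two (a b : E3) : cross3 a b 2 = a 0 * b 1 - a 1 * b 0 := by
  simp [cross3, cross_apply]

theorem inner_cross3_right (a b : E3) : ⟪cross3 a b, b⟫ = 0 := by
  simp [inner_eq_sum_three]; ring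

theorem inner_cross3_self (a b : E3) :
    ⟪cross3 a b, cross3 a b⟫ = ⟪a, a⟫ * ⟪b, b⟫ - ⟪a, b⟫ ^ 2 := by
  simp only [inner_eq_sum_three, cross3_apply_zero, cross3_apply_one, cross3_apply_two]; ring

theorem cross3_cross3 (a b : E3) : cross3 a (cross3 b a) = ⟪a, a⟫ • b - ⟪a, b⟫ • a := by
  ext i; fin_cases i <;> simp [-inner_self_eq_norm_sq_to_K, inner_eq_sum_three] <;> ring

theorem cross3_smul_right (s : ℝ) (a b : E3) : cross3 a (s • b) = s • cross3 a b := by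
  ext i; fin_cases i <;> simp <;> ring

/-- A vector orthogonal to `a` and `b` is parallel to their cross product. -/
theorem smul_eq_of_perp {a b w : E3} (ha : ⟪a, w⟫ = 0) (hb : ⟪b, w⟫ = 0) :
    ⟪cross3 a b, cross3 a b⟫ • w = ⟪w, cross3 a b⟫ • cross3 a b := by
  rw [inner_eq_sum_three] at ha hb
  ext i; fin_cases i <;> simp [-inner_self_eq_norm_sq_to_K, inner_eq_sum_three]
  · linear_combination (a 0 * (b 0 ^2 + b 1 ^2 + b 2 ^2) - b 0 * (a 0 * b 0 + a 1 * b 1 + a 2 * b 2)) * ha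
      + (b 0 * (a 0 ^2 + a 1 ^2 + a 2 ^2) - a 0 * (a 0 * b 0 + a 1 * b 1 + a 2 * b 2)) * hb
  · linear_combination (a 1 * (b 0 ^2 + b 1 ^2 + b 2 ^2) - b 1 * (a 0 * b 0 + a 1 * b 1 + a 2 * b 2)) * ha
      + (b 1 * (a 0 ^2 + a 1 ^2 + a 2 ^2) - a 1 * (a 0 * b 0 + a 1 * b 1 + a 2 * b 2)) * hb
  · linear_combination (a 2 * (b 0 ^2 + b 1 ^2 + b 2 ^2) - b 2 * (a 0 * b 0 + a 1 * b 1 + a 2 * b 2)) * ha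
      + (b 2 * (a 0 ^2 + a 1 ^2 + a 2 ^2) - a 2 * (a 0 * b 0 + a 1 * b 1 + a 2 * b 2)) * hb

theorem eq_zero_of_perp {a b w : E3} (hab : cross3 a b ≠ 0) (ha : ⟪a, w⟫ = 0) (hb : ⟪b, w⟫ = 0)
    (hc : ⟪w, cross3 a b⟫ = 0) : w = 0 := by
  have h := smul_eq_of_perp ha hb
  rw [hc, zero_smul, smul_eq_zero] at h
  exact h.resolve_left fun h => hab (inner_self_eq_zero.1 h)

theorem continuous_cross3 : Continuous fun q : E3 × E3 => cross3 q.1 q.2 := by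
  have h : ∀ q : E3 × E3, cross3 q.1 q.2 = WithLp.toLp 2
    ![q.1 1 * q.2 2 - q.1 2 * q.2 1, q.1 2 * q.2 0 - q.1 0 * q.2 2,
      q.1 0 * q.2 1 - q.1 1 * q.2 0] := fun q => by
    ext i; fin_cases i <;> simp
  simp_rw [h]
  refine (PiLp.continuous_toLp 2 _).comp (continuous_pi fun i => ?_)
  fin_cases i <;> simp <;> fun_prop

theorem ContinuousAt.cross3 {X : Type*} [TopologicalSpace X] {f g : X → E3} {x : X}
    (hf : ContinuousAt f x) (hg : ContinuousAt g x) :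
    ContinuousAt (fun x => cross3 (f x) (g x)) x :=
  continuous_cross3.continuousAt.comp (f := fun x => (f x, g x)) (hf.prodMk hg)

/-- Linearly independent vectors have prescribed inner products with some vector. -/
theorem LinearIndependent.exists_inner_eq {ι : Type*} {f : ι → E3} (hf : LinearIndependent ℝ f)
    (a : ι → ℝ) : ∃ w : E3, ∀ i, ⟪f i, w⟫ = a i := by
  obtain ⟨φ, hφ⟩ : ∃ φ : E3 →ₗ[ℝ] ℝ, ∀ i, φ (f i) = a i := by
    let b := Module.Basis.sumExtend hf
    refine ⟨b.constr ℝ (Sum.elim a fun _ => 0), fun i => ?_⟩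
    have hb : b (Sum.inl i) = f i := by simp [b, Module.Basis.sumExtend]; rfl
    rw [← hb, Module.Basis.constr_basis]
    rfl
  refine ⟨(InnerProductSpace.toDual ℝ E3).symm (LinearMap.toContinuousLinearMap φ), fun i => ?_⟩
  rw [real_inner_comm, InnerProductSpace.toDual_symm_apply]
  exact hφ i

end CrossProduct

/-! ### General position of the normals and the local form of the double point curves -/

/-- The integral from `0` has the smooth derivative `v` on a ball, hence is smooth there. It serves
as arc length. -/
theorem exists_smooth_primitive {v : ℝ → ℝ} (hv : ∀ᶠ t in 𝓝 0, ContDiffAt ℝ ∞ v t) :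
    ∃ ℓ : ℝ → ℝ, ℓ 0 = 0 ∧ ∀ᶠ t in 𝓝 0, HasDerivAt ℓ (v t) t ∧ ContDiffAt ℝ ∞ ℓ t := by
  obtain ⟨a, ha, hav⟩ := Metric.eventually_nhds_iff_ball.1 hv
  have hd : ∀ t ∈ Metric.ball (0 : ℝ) a, HasDerivAt (fun t => ∫ s in (0 : ℝ)..t, v s) (v t) t := by
    intro t ht
    have hsub : uIcc 0 t ⊆ Metric.ball (0 : ℝ) a := by
      rw [← segment_eq_uIcc]
      exact (convex_ball _ _).segment_subset (Metric.mem_ball_self ha) ht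
    have hco : ContinuousOn v (Metric.ball 0 a) := fun s hs => (hav s hs).continuousAt.continuousWithinAt
    exact intervalIntegral.integral_hasDerivAt_right
      ((hco.mono hsub).intervalIntegrable)
      (hco.stronglyMeasurableAtFilter Metric.isOpen_ball t ht) (hav t ht).continuousAt
  refine ⟨fun t => ∫ s in (0 : ℝ)..t, v s, by simp, ?_⟩
  have hs : ContDiffOn ℝ ∞ (fun t => ∫ s in (0 : ℝ)..t, v s) (Metric.ball 0 a) := by
    rw [contDiffOn_infty_iff_deriv_of_isOpen Metric.isOpen_ball]
    refine ⟨fun t ht => (hd t ht).differentiableAt.differentiableWithinAt, ?_⟩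
    exact ContDiffOn.congr (fun t ht => (hav t ht).contDiffWithinAt) fun t ht => (hd t ht).deriv
  filter_upwards [Metric.ball_mem_nhds 0 ha] with t ht
  exact ⟨hd t ht, hs.contDiffAt (Metric.isOpen_ball.mem_nhds ht)⟩

namespace RegularDiagram

variable {M : Type u} [TopologicalSpace M] [ChartedSpace (EuclideanSpace ℝ (Fin 2)) M]
  (D : RegularDiagram M)

/-- The pairs of a lower and an upper preimage of the multiple points of the diagram. -/
def doublePairs : Set (M × M) := {p | D.IsUnderOver p.1 p.2}

theorem IsUnderOver.ne {D : RegularDiagram M} {x y : M} (h : D.IsUnderOver x y) : x ≠ y := by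
  rintro rfl; exact lt_irrefl _ h.2

theorem exists_inner_normal (q : E3) (a : M → ℝ) :
    ∃ w : E3, ∀ x, D.proj x = q → ⟪D.normal x, w⟫ = a x := by
  obtain ⟨w, hw⟩ := (D.normal_crossings q).exists_inner_eq (fun x => a x)
  exact ⟨w, fun x hx => hw ⟨x, hx⟩⟩

/-- If the product vanished, Lagrange's identity would make the second unit normal a multiple of the
first. But general position gives a vector orthogonal to the first normal and not to the second. -/
theorem cross3_normal_ne_zero {x y : M} (hxy : x ≠ y) (h : D.proj x = D.proj y) :
    cross3 (D.normal x) (D.normal y) ≠ 0 := by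
  intro h0
  classical
  obtain ⟨w, hw⟩ := D.exists_inner_normal (D.proj x) (fun z => if z = y then 1 else 0)
  have h1 := hw x rfl
  have h2 := hw y h.symm
  rw [if_neg hxy] at h1
  rw [if_pos rfl] at h2
  have h3 := inner_cross3_self (D.normal x) (D.normal y)
  rw [h0, inner_zero_left, D.inner_normal_self, D.inner_normal_self] at h3
  have h4 : D.normal y - ⟪D.normal x, D.normal y⟫ • D.normal x = 0 := by
    rw [← inner_self_eq_zero (𝕜 := ℝ)]
    simp only [inner_sub_left, inner_sub_right, inner_smul_left, inner_smul_right,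
      D.inner_normal_self, real_inner_comm (D.normal x) (D.normal y), conj_trivial]
    linear_combination -h3
  have h5 := congrArg (fun v => ⟪v, w⟫) h4
  simp [inner_sub_left, inner_smul_left, h1, h2] at h5

/-- A vector `w` orthogonal to the first two normals and not to the third is parallel to the cross
product of the first two; if the triple product were zero, `w` would be orthogonal to the third
normal as well. -/
theorem inner_cross3_normal_ne_zero {x y z : M} (hxy : x ≠ y) (hxz : x ≠ z) (hyz : y ≠ z)
    (h : D.proj x = D.proj y) (h' : D.proj x = D.proj z) :
    ⟪cross3 (D.normal x) (D.normal y), D.normal z⟫ ≠ 0 := by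
  classical
  intro h0
  obtain ⟨w, hw⟩ := D.exists_inner_normal (D.proj x) (fun t => if t = z then 1 else 0)
  have h1 := hw x rfl
  have h2 := hw y h.symm
  have h3 := hw z h'.symm
  rw [if_neg hxz] at h1
  rw [if_neg hyz] at h2
  rw [if_pos rfl] at h3
  have h4 := congrArg (fun v => ⟪v, D.normal z⟫) (smul_eq_of_perp h1 h2)
  simp only [inner_smul_left, conj_trivial, h0, mul_zero, mul_eq_zero] at h4
  rw [real_inner_comm] at h3
  rcases h4 with h4 | h4
  · exact D.cross3_normal_ne_zero hxy h (inner_self_eq_zero.1 h4)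
  · rw [h4] at h3; norm_num at h3

/-- A vector dual to a fourth normal would be orthogonal to three normals with nonzero triple
product, hence zero. This bounds the multiplicity of every point of the image by three. -/
theorem not_four_preimages {x y z t : M} (hxy : x ≠ y) (hxz : x ≠ z) (hxt : x ≠ t) (hyz : y ≠ z)
    (hyt : y ≠ t) (hzt : z ≠ t) (h : D.proj x = D.proj y) (h' : D.proj x = D.proj z)
    (h'' : D.proj x = D.proj t) : False := by
  classical
  obtain ⟨w, hw⟩ := D.exists_inner_normal (D.proj x) (fun s => if s = t then 1 else 0)
  have h1 := hw x rfl
  have h2 := hw y h.symm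
  have h3 := hw z h'.symm
  have h4 := hw t h''.symm
  rw [if_neg hxt] at h1
  rw [if_neg hyt] at h2
  rw [if_neg hzt] at h3
  rw [if_pos rfl] at h4
  have h5 := smul_eq_of_perp h1 h2
  have h6 := congrArg (fun v => ⟪v, D.normal z⟫) h5
  simp only [inner_smul_left, conj_trivial, real_inner_comm (D.normal z) w, h3, mul_zero,
    zero_eq_mul, D.inner_cross3_normal_ne_zero hxy hxz hyz h h', or_false] at h6
  rw [h6, zero_smul, smul_eq_zero] at h5
  rcases h5 with h5 | h5
  · exact D.cross3_normal_ne_zero hxy h (inner_self_eq_zero.1 h5)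
  · rw [h5, inner_zero_right] at h4; norm_num at h4

/-- The unit tangent direction of the double point curves for which the lower sheet's normal
direction of the curve matches the normal of the upper sheet. -/
noncomputable def doubleDir (p : M × M) : E3 :=
  ‖cross3 (D.normal p.2) (D.normal p.1)‖⁻¹ • cross3 (D.normal p.2) (D.normal p.1)

/-- Differentiate `proj (r z) + g z • n = z` and take the inner product with `n`; the first summand
moves inside the sheet and drops out. To first order, `g` is the signed distance from the sheet. -/
theorem sheet_fderiv {x₀ : M} {r : E3 → M} {g : E3 → ℝ} (hr : r (D.proj x₀) = x₀)
    (h : ∀ᶠ z in 𝓝 (D.proj x₀), ContMDiffAt 𝓘(ℝ, E3) (𝓡 2) ∞ r z ∧ ContDiffAt ℝ ∞ g z ∧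
        D.proj (r z) + g z • D.normal x₀ = z) (w : E3) :
    fderiv ℝ g (D.proj x₀) w = ⟪D.normal x₀, w⟫ := by
  obtain ⟨h1, h2, -⟩ := h.self_of_nhds
  have hne : (∞ : WithTop ℕ∞) ≠ 0 := by simp
  have hd1 : HasFDerivAt (fun z => D.proj (r z)) _ (D.proj x₀) :=
    ((D.contDiffAt_proj_comp le_rfl h1).differentiableAt hne).hasFDerivAt
  have hd2 := ((h2.differentiableAt hne).hasFDerivAt.smul_const (D.normal x₀))
  have hd3 := (hd1.add hd2).congr_of_eventuallyEq (f₁ := id) (by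
    filter_upwards [h] with z hz using hz.2.2.symm)
  have h4 := congrArg (fun A => ⟪D.normal x₀, A w⟫) (hd3.unique (hasFDerivAt_id _))
  have h5 := D.inner_normal_fderiv (h1.mdifferentiableAt hne) w
  rw [hr] at h5
  simpa [inner_add_right, inner_smul_right, h5, D.norm_normal] using h4

end RegularDiagram

namespace RegularDiagram

variable {M : Type u} [TopologicalSpace M] [ChartedSpace (EuclideanSpace ℝ (Fin 2)) M]
  (D : RegularDiagram M)

theorem continuous_cross3_normal :
    Continuous fun p : M × M => cross3 (D.normal p.2) (D.normal p.1) :=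
  continuous_cross3.comp ((D.continuous_normal.comp continuous_snd).prodMk
    (D.continuous_normal.comp continuous_fst))

theorem norm_doubleDir {p : M × M} (hp : p ∈ D.doublePairs) : ‖D.doubleDir p‖ = 1 := by
  have h := D.cross3_normal_ne_zero hp.ne.symm hp.1.symm
  rw [doubleDir, norm_smul, norm_inv, norm_norm, inv_mul_cancel₀ (norm_ne_zero_iff.2 h)]

/-- The double point curves are regular curves: near each double point they have a unit speed
parametrization `e`, with inverse given by a smooth function `lam` on `ℝ³`. -/
theorem exists_local_double_curve [IsManifold (𝓡 2) ∞ M] {p : M × M} (hp : p ∈ D.doublePairs) :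
    ∃ (e : ℝ → M × M) (lam : E3 → ℝ), e 0 = p ∧
      (∀ᶠ t in 𝓝 0, e t ∈ D.doublePairs ∧ ContMDiffAt 𝓘(ℝ, ℝ) (𝓡 2) ∞ (fun t => (e t).1) t ∧
        ContMDiffAt 𝓘(ℝ, ℝ) (𝓡 2) ∞ (fun t => (e t).2) t ∧
        HasDerivAt (fun t => D.proj (e t).1) (D.doubleDir (e t)) t ∧
        lam (D.proj (e t).1) = t) ∧
      (∀ᶠ z in 𝓝 (D.proj p.1), ContDiffAt ℝ ∞ lam z) ∧
      ∀ᶠ p' in 𝓝[D.doublePairs] p, e (lam (D.proj p'.1)) = p' := by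
  obtain ⟨x, y⟩ := p
  have hxy : D.proj x = D.proj y := hp.1
  have hne : x ≠ y := hp.ne
  have hinf : (∞ : WithTop ℕ∞) ≠ 0 := by simp
  obtain ⟨r₁, g₁, hr₁, h₁, h₁'⟩ := D.exists_sheet_retraction x
  obtain ⟨r₂, g₂, hr₂, h₂, h₂'⟩ := D.exists_sheet_retraction y
  set q := D.proj x with hq
  have hg₁ := D.sheet_fderiv hr₁ h₁
  have hg₂ := D.sheet_fderiv hr₂ h₂
  rw [← hxy] at hr₂ h₂ hg₂
  rw [← hq] at hg₁
  set τ := cross3 (D.normal y) (D.normal x) with hτ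
  have hτ0 : τ ≠ 0 := D.cross3_normal_ne_zero hne.symm hxy.symm
  have hg₁q : g₁ q = 0 := by
    have := h₁'.self_of_nhds.2
    simpa using this
  have hg₂q : g₂ q = 0 := by
    have := h₂'.self_of_nhds.2
    simpa [← hxy] using this
  let θ : E3 → ℝ := fun z => ⟪τ, z - q⟫
  have hθ : ContDiff ℝ ∞ θ := contDiff_const.inner ℝ (contDiff_id.sub contDiff_const)
  -- The first two coordinates vanish exactly on the two sheets near `q`, and the third measures the
  -- position along the tangent of their intersection. In these coordinates the double point curve
  -- is the third axis.
  let Θ : E3 → ℝ × ℝ × ℝ := fun z => (g₁ z, g₂ z, θ z)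
  have hΘq : Θ q = 0 := by simp [Θ, θ, hg₁q, hg₂q]
  have hinj : Function.Injective (fderiv ℝ Θ q) := by
    have hd1 := (h₁.self_of_nhds.2.1.differentiableAt hinf)
    have hd2 := (h₂.self_of_nhds.2.1.differentiableAt hinf)
    have hd3 : HasFDerivAt θ (innerSL ℝ τ) q := by
      have := (innerSL ℝ τ).hasFDerivAt.comp q ((hasFDerivAt_id (𝕜 := ℝ) q).sub_const q)
      rw [ContinuousLinearMap.comp_id] at this
      exact this
    have hd := (hd1.hasFDerivAt.prodMk (hd2.hasFDerivAt.prodMk hd3))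
    rw [show fderiv ℝ Θ q = _ from hd.fderiv, injective_iff_map_eq_zero]
    intro w hw
    simp only [ContinuousLinearMap.prod_apply, Prod.mk_eq_zero, hg₁, hg₂, innerSL_apply_apply] at hw
    refine eq_zero_of_perp hτ0 hw.2.1 hw.1 ?_
    rw [real_inner_comm]; exact hw.2.2
  obtain ⟨ψ, hψ0, hψl, hψr, hψs⟩ := exists_smooth_local_inverse (f := Θ) (a := q)
    (by filter_upwards [h₁, h₂] with z hz hz' using hz.2.1.prodMk (hz'.2.1.prodMk hθ.contDiffAt))
    hinj (by simp)
  rw [hΘq] at hψ0 hψr hψs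
  let c : ℝ → E3 := fun t => ψ (0, 0, t)
  have hι : ContDiff ℝ ∞ fun t : ℝ => ((0, 0, t) : ℝ × ℝ × ℝ) := by fun_prop
  have hι0 : Tendsto (fun t : ℝ => ((0, 0, t) : ℝ × ℝ × ℝ)) (𝓝 0) (𝓝 0) := by
    have := hι.continuous.tendsto 0
    exact this
  have hcs : ∀ᶠ t in 𝓝 0, ContDiffAt ℝ ∞ c t := by
    filter_upwards [hι0.eventually hψs] with t ht using ht.comp t hι.contDiffAt
  have hc0 : c 0 = q := hψ0
  have hct : Tendsto c (𝓝 0) (𝓝 q) := by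
    have := hcs.self_of_nhds.continuousAt.tendsto
    rwa [hc0] at this
  have hcΘ : ∀ᶠ t in 𝓝 0, g₁ (c t) = 0 ∧ g₂ (c t) = 0 ∧ θ (c t) = t := by
    filter_upwards [hι0.eventually hψr] with t ht
    simpa [Θ] using ht
  have hrc : ∀ᶠ t in 𝓝 0, D.proj (r₁ (c t)) = c t ∧ D.proj (r₂ (c t)) = c t := by
    filter_upwards [hct.eventually h₁, hct.eventually h₂, hcΘ] with t ht ht' ht''
    have a := ht.2.2
    have b := ht'.2.2
    rw [ht''.1, zero_smul, add_zero] at a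
    rw [ht''.2.1, zero_smul, add_zero] at b
    exact ⟨a, b⟩
  let E : ℝ → M × M := fun t => (r₁ (c t), r₂ (c t))
  have hEs : ∀ᶠ t in 𝓝 0, ContMDiffAt 𝓘(ℝ, ℝ) (𝓡 2) ∞ (fun t => (E t).1) t ∧
      ContMDiffAt 𝓘(ℝ, ℝ) (𝓡 2) ∞ (fun t => (E t).2) t := by
    filter_upwards [hct.eventually h₁, hct.eventually h₂, hcs] with t ht ht' ht''
    exact ⟨ht.1.comp t (contMDiffAt_iff_contDiffAt.2 ht''),
      ht'.1.comp t (contMDiffAt_iff_contDiffAt.2 ht'')⟩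
  have hE0 : E 0 = (x, y) := by simp [E, hc0, hr₁, hr₂]
  have hEc : ContinuousAt E 0 :=
    hEs.self_of_nhds.1.continuousAt.prodMk hEs.self_of_nhds.2.continuousAt
  have hEt : Tendsto E (𝓝 0) (𝓝 (x, y)) := by
    have := hEc.tendsto
    rwa [hE0] at this
  have hEU : ∀ᶠ t in 𝓝 0, E t ∈ D.doublePairs := by
    have hopen : ∀ᶠ p : M × M in 𝓝 (x, y), D.height p.1 < D.height p.2 :=
      (isOpen_lt (D.continuous_height.comp continuous_fst)
        (D.continuous_height.comp continuous_snd)).mem_nhds hp.2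
    filter_upwards [hEt.eventually hopen, hrc] with t ht ht'
    exact ⟨ht'.1.trans ht'.2.symm, ht⟩
  have hdc : ∀ᶠ t in 𝓝 0, HasDerivAt c (deriv c t) t := by
    filter_upwards [hcs] with t ht using (ht.differentiableAt hinf).hasDerivAt
  -- The curve runs in both sheets, so its velocity is orthogonal to both normals and therefore a
  -- multiple of their cross product.
  have hperp : ∀ᶠ t in 𝓝 0, ⟪D.normal (E t).1, deriv c t⟫ = 0 ∧
      ⟪D.normal (E t).2, deriv c t⟫ = 0 := by
    filter_upwards [hEs, hrc.eventually_nhds] with t ht ht'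
    constructor
    · have := D.inner_normal_fderiv (ht.1.mdifferentiableAt hinf) 1
      rw [fderiv_apply_one_eq_deriv, Filter.EventuallyEq.deriv_eq (f := c)] at this
      · exact this
      · filter_upwards [ht'] with s hs using hs.1
    · have := D.inner_normal_fderiv (ht.2.mdifferentiableAt hinf) 1
      rw [fderiv_apply_one_eq_deriv, Filter.EventuallyEq.deriv_eq (f := c)] at this
      · exact this
      · filter_upwards [ht'] with s hs using hs.2
  have hdcont : ContinuousAt (deriv c) 0 := by
    have := (hcs.self_of_nhds.fderiv_right (m := 0) (by simp)).continuousAt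
    exact this.clm_apply continuousAt_const
  have hC : ContinuousAt (fun t => cross3 (D.normal (E t).2) (D.normal (E t).1)) 0 :=
    (D.continuous_cross3_normal.continuousAt.comp hEc)
  -- The multiple is positive: `θ (c t) = t` gives `⟪τ, c' 0⟫ = 1`, and positivity persists nearby.
  have hpos : ∀ᶠ t in 𝓝 0,
      0 < ⟪deriv c t, cross3 (D.normal (E t).2) (D.normal (E t).1)⟫ := by
    refine (hdcont.inner hC).eventually (lt_mem_nhds (a := 0) ?_)
    have hd : HasDerivAt (fun t => θ (c t)) ⟪τ, deriv c 0⟫ 0 := by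
      have := (innerSL ℝ τ).hasFDerivAt.comp_hasDerivAt 0 (hdc.self_of_nhds.sub_const q)
      exact this
    have hd' := hd.congr_of_eventuallyEq (f₁ := id) (by
      filter_upwards [hcΘ] with t ht using ht.2.2.symm)
    have := hd'.unique (hasDerivAt_id 0)
    simp only [hE0, ← hτ]
    rw [real_inner_comm, this]; norm_num
  have hdir : ∀ᶠ t in 𝓝 0, 0 < ‖deriv c t‖ ∧ deriv c t = ‖deriv c t‖ • D.doubleDir (E t) := by
    filter_upwards [hperp, hpos, hEU] with t h1 h2 h3
    set C := cross3 (D.normal (E t).2) (D.normal (E t).1) with hCdef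
    have hC0 : C ≠ 0 := D.cross3_normal_ne_zero h3.ne.symm h3.1.symm
    have h4 := smul_eq_of_perp h1.2 h1.1
    rw [← hCdef, real_inner_self_eq_norm_sq] at h4
    have hCn : 0 < ‖C‖ := norm_pos_iff.2 hC0
    have h5 : deriv c t = (⟪deriv c t, C⟫ / ‖C‖ ^ 2) • C := by
      rw [div_eq_inv_mul, mul_smul, ← h4, smul_smul, inv_mul_cancel₀ (by positivity), one_smul]
    have h6 : ‖deriv c t‖ = ⟪deriv c t, C⟫ / ‖C‖ ^ 2 * ‖C‖ := by
      conv_lhs => rw [h5]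
      rw [norm_smul, Real.norm_of_nonneg (by positivity)]
    refine ⟨by rw [h6]; positivity, ?_⟩
    rw [h6, doubleDir, ← hCdef, smul_smul, mul_assoc, mul_inv_cancel₀ hCn.ne', mul_one]
    exact h5
  -- Arc length along `c`; its inverse `μ` produces the unit speed parametrization.
  obtain ⟨ℓ, hℓ0, hℓ⟩ := exists_smooth_primitive (v := fun t => ‖deriv c t‖) (by
    filter_upwards [hcs.eventually_nhds, hdir] with t ht ht'
    refine ContDiffAt.norm ℝ ?_ (norm_pos_iff.1 ht'.1)
    have := ht.self_of_nhds.fderiv_right (m := ∞) (by simp)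
    exact this.clm_apply contDiffAt_const)
  obtain ⟨μ, hμ0, hμl, hμr, hμs⟩ := exists_smooth_local_inverse (f := ℓ) (a := 0)
    (hℓ.mono fun t ht => ht.2) (by
      rw [injective_iff_map_eq_zero]
      intro s hs
      have h1 := hℓ.self_of_nhds.1.hasFDerivAt.fderiv
      rw [h1] at hs
      simpa [hdir.self_of_nhds.1.ne'] using hs) rfl
  rw [hℓ0] at hμ0 hμr hμs
  have hμt : Tendsto μ (𝓝 0) (𝓝 0) := by
    have := hμs.self_of_nhds.continuousAt.tendsto
    rwa [hμ0] at this
  have hμd : ∀ᶠ t in 𝓝 0, HasDerivAt μ (‖deriv c (μ t)‖)⁻¹ t := by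
    filter_upwards [hμr.eventually_nhds, hμt.eventually hℓ, hμs, hμt.eventually hdir]
      with t ht1 ht2 ht3 ht4
    exact HasDerivAt.of_local_left_inverse ht3.continuousAt ht2.1 ht4.1.ne' ht1
  have hlamt : Tendsto (fun p' : M × M => θ (D.proj p'.1)) (𝓝[D.doublePairs] (x, y)) (𝓝 0) := by
    have : ContinuousAt (fun p' : M × M => θ (D.proj p'.1)) (x, y) :=
      (hθ.continuous.comp (D.continuous_proj.comp continuous_fst)).continuousAt
    have h := this.tendsto.mono_left (nhdsWithin_le_nhds (s := D.doublePairs))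
    simpa [θ, ← hq] using h
  refine ⟨fun t => E (μ t), fun z => ℓ (θ z), by simp [hμ0, hE0], ?_, ?_, ?_⟩
  · filter_upwards [hμt.eventually hEU, hμt.eventually hEs, hμs, hμd, hμt.eventually hdir,
      (hμt.eventually hrc.eventually_nhds), hμt.eventually hdc, hμr, hμt.eventually hcΘ]
      with t h1 h2 h3 h4 h5 h6 h7 h8 h9
    refine ⟨h1, h2.1.comp t (contMDiffAt_iff_contDiffAt.2 h3),
      h2.2.comp t (contMDiffAt_iff_contDiffAt.2 h3), ?_, ?_⟩
    · have hd := h7.scomp t h4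
      have heq : (fun t => D.proj (E (μ t)).1) =ᶠ[𝓝 t] c ∘ μ :=
        h3.continuousAt.eventually (h6.mono fun s hs => hs.1)
      refine (hd.congr_of_eventuallyEq heq).congr_deriv ?_
      have h10 := congrArg (fun v => ‖deriv c (μ t)‖⁻¹ • v) h5.2
      simp only [smul_smul, inv_mul_cancel₀ h5.1.ne', one_smul] at h10
      exact h10
    · change ℓ (θ (D.proj (r₁ (c (μ t))))) = t
      rw [h6.self_of_nhds.1, h9.2.2, h8]
  · have hθt : Tendsto θ (𝓝 q) (𝓝 0) := by
      have := hθ.continuous.tendsto q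
      simpa [θ] using this
    filter_upwards [hθt.eventually hℓ] with z hz using hz.2.comp z hθ.contDiffAt
  -- For a double pair near `(x, y)` both functions `g₁` and `g₂` vanish at the common image, so
  -- this image lies on `c` and the retractions recover the pair.
  · have hι1 : Tendsto (fun p' : M × M => (p'.1, (0:ℝ))) (𝓝 (x, y)) (𝓝 (x, 0)) :=
      (continuous_fst.prodMk continuous_const).tendsto (x, y)
    have hι2 : Tendsto (fun p' : M × M => (p'.2, (0:ℝ))) (𝓝 (x, y)) (𝓝 (y, 0)) :=
      (continuous_snd.prodMk continuous_const).tendsto (x, y)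
    have hz : Tendsto (fun p' : M × M => D.proj p'.1) (𝓝 (x, y)) (𝓝 q) :=
      (D.continuous_proj.comp continuous_fst).tendsto (x, y)
    filter_upwards [self_mem_nhdsWithin, nhdsWithin_le_nhds (hι1.eventually h₁'),
      nhdsWithin_le_nhds (hι2.eventually h₂'), nhdsWithin_le_nhds (hz.eventually hψl),
      hlamt.eventually hμl] with p' hp' h1 h2 h3 h4
    simp only [zero_smul, add_zero] at h1 h2
    rw [← show D.proj p'.1 = D.proj p'.2 from hp'.1] at h2
    have h5 : c (θ (D.proj p'.1)) = D.proj p'.1 := by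
      have h6 : Θ (D.proj p'.1) = (0, 0, θ (D.proj p'.1)) := by simp only [Θ, h1.2, h2.2]
      change ψ (0, 0, θ (D.proj p'.1)) = _
      rw [← h6, h3]
    rw [h4]
    simp only [E, h5, h1.1, h2.1]

end RegularDiagram

/-! ### Compact one-dimensional sets as unions of closed curves -/

/-- A family of germs of parametrized curves on the set `U`: through every point of `U` there is
exactly one germ, up to a shift of the parameter its curve stays in the family, and a curve of the
family runs through a neighbourhood in `U` of each of its points. -/
structure IsCurveFamily {X : Type*} [TopologicalSpace X] (U : Set X) (C : (ℝ → X) → ℝ → Prop) :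
    Prop where
  mem : ∀ {δ t}, C δ t → δ t ∈ U
  continuousAt : ∀ {δ t}, C δ t → ContinuousAt δ t
  congr : ∀ {δ δ' t}, C δ t → δ =ᶠ[𝓝 t] δ' → C δ' t
  shift : ∀ {δ t} (a : ℝ), C δ (t + a) → C (fun s => δ (s + a)) t
  unique : ∀ {δ δ' t}, C δ t → C δ' t → δ t = δ' t → δ =ᶠ[𝓝 t] δ'
  eventually_ne : ∀ {δ t}, C δ t → ∀ᶠ s in 𝓝[≠] t, δ s ≠ δ t
  exists_curve : ∀ u ∈ U, ∃ r > 0, ∃ e : ℝ → X, e 0 = u ∧ (∀ t, |t| < r → C e t) ∧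
    ∀ ρ > 0, e '' Ioo (-ρ) ρ ∈ 𝓝[U] u

namespace IsCurveFamily

variable {X : Type*} [TopologicalSpace X] {U : Set X} {C : (ℝ → X) → ℝ → Prop}

/-- The parameters near which the curves agree form an open set by uniqueness of germs, and those
near which they differ form an open set by the Hausdorff property; together the two sets cover `I`.
-/
theorem eqOn [T2Space X] (hC : IsCurveFamily U C) {I : Set ℝ} (hI : IsPreconnected I) {δ δ' : ℝ → X}
    (hδ : ∀ t ∈ I, C δ t) (hδ' : ∀ t ∈ I, C δ' t) {t₀ : ℝ} (ht₀ : t₀ ∈ I) (h : δ t₀ = δ' t₀) :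
    EqOn δ δ' I := by
  have hA : IsOpen {t | ∀ᶠ s in 𝓝 t, δ s = δ' s} := isOpen_setOfPred_eventually_nhds
  have hB : IsOpen {t | ∀ᶠ s in 𝓝 t, δ s ≠ δ' s} := isOpen_setOfPred_eventually_nhds
  have hsub := hI.subset_left_of_subset_union hA hB
    (Set.disjoint_left.2 fun t h1 h2 => h2.self_of_nhds h1.self_of_nhds)
    (fun t ht => by
      by_cases htt : δ t = δ' t
      · exact Or.inl (hC.unique (hδ t ht) (hδ' t ht) htt)
      · exact Or.inr (((hC.continuousAt (hδ t ht)).prodMk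
          (hC.continuousAt (hδ' t ht))).eventually (isClosed_diagonal.isOpen_compl.mem_nhds htt)))
    ⟨t₀, ht₀, hC.unique (hδ t₀ ht₀) (hδ' t₀ ht₀) h⟩
  exact fun t ht => (hsub ht).self_of_nhds

/-- A curve of lifetime `r` through `u` serves, with lifetime `r / 2`, every point on its middle
half, which is a neighbourhood of `u` in `U`; compactness leaves finitely many lifetimes. -/
theorem exists_uniform (hC : IsCurveFamily U C) (hU : IsCompact U) :
    ∃ ρ > 0, ∀ u ∈ U, ∃ e : ℝ → X, e 0 = u ∧ ∀ t, |t| < ρ → C e t := by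
  refine hU.induction_on (p := fun S => ∃ ρ > 0, ∀ u ∈ S, ∃ e : ℝ → X, e 0 = u ∧
    ∀ t, |t| < ρ → C e t) ⟨1, one_pos, by simp⟩ ?_ ?_ ?_
  · rintro s t hst ⟨ρ, hρ, h⟩
    exact ⟨ρ, hρ, fun u hu => h u (hst hu)⟩
  · rintro s t ⟨ρ, hρ, h⟩ ⟨ρ', hρ', h'⟩
    refine ⟨min ρ ρ', lt_min hρ hρ', ?_⟩
    rintro u (hu | hu)
    · obtain ⟨e, he, h2⟩ := h u hu
      exact ⟨e, he, fun t ht => h2 t (ht.trans_le (min_le_left _ _))⟩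
    · obtain ⟨e, he, h2⟩ := h' u hu
      exact ⟨e, he, fun t ht => h2 t (ht.trans_le (min_le_right _ _))⟩
  · intro u hu
    obtain ⟨r, hr, e, he0, he, hn⟩ := hC.exists_curve u hu
    refine ⟨_, hn (r / 2) (by positivity), r / 2, by positivity, ?_⟩
    rintro _ ⟨a, ha, rfl⟩
    refine ⟨fun s => e (s + a), by simp, fun t ht => hC.shift a (he _ ?_)⟩
    rw [abs_lt] at ht ⊢
    constructor <;> linarith [ht.1, ht.2, ha.1, ha.2]

theorem range_subset (hC : IsCurveFamily U C) {E : ℝ → X} (hE : ∀ t, C E t) : range E ⊆ U := by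
  rintro _ ⟨t, rfl⟩; exact hC.mem (hE t)

theorem exists_extension (hC : IsCurveFamily U C) {ρ : ℝ} (hρ : 0 < ρ)
    (hex : ∀ u ∈ U, ∃ e : ℝ → X, e 0 = u ∧ ∀ t, |t| < ρ → C e t) {a : ℝ} (ha : ρ ≤ a) {δ : ℝ → X}
    (hδ : ∀ t, |t| < a → C δ t) : ∃ δ', δ' 0 = δ 0 ∧ ∀ t, |t| < a + ρ / 2 → C δ' t := by
  -- A local curve through `δ b` agrees with `δ` near `b` and lasts until `b + ρ = a + ρ / 2`; the
  -- same gluing is done at `-b`.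
  set b := a - ρ / 2 with hb
  have hb0 : 0 < b := by linarith
  have hb1 : C δ b := hδ b (by rw [abs_of_pos hb0]; linarith)
  have hb2 : C δ (-b) := hδ (-b) (by rw [abs_neg, abs_of_pos hb0]; linarith)
  obtain ⟨e₁, h1, h1'⟩ := hex _ (hC.mem hb1)
  obtain ⟨e₂, h2, h2'⟩ := hex _ (hC.mem hb2)
  have hs1 : ∀ t, |t - b| < ρ → C (fun s => e₁ (s - b)) t := fun t ht => by
    have := hC.shift (δ := e₁) (t := t) (-b) (h1' _ (by rwa [← sub_eq_add_neg]))
    simpa only [← sub_eq_add_neg] using this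
  have hs2 : ∀ t, |t + b| < ρ → C (fun s => e₂ (s + b)) t := fun t ht =>
    hC.shift (δ := e₂) (t := t) b (h2' _ ht)
  have hg1 : δ =ᶠ[𝓝 b] fun s => e₁ (s - b) := hC.unique hb1 (hs1 b (by simpa using hρ)) (by simp [h1])
  have hg2 : δ =ᶠ[𝓝 (-b)] fun s => e₂ (s + b) :=
    hC.unique hb2 (hs2 (-b) (by simpa using hρ)) (by simp [h2])
  refine ⟨fun t => if b < t then e₁ (t - b) else if t < -b then e₂ (t + b) else δ t, ?_, ?_⟩
  · simp [hb0.not_gt]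
  intro t ht
  rw [abs_lt] at ht
  rcases lt_trichotomy t b with htb | rfl | htb
  · rcases lt_trichotomy t (-b) with htb' | rfl | htb'
    · refine hC.congr (hs2 t (by rw [abs_lt]; constructor <;> linarith [ht.1])) ?_
      filter_upwards [gt_mem_nhds htb'] with s hs
      rw [if_neg (by linarith), if_pos hs]
    · refine hC.congr hb2 ?_
      filter_upwards [gt_mem_nhds htb, hg2] with s hs hs'
      rw [if_neg hs.not_gt]
      split_ifs
      exacts [hs', rfl]
    · refine hC.congr (hδ t (by rw [abs_lt]; constructor <;> linarith)) ?_
      filter_upwards [gt_mem_nhds htb, lt_mem_nhds htb'] with s hs hs'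
      rw [if_neg hs.not_gt, if_neg hs'.not_gt]
  · refine hC.congr hb1 ?_
    filter_upwards [lt_mem_nhds (show -b < b by linarith), hg1] with s hs hs'
    rw [if_neg hs.not_gt]
    split_ifs
    exacts [hs', rfl]
  · refine hC.congr (hs1 t (by rw [abs_lt]; constructor <;> linarith [ht.2])) ?_
    filter_upwards [lt_mem_nhds htb] with s hs
    rw [if_pos hs]

variable [T2Space X]

theorem exists_global (hC : IsCurveFamily U C) (hU : IsCompact U) {u : X} (hu : u ∈ U) :
    ∃ E : ℝ → X, E 0 = u ∧ ∀ t, C E t := by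
  obtain ⟨ρ, hρ, hex⟩ := hC.exists_uniform hU
  have h1 : ∀ n : ℕ, ∃ δ : ℝ → X, δ 0 = u ∧ ∀ t, |t| < ρ + n * (ρ / 2) → C δ t := by
    intro n
    induction n with
    | zero => simpa using hex u hu
    | succ n ih =>
      obtain ⟨δ, hδ0, hδ⟩ := ih
      obtain ⟨δ', h0, h'⟩ := hC.exists_extension hρ hex (le_add_of_nonneg_right (by positivity)) hδ
      refine ⟨δ', h0.trans hδ0, fun t ht => h' t (ht.trans_eq ?_)⟩
      push_cast; ring
  have h2 : ∀ n : ℕ, ∃ δ : ℝ → X, δ 0 = u ∧ ∀ t ∈ Ioo (-(n : ℝ)) n, C δ t := by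
    intro n
    obtain ⟨m, hm⟩ := exists_nat_gt ((n : ℝ) / (ρ / 2))
    obtain ⟨δ, hδ0, hδ⟩ := h1 m
    refine ⟨δ, hδ0, fun t ht => hδ t ?_⟩
    rw [div_lt_iff₀ (by positivity)] at hm
    have := abs_lt.2 ht
    linarith
  choose δ hδ0 hδ using h2
  have hagree : ∀ m n : ℕ, ∀ t : ℝ, |t| < m → |t| < n → δ m t = δ n t := by
    intro m n t hm hn
    have hmn : |t| < min (m : ℝ) n := lt_min hm hn
    have h0 : (0 : ℝ) < min (m : ℝ) n := (abs_nonneg t).trans_lt hmn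
    refine hC.eqOn (I := Ioo (-(min (m : ℝ) n)) (min (m : ℝ) n)) isPreconnected_Ioo ?_ ?_
      (t₀ := 0) (by simpa using h0) ((hδ0 m).trans (hδ0 n).symm) (abs_lt.1 hmn)
    · intro s hs
      refine hδ m s ?_
      have := min_le_left (m : ℝ) n
      exact ⟨by linarith [hs.1], by linarith [hs.2]⟩
    · intro s hs
      refine hδ n s ?_
      have := min_le_right (m : ℝ) n
      exact ⟨by linarith [hs.1], by linarith [hs.2]⟩
  have hceil : ∀ t : ℝ, |t| < ((⌈|t|⌉₊ + 1 : ℕ) : ℝ) := fun t => by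
    push_cast; linarith [Nat.le_ceil |t|]
  -- The added `1` makes the index strictly larger than `|t|`, so that the chosen curve is in the
  -- family at `t` and agrees with the other choices near `t`.
  refine ⟨fun t => δ (⌈|t|⌉₊ + 1) t, hδ0 _, fun t => ?_⟩
  refine hC.congr (hδ (⌈|t|⌉₊ + 1) t (abs_lt.1 (hceil t))) ?_
  have : ∀ᶠ s in 𝓝 t, |s| < ((⌈|t|⌉₊ + 1 : ℕ) : ℝ) :=
    continuous_abs.continuousAt.eventually (gt_mem_nhds (hceil t))
  filter_upwards [this] with s hs
  exact hagree _ _ s hs (hceil s)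

/-- Global curves behave like the orbits of a flow: after shifts that put the common point at
parameter `0`, they agree everywhere. -/
theorem shift_eq (hC : IsCurveFamily U C) {E F : ℝ → X} (hE : ∀ t, C E t) (hF : ∀ t, C F t)
    {s t : ℝ} (h : E s = F t) (a : ℝ) : E (s + a) = F (t + a) := by
  have := hC.eqOn (I := univ) isPreconnected_univ (δ := fun a => E (a + s)) (δ' := fun a => F (a + t))
    (fun a _ => hC.shift s (hE _)) (fun a _ => hC.shift t (hF _)) (mem_univ 0) (by simpa using h)
    (mem_univ a)
  simpa only [add_comm] using this

theorem image_mem_nhdsWithin (hC : IsCurveFamily U C) {E : ℝ → X} (hE : ∀ t, C E t) (t : ℝ)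
    {ρ : ℝ} (hρ : 0 < ρ) : E '' Ioo (t - ρ) (t + ρ) ∈ 𝓝[U] (E t) := by
  obtain ⟨r, hr, e, he0, he, hn⟩ := hC.exists_curve (E t) (hC.mem (hE t))
  refine mem_of_superset (hn (min r ρ) (lt_min hr hρ)) ?_
  rintro _ ⟨a, ha, rfl⟩
  have h1 := min_le_left r ρ
  have h2 := min_le_right r ρ
  have : (fun a => E (a + t)) a = e a := by
    refine hC.eqOn (I := Ioo (-(min r ρ)) (min r ρ)) isPreconnected_Ioo
      (fun a _ => hC.shift t (hE _)) (fun a ha => he a ?_) (t₀ := 0) ?_ (by simp [he0]) ha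
    · rw [abs_lt]; constructor <;> linarith [ha.1, ha.2]
    · simp [hr, hρ]
  rw [← this]
  exact ⟨a + t, ⟨by linarith [ha.1], by linarith [ha.2]⟩, rfl⟩

theorem range_eq (hC : IsCurveFamily U C) {E F : ℝ → X} (hE : ∀ t, C E t) (hF : ∀ t, C F t)
    {s t : ℝ} (h : E s = F t) : range E = range F := by
  apply Subset.antisymm
  · rintro _ ⟨a, rfl⟩
    refine ⟨t + (a - s), ?_⟩
    rw [← hC.shift_eq hE hF h, add_sub_cancel]
  · rintro _ ⟨a, rfl⟩
    refine ⟨s + (a - t), ?_⟩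
    rw [hC.shift_eq hE hF h, add_sub_cancel]

theorem range_mem_nhdsWithin (hC : IsCurveFamily U C) {E : ℝ → X} (hE : ∀ t, C E t) (t : ℝ) :
    range E ∈ 𝓝[U] (E t) :=
  mem_of_superset (hC.image_mem_nhdsWithin hE t one_pos) (image_subset_range _ _)

/-- Orbits are relatively open in `U` and disjoint or equal, so the complement of an orbit in `U` is
relatively open too. -/
theorem isCompact_range (hC : IsCurveFamily U C) (hU : IsCompact U) {E : ℝ → X}
    (hE : ∀ t, C E t) : IsCompact (range E) := by
  refine hU.of_isClosed_subset ?_ (hC.range_subset hE)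
  rw [← isOpen_compl_iff, isOpen_iff_mem_nhds]
  intro v hv
  by_cases hvU : v ∈ U
  · obtain ⟨F, hF0, hF⟩ := hC.exists_global hU hvU
    have h1 := hC.range_mem_nhdsWithin hF 0
    rw [hF0, mem_nhdsWithin_iff_exists_mem_nhds_inter] at h1
    obtain ⟨N, hN, hsub⟩ := h1
    filter_upwards [hN] with w hw hwE
    obtain ⟨a, ha⟩ := hsub ⟨hw, hC.range_subset hE hwE⟩
    obtain ⟨b, hb⟩ := hwE
    exact hv (hC.range_eq hE hF (hb.trans ha.symm) ▸ ⟨0, hF0⟩)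
  · filter_upwards [hU.isClosed.isOpen_compl.mem_nhds hvU] with w hw hwE
    exact hw (hC.range_subset hE hwE)

/-- Compactness of the orbit forces a bounded interval to cover it, which yields a nonzero period.
Since the curve does not return to a point at once, `0` is isolated in the group of periods, which
is then infinite cyclic. -/
theorem exists_period (hC : IsCurveFamily U C) (hU : IsCompact U) {E : ℝ → X}
    (hE : ∀ t, C E t) :
    ∃ T > 0, Function.Periodic E T ∧ ∀ s t, E s = E t → ∃ m : ℤ, t = s + m * T := by
  have h1 : ∃ n : ℕ, range E ⊆ E '' Ioo (-(n : ℝ)) n := by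
    refine (hC.isCompact_range hU hE).induction_on
      (p := fun S => ∃ n : ℕ, S ⊆ E '' Ioo (-(n : ℝ)) n) ⟨0, empty_subset _⟩ ?_ ?_ ?_
    · rintro s t hst ⟨n, hn⟩
      exact ⟨n, hst.trans hn⟩
    · rintro s t ⟨n, hn⟩ ⟨m, hm⟩
      refine ⟨max n m, union_subset (hn.trans (image_mono ?_)) (hm.trans (image_mono ?_))⟩
      · apply Ioo_subset_Ioo <;> simp
      · apply Ioo_subset_Ioo <;> simp
    · rintro _ ⟨t, rfl⟩
      refine ⟨_, nhdsWithin_mono _ (hC.range_subset hE) (hC.image_mem_nhdsWithin hE t one_pos),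
        ⌈|t|⌉₊ + 1, image_mono ?_⟩
      have h2 := Nat.le_ceil |t|
      have h3 := neg_abs_le t
      have h4 := le_abs_self t
      push_cast
      apply Ioo_subset_Ioo <;> linarith
  obtain ⟨n, hn⟩ := h1
  -- The endpoint `n` is not in the open interval, so `E n` is also attained at some `t₁ < n`, and
  -- `n - t₁` is a nonzero period.
  obtain ⟨t₁, ht₁, h2⟩ := hn ⟨n, rfl⟩
  let G : AddSubgroup ℝ :=
    { carrier := {a | Function.Periodic E a}
      zero_mem' := fun t => by simp
      add_mem' := fun {a b} ha hb => Function.Periodic.add_period ha hb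
      neg_mem' := fun {a} ha => Function.Periodic.neg ha }
  have hG : ∀ s t, E s = E t → t - s ∈ G := fun s t h a => by
    have := hC.shift_eq hE hE h (a - s)
    rw [add_sub_cancel] at this
    rw [this]; congr 1; ring
  obtain ⟨r, hr, hrG⟩ : ∃ r > 0, Disjoint (G : Set ℝ) (Ioo 0 r) := by
    have := hC.eventually_ne (hE 0)
    rw [eventually_nhdsWithin_iff, Metric.eventually_nhds_iff_ball] at this
    obtain ⟨r, hr, h⟩ := this
    refine ⟨r, hr, Set.disjoint_left.2 fun a haG ha => ?_⟩
    refine h a ?_ ha.1.ne' ?_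
    · rw [Metric.mem_ball, Real.dist_eq, sub_zero, abs_of_pos ha.1]; exact ha.2
    · have := haG 0
      rwa [zero_add] at this
  obtain ⟨b, hb⟩ := AddSubgroup.cyclic_of_isolated_zero hr hrG
  have hbG : b ∈ G := hb ▸ AddSubgroup.subset_closure rfl
  have hb0 : b ≠ 0 := by
    rintro rfl
    have h3 : (n : ℝ) - t₁ ∈ G := hG _ _ h2
    rw [hb, AddSubgroup.mem_closure_singleton] at h3
    obtain ⟨m, hm⟩ := h3
    rw [smul_zero] at hm
    linarith [ht₁.2]
  have hall : ∀ s t, E s = E t → ∃ m : ℤ, t = s + m * b := fun s t h => by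
    have h3 := hG s t h
    rw [hb, AddSubgroup.mem_closure_singleton] at h3
    obtain ⟨m, hm⟩ := h3
    refine ⟨m, ?_⟩
    rw [zsmul_eq_mul] at hm
    linarith
  rcases hb0.lt_or_gt with hlt | hgt
  · refine ⟨-b, by linarith, Function.Periodic.neg hbG, fun s t h => ?_⟩
    obtain ⟨m, hm⟩ := hall s t h
    exact ⟨-m, by push_cast; linarith⟩
  · exact ⟨b, hgt, hbG, hall⟩

/-- The set `U` is the union of finitely many disjoint closed curves. -/
theorem exists_closed_curves (hC : IsCurveFamily U C) (hU : IsCompact U) :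
    ∃ (n : ℕ) (γ : Fin n → ℝ → X) (T : Fin n → ℝ), (∀ i, 0 < T i) ∧ (∀ i t, C (γ i) t) ∧
      (∀ i, Function.Periodic (γ i) (T i)) ∧ (∀ u ∈ U, ∃ i t, γ i t = u) ∧
      ∀ i s j t, γ i s = γ j t → i = j ∧ ∃ m : ℤ, t = s + m * T i := by
  classical
  choose E hE0 hE using fun u : U => hC.exists_global hU u.2
  have hself : ∀ u : U, (u : X) ∈ range (E u) := fun u => ⟨0, hE0 u⟩
  obtain ⟨F, hF⟩ := hU.elim_nhdsWithin_subcover' (fun u hu => range (E ⟨u, hu⟩))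
    (fun u hu => by
      have := hC.range_mem_nhdsWithin (hE ⟨u, hu⟩) 0
      rwa [hE0] at this)
  have hrep : ∀ u : U, ∃ v : U, (v : X) ∈ range (E u) := fun u => ⟨u, hself u⟩
  -- One chosen point for each orbit, depending on the orbit only; `u` is a default value for sets
  -- that miss `U`. The finite subcover may contain an orbit several times, and passing to
  -- representatives removes the repetitions.
  let rep : Set X → U → U := fun S u => if h : ∃ v : U, (v : X) ∈ S then h.choose else u
  have hrep1 : ∀ u w, ((rep (range (E u)) w : U) : X) ∈ range (E u) := fun u w => by
    simp only [rep, dif_pos (hrep u)]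
    exact (hrep u).choose_spec
  have hrep2 : ∀ u w w', rep (range (E u)) w = rep (range (E u)) w' := fun u w w' => by
    simp only [rep, dif_pos (hrep u)]
  have hrange : ∀ u v : U, (v : X) ∈ range (E u) → range (E v) = range (E u) := by
    rintro u v ⟨t, ht⟩
    exact hC.range_eq (hE v) (hE u) ((hE0 v).trans ht.symm)
  let R : Finset U := F.image fun u => rep (range (E u)) u
  choose T hT0 hTp hTs using fun u : U => hC.exists_period hU (hE u)
  let φ := R.equivFin.symm
  refine ⟨R.card, fun i => E (φ i).1, fun i => T (φ i).1, fun i => hT0 _, fun i => hE _,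
    fun i => hTp _, ?_, ?_⟩
  · intro u hu
    have := hF hu
    rw [mem_iUnion₂] at this
    obtain ⟨v, hv, huv⟩ := this
    let w : R := ⟨rep (range (E v)) v, Finset.mem_image.2 ⟨v, hv, rfl⟩⟩
    rw [← hrange v w.1 (hrep1 v v)] at huv
    obtain ⟨t, ht⟩ := huv
    exact ⟨φ.symm w, t, by simpa using ht⟩
  · intro i s j t h
    have hij : i = j := by
      apply φ.injective
      apply Subtype.ext
      have hr := hC.range_eq (hE _) (hE _) h
      obtain ⟨u, -, hu⟩ := Finset.mem_image.1 (φ i).2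
      obtain ⟨v, -, hv⟩ := Finset.mem_image.1 (φ j).2
      have h1 := hrange u (φ i).1 (hu ▸ hrep1 u u)
      have h2 := hrange v (φ j).1 (hv ▸ hrep1 v v)
      rw [← hu, ← hv, ← h1, ← h2, hr]
      exact hrep2 _ _ _
    subst hij
    exact ⟨rfl, hTs _ s t h⟩

end IsCurveFamily

/-! ### Closed parametrizations of the double point curves -/

namespace RegularDiagram

variable {M : Type u} [TopologicalSpace M] [ChartedSpace (EuclideanSpace ℝ (Fin 2)) M]
  (D : RegularDiagram M)

/-- The retraction of a tubular neighbourhood is a left inverse of the projection near `x`. -/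
theorem eventually_proj_injective [IsManifold (𝓡 2) ∞ M] (x : M) :
    ∀ᶠ p : M × M in 𝓝 (x, x), D.proj p.1 = D.proj p.2 → p.1 = p.2 := by
  obtain ⟨r, g, -, -, h⟩ := D.exists_sheet_retraction x
  have h1 : Tendsto (fun p : M × M => (p.1, (0 : ℝ))) (𝓝 (x, x)) (𝓝 (x, 0)) :=
    (continuous_fst.prodMk continuous_const).tendsto (x, x)
  have h2 : Tendsto (fun p : M × M => (p.2, (0 : ℝ))) (𝓝 (x, x)) (𝓝 (x, 0)) :=
    (continuous_snd.prodMk continuous_const).tendsto (x, x)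
  filter_upwards [h1.eventually h, h2.eventually h] with p hp hp' heq
  simp only [zero_smul, add_zero] at hp hp'
  rw [← hp.1, ← hp'.1, heq]

/-- The strict inequality of heights is not a closed condition by itself. A limit pair with equal
heights would be diagonal, since the surface is embedded in ℝ⁴, and near the diagonal the projection
is injective. -/
theorem isClosed_doublePairs [IsManifold (𝓡 2) ∞ M] : IsClosed D.doublePairs := by
  rw [← isOpen_compl_iff, isOpen_iff_eventually]
  rintro ⟨x, y⟩ hp
  by_cases hxy : D.proj x = D.proj y
  · rcases lt_trichotomy (D.height x) (D.height y) with h | h | h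
    · exact absurd ⟨hxy, h⟩ hp
    · obtain rfl : x = y := D.injective (Prod.ext hxy h)
      filter_upwards [D.eventually_proj_injective x] with p hp' hpU
      exact hpU.ne (hp' hpU.1)
    · have : ∀ᶠ p : M × M in 𝓝 (x, y), D.height p.2 < D.height p.1 :=
        (isOpen_lt (D.continuous_height.comp continuous_snd)
          (D.continuous_height.comp continuous_fst)).mem_nhds h
      filter_upwards [this] with p hp' hpU
      exact lt_asymm hp' hpU.2
  · have : ∀ᶠ p : M × M in 𝓝 (x, y), D.proj p.1 ≠ D.proj p.2 :=
      (isOpen_ne_fun (D.continuous_proj.comp continuous_fst)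
        (D.continuous_proj.comp continuous_snd)).mem_nhds hxy
    filter_upwards [this] with p hp' hpU using hp' hpU.1

/-- The germs of unit speed parametrizations of the double point curves. -/
def IsUnitDoubleCurve (δ : ℝ → M × M) (t : ℝ) : Prop :=
  ∀ᶠ s in 𝓝 t, δ s ∈ D.doublePairs ∧ ContinuousAt δ s ∧
    HasDerivAt (fun t => D.proj (δ t).1) (D.doubleDir (δ s)) s

variable {D}

theorem IsUnitDoubleCurve.congr {δ δ' : ℝ → M × M} {t : ℝ} (h : D.IsUnitDoubleCurve δ t)
    (hδ : δ =ᶠ[𝓝 t] δ') : D.IsUnitDoubleCurve δ' t := by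
  filter_upwards [h, hδ.eventually_nhds] with s hs hs'
  have hs'' := hs'.self_of_nhds
  refine ⟨hs'' ▸ hs.1, hs.2.1.congr hs', ?_⟩
  rw [← hs'']
  refine hs.2.2.congr_of_eventuallyEq ?_
  filter_upwards [hs'] with a ha
  rw [ha]

theorem IsUnitDoubleCurve.shift {δ : ℝ → M × M} {t : ℝ} (a : ℝ)
    (h : D.IsUnitDoubleCurve δ (t + a)) : D.IsUnitDoubleCurve (fun s => δ (s + a)) t := by
  have hc : ∀ s : ℝ, ContinuousAt (fun s : ℝ => s + a) s := fun s => by fun_prop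
  filter_upwards [(hc t).eventually h] with s hs
  refine ⟨hs.1, ContinuousAt.comp (f := fun s : ℝ => s + a) (x := s) hs.2.1 (hc s), ?_⟩
  exact hs.2.2.comp_add_const s a

/-- Read the position of `δ s` on the model curve `e` as `f s = lam (proj (δ s).1)`. Both curves
follow the same velocity field and `lam` inverts `proj ∘ e`, so `f' = 1` and `f s = s - t`. -/
theorem IsUnitDoubleCurve.eventually_eq_local {p : M × M} {e : ℝ → M × M}
    {lam : E3 → ℝ}
    (he : ∀ᶠ t in 𝓝 0, HasDerivAt (fun t => D.proj (e t).1) (D.doubleDir (e t)) t ∧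
        lam (D.proj (e t).1) = t)
    (hlam : ∀ᶠ z in 𝓝 (D.proj p.1), ContDiffAt ℝ ∞ lam z)
    (hinv : ∀ᶠ p' in 𝓝[D.doublePairs] p, e (lam (D.proj p'.1)) = p') (he0 : e 0 = p)
    {δ : ℝ → M × M} {t : ℝ} (h : D.IsUnitDoubleCurve δ t) (hδ : δ t = p) :
    δ =ᶠ[𝓝 t] fun s => e (s - t) := by
  have hδc : Tendsto δ (𝓝 t) (𝓝 p) := by
    have := h.self_of_nhds.2.1.tendsto
    rwa [hδ] at this
  have hδU : Tendsto δ (𝓝 t) (𝓝[D.doublePairs] p) :=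
    tendsto_nhdsWithin_iff.2 ⟨hδc, h.mono fun s hs => hs.1⟩
  have hproj : Tendsto (fun s => D.proj (δ s).1) (𝓝 t) (𝓝 (D.proj p.1)) :=
    ((D.continuous_proj.comp continuous_fst).tendsto p).comp hδc
  have hlam0 : lam (D.proj p.1) = 0 := by
    have := he.self_of_nhds.2
    rwa [he0] at this
  set f : ℝ → ℝ := fun s => lam (D.proj (δ s).1) with hf
  have hfc : Tendsto f (𝓝 t) (𝓝 0) := by
    have := hlam.self_of_nhds.continuousAt.tendsto
    rw [hlam0] at this
    exact this.comp hproj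
  have hfd : ∀ᶠ s in 𝓝 t, HasDerivAt f 1 s := by
    filter_upwards [h, hδU.eventually hinv, hproj.eventually hlam,
      hfc.eventually he.eventually_nhds] with s h1 h2 h3 h4
    have hl := (h3.differentiableAt (by simp)).hasFDerivAt
    have h5 := hl.comp_hasDerivAt s h1.2.2
    have heq : D.proj (e (f s)).1 = D.proj (δ s).1 := by rw [h2]
    have hl' : HasFDerivAt lam (fderiv ℝ lam (D.proj (δ s).1)) (D.proj (e (f s)).1) := by
      rw [heq]; exact hl
    have h6 := hl'.comp_hasDerivAt (f s) h4.self_of_nhds.1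
    have h7 := h6.congr_of_eventuallyEq (f₁ := id) (h4.mono fun a ha => ha.2.symm)
    have h8 := h7.unique (hasDerivAt_id _)
    rw [show e (f s) = δ s from h2] at h8
    rw [h8] at h5
    exact h5
  have hfs : ∀ᶠ s in 𝓝 t, f s = s - t := by
    obtain ⟨a, ha, hd⟩ := Metric.eventually_nhds_iff_ball.1 hfd
    filter_upwards [Metric.ball_mem_nhds t ha] with s hs
    have hft : f t = 0 := by simp [hf, hδ, hlam0]
    have := (convex_ball t a).is_const_of_fderivWithin_eq_zero (𝕜 := ℝ) (f := fun s => f s - s)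
      (fun s hs => ((hd s hs).sub (hasDerivAt_id s)).differentiableAt.differentiableWithinAt)
      (fun s hs => by
        rw [fderivWithin_of_isOpen Metric.isOpen_ball hs]
        ext
        have := ((hd s hs).sub (hasDerivAt_id s)).hasFDerivAt.fderiv
        rw [show fderiv ℝ (fun s => f s - s) s = _ from this]
        simp) hs (Metric.mem_ball_self ha)
    simp only [hft] at this
    linarith
  filter_upwards [hδU.eventually hinv, hfs] with s h1 h2
  rw [← h2, ← h1]

theorem isCurveFamily_doublePairs [IsManifold (𝓡 2) ∞ M] :
    IsCurveFamily D.doublePairs D.IsUnitDoubleCurve where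
  mem h := h.self_of_nhds.1
  continuousAt h := h.self_of_nhds.2.1
  congr h h' := h.congr h'
  shift a h := h.shift a
  unique {δ δ' t} h h' heq := by
    obtain ⟨e, lam, he0, he, hlam, hinv⟩ := D.exists_local_double_curve h.self_of_nhds.1
    have he' := he.mono fun t ht => ht.2.2.2
    exact (h.eventually_eq_local he' hlam hinv he0 rfl).trans
      (h'.eventually_eq_local he' hlam hinv he0 heq.symm).symm
  eventually_ne {δ t} h := by
    have hd := h.self_of_nhds
    have hne : D.doubleDir (δ t) ≠ 0 := by
      rw [← norm_ne_zero_iff, D.norm_doubleDir hd.1]; exact one_ne_zero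
    filter_upwards [hd.2.2.eventually_ne hne (c := D.proj (δ t).1)] with s hs hs'
    exact hs (by rw [hs'])
  exists_curve p hp := by
    obtain ⟨e, lam, he0, he, hlam, hinv⟩ := D.exists_local_double_curve hp
    have heC : ∀ᶠ t in 𝓝 0, D.IsUnitDoubleCurve e t := by
      filter_upwards [he.eventually_nhds] with t ht
      filter_upwards [ht] with s hs
      exact ⟨hs.1, hs.2.1.continuousAt.prodMk hs.2.2.1.continuousAt, hs.2.2.2.1⟩
    obtain ⟨r, hr, h⟩ := Metric.eventually_nhds_iff_ball.1 heC
    refine ⟨r, hr, e, he0, fun t ht => h t (by simpa using ht), fun ρ hρ => ?_⟩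
    have hlam0 : lam (D.proj p.1) = 0 := by
      have := he.self_of_nhds.2.2.2.2
      rwa [he0] at this
    have hc : Tendsto (fun p' : M × M => lam (D.proj p'.1)) (𝓝[D.doublePairs] p) (𝓝 0) := by
      have h1 := hlam.self_of_nhds.continuousAt.tendsto
      rw [hlam0] at h1
      exact h1.comp (((D.continuous_proj.comp continuous_fst).tendsto p).mono_left
        nhdsWithin_le_nhds)
    filter_upwards [hinv, hc.eventually (Ioo_mem_nhds (neg_lt_zero.2 hρ) hρ)] with p' h1 h2
    exact ⟨_, h2, h1⟩

theorem IsUnitDoubleCurve.contMDiffAt [IsManifold (𝓡 2) ∞ M] {δ : ℝ → M × M} {t : ℝ}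
    (h : D.IsUnitDoubleCurve δ t) : ContMDiffAt 𝓘(ℝ, ℝ) (𝓡 2) ∞ (fun t => (δ t).1) t ∧
      ContMDiffAt 𝓘(ℝ, ℝ) (𝓡 2) ∞ (fun t => (δ t).2) t := by
  obtain ⟨e, lam, he0, he, hlam, hinv⟩ := D.exists_local_double_curve h.self_of_nhds.1
  have heq := h.eventually_eq_local (he.mono fun t ht => ht.2.2.2) hlam hinv he0 rfl
  have h0 := he.self_of_nhds
  have hs : ContMDiffAt 𝓘(ℝ, ℝ) 𝓘(ℝ, ℝ) ∞ (fun s : ℝ => s - t) t :=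
    (contDiff_id.sub contDiff_const).contMDiff.contMDiffAt
  have h1 : ContMDiffAt 𝓘(ℝ, ℝ) (𝓡 2) ∞ (fun t => (e t).1) (t - t) := by
    rw [sub_self]; exact h0.2.1
  have h2 : ContMDiffAt 𝓘(ℝ, ℝ) (𝓡 2) ∞ (fun t => (e t).2) (t - t) := by
    rw [sub_self]; exact h0.2.2.1
  constructor
  · refine (ContMDiffAt.comp (f := fun s => s - t) t h1 hs).congr_of_eventuallyEq ?_
    filter_upwards [heq] with s hs
    rw [hs]; rfl
  · refine (ContMDiffAt.comp (f := fun s => s - t) t h2 hs).congr_of_eventuallyEq ?_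
    filter_upwards [heq] with s hs
    rw [hs]; rfl

variable (D)

/-- The double point curves of a diagram have a regular parametrization, with the orientation for
which the normal direction in the lower sheet matches the normal of the upper sheet. -/
theorem exists_parametrization [IsManifold (𝓡 2) ∞ M] [T2Space M] [CompactSpace M] :
    ∃ (n : ℕ) (low up : Fin n → ℝ → M), D.ParametrizesDoubleCurves low up ∧
      ∀ i t, ∃ κ > 0, deriv (fun r => D.proj (low i r)) t =
        (κ : ℝ) • cross3 (D.normal (up i t)) (D.normal (low i t)) := by
  obtain ⟨n, γ, T, hT, hγ, hper, hsurj, hinj⟩ :=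
    (isCurveFamily_doublePairs (D := D)).exists_closed_curves D.isClosed_doublePairs.isCompact
  have hmul : ∀ i, ContMDiff 𝓘(ℝ, ℝ) 𝓘(ℝ, ℝ) ∞ fun t : ℝ => t * T i := fun i =>
    (contDiff_id.mul contDiff_const).contMDiff
  have hper' : ∀ i t, γ i ((t + 1) * T i) = γ i (t * T i) := fun i t => by
    rw [add_mul, one_mul]; exact hper i _
  have hder : ∀ i t, HasDerivAt (fun r => D.proj (γ i (r * T i)).1)
      (T i • D.doubleDir (γ i (t * T i))) t := fun i t => by
    have h1 := (hγ i (t * T i)).self_of_nhds.2.2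
    have h2 : HasDerivAt (fun r : ℝ => r * T i) (T i) t := by
      simpa using (hasDerivAt_id t).mul_const (T i)
    exact h1.scomp t h2
  -- Rescaling by the minimal period turns `T i`-periodic curves into curves parametrized by `ℝ /
  -- ℤ`.
  refine ⟨n, fun i t => (γ i (t * T i)).1, fun i t => (γ i (t * T i)).2, ⟨?_, ?_, ?_, ?_, ?_, ?_,
    ?_, ?_⟩, ?_⟩
  · exact fun i t => ContMDiffAt.comp (f := fun t => t * T i) t
      (hγ i (t * T i)).contMDiffAt.1 (hmul i t)
  · exact fun i t => ContMDiffAt.comp (f := fun t => t * T i) t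
      (hγ i (t * T i)).contMDiffAt.2 (hmul i t)
  · exact fun i t => by simp only [hper']
  · exact fun i t => by simp only [hper']
  · intro i t
    rw [(hder i t).deriv, ← norm_ne_zero_iff, norm_smul,
      D.norm_doubleDir (hγ i _).self_of_nhds.1, mul_one, norm_ne_zero_iff]
    exact (hT i).ne'
  · exact fun i t => (hγ i _).self_of_nhds.1
  · intro x y hxy
    obtain ⟨i, t, h⟩ := hsurj (x, y) hxy
    refine ⟨i, t / T i, ?_⟩
    simp only [div_mul_cancel₀ _ (hT i).ne', h, and_self]
  · intro i s j t h1 h2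
    obtain ⟨rfl, m, hm⟩ := hinj i (s * T i) j (t * T j) (Prod.ext h1 h2)
    refine ⟨rfl, m, ?_⟩
    have : t * T i = (s + m) * T i := by rw [hm]; ring
    exact mul_right_cancel₀ (hT i).ne' this
  · intro i t
    have hU := (hγ i (t * T i)).self_of_nhds.1
    refine ⟨T i * ‖cross3 (D.normal (γ i (t * T i)).2) (D.normal (γ i (t * T i)).1)‖⁻¹, ?_, ?_⟩
    · have := norm_pos_iff.2 (D.cross3_normal_ne_zero hU.ne.symm hU.1.symm)
      have := hT i
      positivity
    · rw [(hder i t).deriv, doubleDir, smul_smul]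

end RegularDiagram

/-! ### Pushing the surface against the upper normals -/

namespace RegularDiagram

variable {M : Type u} [TopologicalSpace M] [ChartedSpace (EuclideanSpace ℝ (Fin 2)) M]
  (D : RegularDiagram M)

/-- The initial velocity in `ℝ³` of a family of maps of the surface to itself. -/
noncomputable def pushVelocity (Φ : ℝ × M → M) (p : M) : E3 := deriv (fun s => D.proj (Φ (s, p))) 0

/-- A smooth family, for small times, of maps of the surface to itself that starts at the identity
and does not move the lower disks towards the normal direction of the upper disks. -/
structure IsPush (Φ : ℝ × M → M) : Prop where
  smooth : ∀ p, ∀ᶠ q in 𝓝 ((0 : ℝ), p), ContMDiffAt (𝓘(ℝ, ℝ).prod (𝓡 2)) (𝓡 2) ∞ Φ q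
  zero : ∀ p, Φ (0, p) = p
  nonpos : ∀ p ∈ D.doublePairs, ⟪D.pushVelocity Φ p.1, D.normal p.2⟫ ≤ 0

variable {D}

theorem IsPush.tendsto {Φ : ℝ × M → M} (h : D.IsPush Φ) (p : M) :
    Tendsto Φ (𝓝 (0, p)) (𝓝 p) := by
  have := (h.smooth p).self_of_nhds.continuousAt.tendsto
  rwa [h.zero] at this

theorem IsPush.contMDiffAt_time {Φ : ℝ × M → M} (h : D.IsPush Φ) (p : M) :
    ContMDiffAt 𝓘(ℝ, ℝ) (𝓡 2) ∞ (fun s => Φ (s, p)) 0 :=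
  ContMDiffAt.comp (f := fun s : ℝ => (s, p)) 0 (h.smooth p).self_of_nhds
    (contMDiffAt_id.prodMk contMDiffAt_const)

theorem IsPush.hasDerivAt {Φ : ℝ × M → M} (h : D.IsPush Φ) (p : M) :
    HasDerivAt (fun s => D.proj (Φ (s, p))) (D.pushVelocity Φ p) 0 :=
  ((D.contDiffAt_proj_comp le_rfl (h.contMDiffAt_time p)).differentiableAt (by simp)).hasDerivAt

theorem IsPush.inner_normal {Φ : ℝ × M → M} (h : D.IsPush Φ) (p : M) :
    ⟪D.normal p, D.pushVelocity Φ p⟫ = 0 := by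
  have := D.inner_normal_fderiv ((h.contMDiffAt_time p).mdifferentiableAt (by simp)) 1
  rwa [h.zero, fderiv_apply_one_eq_deriv] at this

/-- A local expression of a push in `ℝ³`. -/
theorem IsPush.contDiffAt_local {Φ : ℝ × M → M} (h : D.IsPush Φ) {p : M} {r : E3 → M}
    (hr0 : r (D.proj p) = p)
    (hr : ∀ᶠ z in 𝓝 (D.proj p), ContMDiffAt 𝓘(ℝ, E3) (𝓡 2) ∞ r z) :
    ∀ᶠ q in 𝓝 ((0 : ℝ), D.proj p), ContDiffAt ℝ ∞ (fun q : ℝ × E3 => D.proj (Φ (q.1, r q.2))) q := by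
  have hc : Tendsto (fun q : ℝ × E3 => (q.1, r q.2)) (𝓝 (0, D.proj p)) (𝓝 (0, p)) := by
    have h1 : ContinuousAt (fun q : ℝ × E3 => r q.2) (0, D.proj p) :=
      ContinuousAt.comp (f := Prod.snd) (x := ((0 : ℝ), D.proj p)) hr.self_of_nhds.continuousAt
        continuousAt_snd
    have := (continuousAt_fst.prodMk h1).tendsto
    simpa [hr0] using this
  filter_upwards [hc.eventually (h.smooth p), (continuousAt_snd
    (p := ((0 : ℝ), D.proj p))).eventually hr] with q h1 h2
  refine D.contDiffAt_proj_comp le_rfl ?_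
  refine ContMDiffAt.comp (f := fun q : ℝ × E3 => (q.1, r q.2)) q h1 ?_
  exact (contMDiffAt_iff_contDiffAt.2 contDiffAt_fst).prodMk
    (ContMDiffAt.comp (f := Prod.snd) q h2 (contMDiffAt_iff_contDiffAt.2 contDiffAt_snd))

/-- At time `0` both maps are the identity. In the local expression `K (s, z)` of `Φ`, the
derivative in direction `(1, v)` is the sum of those in directions `(1, 0)` and `(0, v)`: the
velocity of `Φ`, and `v` itself when `v` is the velocity of `Ψ`. -/
theorem IsPush.pushVelocity_comp [IsManifold (𝓡 2) ∞ M] {Φ Ψ : ℝ × M → M} (hΦ : D.IsPush Φ)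
    (hΨ : D.IsPush Ψ) (p : M) : D.pushVelocity (fun q => Φ (q.1, Ψ q)) p =
      D.pushVelocity Φ p + D.pushVelocity Ψ p := by
  obtain ⟨r, g, hr0, hr, hr'⟩ := D.exists_sheet_retraction p
  have hK := (hΦ.contDiffAt_local hr0 (hr.mono fun z hz => hz.1)).self_of_nhds
  set K := fun q : ℝ × E3 => D.proj (Φ (q.1, r q.2)) with hKdef
  have hKd := (hK.differentiableAt (by simp)).hasFDerivAt
  have hev : ∀ᶠ p' in 𝓝 p, r (D.proj p') = p' := by
    have h1 : Tendsto (fun p' : M => (p', (0 : ℝ))) (𝓝 p) (𝓝 (p, 0)) :=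
      (continuous_id.prodMk continuous_const).tendsto p
    filter_upwards [h1.eventually hr'] with p' h
    simpa using h.1
  have hΨt : Tendsto (fun s => Ψ (s, p)) (𝓝 0) (𝓝 p) :=
    (hΨ.tendsto p).comp ((continuous_id.prodMk continuous_const).tendsto (0 : ℝ))
  have hΨd := hΨ.hasDerivAt p
  have hbase : D.proj (Ψ (0, p)) = D.proj p := by rw [hΨ.zero]
  have hKd' : HasFDerivAt K (fderiv ℝ K (0, D.proj p)) ((0 : ℝ), D.proj (Ψ (0, p))) := by
    rw [hbase]; exact hKd
  have hA : HasDerivAt (fun s => K (s, D.proj (Ψ (s, p))))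
      (fderiv ℝ K (0, D.proj p) (1, D.pushVelocity Ψ p)) 0 :=
    hKd'.comp_hasDerivAt (f := fun s => (s, D.proj (Ψ (s, p)))) 0
      ((hasDerivAt_id (0 : ℝ)).prodMk hΨd)
  have hB : HasDerivAt (fun s => K (s, D.proj p)) (fderiv ℝ K (0, D.proj p) (1, 0)) 0 :=
    hKd.comp_hasDerivAt (f := fun s : ℝ => (s, D.proj p)) 0
      ((hasDerivAt_id (0 : ℝ)).prodMk (hasDerivAt_const _ _))
  have hC : HasDerivAt (fun s => K (0, D.proj (Ψ (s, p))))
      (fderiv ℝ K (0, D.proj p) (0, D.pushVelocity Ψ p)) 0 :=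
    hKd'.comp_hasDerivAt (f := fun s => ((0 : ℝ), D.proj (Ψ (s, p)))) 0
      ((hasDerivAt_const _ _).prodMk hΨd)
  have hB' := hB.unique ((hΦ.hasDerivAt p).congr_of_eventuallyEq (by
    filter_upwards with s
    simp only [hKdef, hr0]))
  have hC' := hC.unique (hΨd.congr_of_eventuallyEq (by
    filter_upwards [hΨt.eventually hev] with s hs
    simp only [hKdef, hs, hΦ.zero]))
  have hA' : HasDerivAt (fun s => D.proj (Φ (s, Ψ (s, p)))) _ 0 := hA.congr_of_eventuallyEq (by
    filter_upwards [hΨt.eventually hev] with s hs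
    simp only [hKdef, hs])
  rw [pushVelocity, hA'.deriv, ← hB']
  nth_rw 2 [← hC']
  rw [← map_add]
  simp

theorem IsPush.comp [IsManifold (𝓡 2) ∞ M] {Φ Ψ : ℝ × M → M} (hΦ : D.IsPush Φ)
    (hΨ : D.IsPush Ψ) : D.IsPush fun q => Φ (q.1, Ψ q) where
  smooth p := by
    have hc : Tendsto (fun q : ℝ × M => (q.1, Ψ q)) (𝓝 (0, p)) (𝓝 (0, p)) := by
      rw [nhds_prod_eq (x := (0 : ℝ)) (y := p)]
      refine Tendsto.prodMk tendsto_fst ?_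
      rw [← nhds_prod_eq]
      exact hΨ.tendsto p
    filter_upwards [hc.eventually (hΦ.smooth p), hΨ.smooth p] with q h1 h2
    exact ContMDiffAt.comp (f := fun q : ℝ × M => (q.1, Ψ q)) q h1 (contMDiffAt_fst.prodMk h2)
  zero p := by simp [hΨ.zero, hΦ.zero]
  nonpos p hp := by
    rw [hΦ.pushVelocity_comp hΨ, inner_add_left]
    exact add_nonpos (hΦ.nonpos p hp) (hΨ.nonpos p hp)

theorem isPush_snd : D.IsPush Prod.snd where
  smooth p := Eventually.of_forall fun q => contMDiffAt_snd
  zero p := rfl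
  nonpos p hp := by simp [pushVelocity]

variable (D)

/-- General position provides one direction in the sheet at `x₀` that runs against the normals of
all other sheets over the same point. Moving in this direction and back onto the sheet, damped by a
bump function, gives the push. -/
theorem exists_local_push [IsManifold (𝓡 2) ∞ M] [T2Space M] [CompactSpace M] (x₀ : M) :
    ∃ Φ, D.IsPush Φ ∧ ∀ᶠ x in 𝓝 x₀, ∀ y, D.IsUnderOver x y →
      ⟪D.pushVelocity Φ x, D.normal y⟫ < 0 := by
  classical
  obtain ⟨r, g, hr0, hr, hr'⟩ := D.exists_sheet_retraction x₀
  obtain ⟨w, hw⟩ := D.exists_inner_normal (D.proj x₀) (fun y => if y = x₀ then 0 else -1)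
  have hw0 : ⟪D.normal x₀, w⟫ = 0 := by rw [hw x₀ rfl, if_pos rfl]
  have hrs : ∀ᶠ z in 𝓝 (D.proj x₀), ContMDiffAt 𝓘(ℝ, E3) (𝓡 2) ∞ r z := hr.mono fun z hz => hz.1
  have hev : ∀ᶠ p in 𝓝 x₀, r (D.proj p) = p := by
    have h1 : Tendsto (fun p : M => (p, (0 : ℝ))) (𝓝 x₀) (𝓝 (x₀, 0)) :=
      (continuous_id.prodMk continuous_const).tendsto x₀
    filter_upwards [h1.eventually hr'] with p h
    simpa using h.1
  set P : E3 → E3 := fun z => D.proj (r z) with hP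
  have hPs : ∀ᶠ z in 𝓝 (D.proj x₀), ContDiffAt ℝ ∞ P z :=
    hrs.mono fun z hz => D.contDiffAt_proj_comp le_rfl hz
  -- The vector `w` is tangent to the sheet at `x₀`, and the retraction onto the sheet fixes tangent
  -- vectors to first order.
  have hPw : fderiv ℝ P (D.proj x₀) w = w := by
    have h1 := (hPs.self_of_nhds.differentiableAt (by simp)).hasFDerivAt
    have h2 := ((hr.self_of_nhds.2.1.differentiableAt (by simp)).hasFDerivAt.smul_const
      (D.normal x₀))
    have h3 := (h1.add h2).congr_of_eventuallyEq (f₁ := id) (by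
      filter_upwards [hr] with z hz using hz.2.2.symm)
    have h4 := congrArg (fun A => A w) (h3.unique (hasFDerivAt_id _))
    have h5 := D.sheet_fderiv hr0 hr w
    simpa [h5, hw0] using h4
  have hneg : ∀ᶠ x in 𝓝 x₀, ∀ y, D.IsUnderOver x y →
      ⟪fderiv ℝ P (D.proj x) w, D.normal y⟫ < 0 := by
    -- The neighbourhood of `x₀` has to work for all upper points at once. If `y` is not above `x₀`,
    -- there are no double pairs near `(x₀, y)` because these form a closed set.
    have := isCompact_univ.eventually_forall_of_forall_eventually (x₀ := x₀) (K := univ)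
      (P := fun x y => D.IsUnderOver x y → ⟪fderiv ℝ P (D.proj x) w, D.normal y⟫ < 0) (by
      intro y _
      by_cases hy : D.IsUnderOver x₀ y
      · have hc1 : ContinuousAt (fun x => fderiv ℝ P (D.proj x) w) x₀ := by
          have := (hPs.self_of_nhds.fderiv_right (m := 0) (by simp)).continuousAt
          exact (this.comp D.continuous_proj.continuousAt).clm_apply continuousAt_const
        have hc : ContinuousAt (fun p : M × M => ⟪fderiv ℝ P (D.proj p.1) w, D.normal p.2⟫)
            (x₀, y) :=
          (ContinuousAt.comp (f := Prod.fst) (x := (x₀, y)) hc1 continuousAt_fst).inner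
            (D.continuous_normal.comp continuous_snd).continuousAt
        have h0 : ⟪fderiv ℝ P (D.proj x₀) w, D.normal y⟫ < 0 := by
          rw [hPw, real_inner_comm, hw y hy.1.symm, if_neg hy.ne.symm]; norm_num
        exact (hc.eventually (gt_mem_nhds h0)).mono fun p hp _ => hp
      · have h1 : ∀ᶠ p in 𝓝 (x₀, y), p ∈ D.doublePairsᶜ :=
          D.isClosed_doublePairs.isOpen_compl.mem_nhds hy
        exact h1.mono fun p hp hp' => absurd hp' hp)
    exact this.mono fun x hx y => hx y (mem_univ y)
  obtain ⟨V, hV, hVo, hxV⟩ := eventually_nhds_iff.1 (hev.and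
    ((D.continuous_proj.continuousAt.eventually hrs.eventually_nhds).and hneg))
  obtain ⟨χ, -, hχV⟩ := (SmoothBumpFunction.nhds_basis_tsupport (I := 𝓡 2) x₀).mem_iff.1
    (hVo.mem_nhds hxV)
  have hχs : ContMDiff (𝓡 2) 𝓘(ℝ, ℝ) ∞ χ := χ.contMDiff
  -- The retraction is only meaningful near `x₀`, hence the case distinction; inside `V` both
  -- branches are given by the same smooth formula.
  let Φ : ℝ × M → M := fun q => if χ q.2 = 0 then q.2 else r (D.proj q.2 + (q.1 * χ q.2) • w)
  have hΦV : ∀ q : ℝ × M, q.2 ∈ V → Φ q = r (D.proj q.2 + (q.1 * χ q.2) • w) := by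
    intro q hq
    by_cases h0 : χ q.2 = 0
    · simp only [Φ, if_pos h0, h0, mul_zero, zero_smul, add_zero, (hV _ hq).1]
    · simp only [Φ, if_neg h0]
  have hΦ0 : ∀ p, p ∉ V → ∀ s, Φ (s, p) = p := by
    intro p hp s
    have : χ p = 0 := image_eq_zero_of_notMem_tsupport fun h => hp (hχV h)
    simp only [Φ, if_pos this]
  have hvel : ∀ p ∈ V, D.pushVelocity Φ p = χ p • fderiv ℝ P (D.proj p) w := by
    intro p hp
    have h1 : HasDerivAt (fun s : ℝ => D.proj p + (s * χ p) • w) (χ p • w) 0 := by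
      have := (((hasDerivAt_id (0 : ℝ)).mul_const (χ p)).smul_const w).const_add (D.proj p)
      simpa using this
    have h2 : HasFDerivAt P (fderiv ℝ P (D.proj p)) (D.proj p + ((0 : ℝ) * χ p) • w) := by
      rw [zero_mul, zero_smul, add_zero]
      exact ((D.contDiffAt_proj_comp le_rfl (hV p hp).2.1.self_of_nhds).differentiableAt
        (by simp)).hasFDerivAt
    have h3 := h2.comp_hasDerivAt (0 : ℝ) h1
    rw [map_smul] at h3
    refine HasDerivAt.deriv (h3.congr_of_eventuallyEq ?_)
    filter_upwards with s
    rw [hΦV (s, p) hp]; rfl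
  refine ⟨Φ, ⟨?_, ?_, ?_⟩, ?_⟩
  · intro p
    by_cases hp : p ∈ V
    · have h1 : ∀ᶠ q : ℝ × M in 𝓝 (0, p), ∀ᶠ q' in 𝓝 q, q'.2 ∈ V :=
        (continuousAt_snd.eventually (hVo.mem_nhds hp)).eventually_nhds
      have h2 : ContMDiff (𝓘(ℝ, ℝ).prod (𝓡 2)) 𝓘(ℝ, E3) ∞
          (fun q : ℝ × M => D.proj q.2 + (q.1 * χ q.2) • w) :=
        (D.contMDiff_proj.comp contMDiff_snd).add
          ((contMDiff_fst.mul (hχs.comp contMDiff_snd)).smul contMDiff_const)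
      have h3 : Tendsto (fun q : ℝ × M => D.proj q.2 + (q.1 * χ q.2) • w) (𝓝 (0, p))
          (𝓝 (D.proj p)) := by
        have := h2.continuous.tendsto (0, p)
        simpa using this
      filter_upwards [h1, h3.eventually (hV p hp).2.1] with q hq hq'
      refine (ContMDiffAt.comp q hq' h2.contMDiffAt).congr_of_eventuallyEq ?_
      exact hq.mono fun q' hq' => hΦV q' hq'
    · have hpt : p ∉ tsupport χ := fun h => hp (hχV h)
      have h1 : ∀ᶠ q : ℝ × M in 𝓝 (0, p), ∀ᶠ q' in 𝓝 q, q'.2 ∉ tsupport χ :=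
        ((continuousAt_snd (p := ((0 : ℝ), p))).eventually
          ((isClosed_tsupport χ).isOpen_compl.mem_nhds hpt)).eventually_nhds
      filter_upwards [h1] with q hq
      refine contMDiffAt_snd.congr_of_eventuallyEq ?_
      filter_upwards [hq] with q' hq'
      simp only [Φ, if_pos (image_eq_zero_of_notMem_tsupport hq')]
  · intro p
    by_cases hp : p ∈ V
    · rw [hΦV _ hp]; simp [(hV p hp).1]
    · exact hΦ0 p hp 0
  · rintro ⟨x, y⟩ hp
    by_cases hx : x ∈ V
    · rw [hvel x hx, inner_smul_left]
      exact mul_nonpos_of_nonneg_of_nonpos χ.nonneg ((hV x hx).2.2 y hp).le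
    · simp [pushVelocity, hΦ0 x hx]
  · filter_upwards [hVo.mem_nhds hxV, χ.eventuallyEq_one] with x hx hx1 y hy
    rw [hvel x hx, show χ x = 1 from hx1, one_smul]
    exact (hV x hx).2.2 y hy

/-- The surface can be pushed so that the lower disks move strictly against the normal direction of
the upper disks. -/
theorem exists_push [IsManifold (𝓡 2) ∞ M] [T2Space M] [CompactSpace M] :
    ∃ Φ, D.IsPush Φ ∧ ∀ x y, D.IsUnderOver x y → ⟪D.pushVelocity Φ x, D.normal y⟫ < 0 := by
  -- Composition adds initial velocities. Every push has nonpositive inner products with the upper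
  -- normals everywhere, so strict negativity gained on one set is not lost when further pushes are
  -- composed.
  have := isCompact_univ.induction_on (p := fun S : Set M => ∃ Φ, D.IsPush Φ ∧ ∀ x ∈ S, ∀ y,
    D.IsUnderOver x y → ⟪D.pushVelocity Φ x, D.normal y⟫ < 0) ⟨_, isPush_snd, by simp⟩
    (fun s t hst ⟨Φ, h, h'⟩ => ⟨Φ, h, fun x hx => h' x (hst hx)⟩) ?_ ?_
  · obtain ⟨Φ, h, h'⟩ := this
    exact ⟨Φ, h, fun x => h' x (mem_univ x)⟩
  · rintro s t ⟨Φ, h, h'⟩ ⟨Ψ, k, k'⟩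
    refine ⟨_, h.comp k, ?_⟩
    rintro x (hx | hx) y hy
    · rw [h.pushVelocity_comp k, inner_add_left]
      exact add_neg_of_neg_of_nonpos (h' x hx y hy) (k.nonpos (x, y) hy)
    · rw [h.pushVelocity_comp k, inner_add_left]
      exact add_neg_of_nonpos_of_neg (h.nonpos (x, y) hy) (k' x hx y hy)
  · intro x _
    obtain ⟨Φ, h, h'⟩ := D.exists_local_push x
    exact ⟨_, nhdsWithin_le_nhds h', Φ, h, fun x hx => hx⟩

end RegularDiagram

/-! ### The strips swept out by the pushed double point curves -/

/-- The tube lemma over `K`. The hypothesis `hP` is for periodic conditions, whose parameters reduce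
to fractional parts in `[0, 1]`. -/
theorem eventually_forall_of_compact {Y : Type*} [TopologicalSpace Y] {K : Set Y}
    (hK : IsCompact K) {P : Y → ℝ → Prop} (hP : ∀ s y, ∃ y' ∈ K, P y' s → P y s)
    (h : ∀ y ∈ K, ∀ᶠ q in 𝓝 (y, (0 : ℝ)), P q.1 q.2) : ∀ᶠ s in 𝓝 (0 : ℝ), ∀ y, P y s := by
  have := hK.eventually_forall_of_forall_eventually (x₀ := (0 : ℝ)) (P := fun s y => P y s)
    (fun y hy => (continuous_swap.tendsto ((0 : ℝ), y)).eventually (h y hy))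
  filter_upwards [this] with s hs y
  obtain ⟨y', hy', hyP⟩ := hP s y
  exact hyP (hs y' hy')

theorem Function.Periodic.map_fract_one {α : Type*} {f : ℝ → α} (hf : Function.Periodic f 1)
    (t : ℝ) : f (Int.fract t) = f t := by
  have := (hf.int_mul ⌊t⌋) (Int.fract t)
  rw [mul_one, Int.fract_add_floor] at this
  exact this.symm

theorem fract_mem_Icc (t : ℝ) : Int.fract t ∈ Icc (0 : ℝ) 1 :=
  ⟨Int.fract_nonneg t, (Int.fract_lt_one t).le⟩

theorem RegularDiagram.SameParam.of_fract {n : ℕ} {i j : Fin n} {s t : ℝ}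
    (h : RegularDiagram.SameParam i (Int.fract s) j (Int.fract t)) :
    RegularDiagram.SameParam i s j t := by
  obtain ⟨hij, m, hm⟩ := h
  refine ⟨hij, m + ⌊t⌋ - ⌊s⌋, ?_⟩
  have h1 := Int.fract_add_floor s
  have h2 := Int.fract_add_floor t
  push_cast
  linarith

namespace RegularDiagram

variable {M : Type u} [TopologicalSpace M] [ChartedSpace (EuclideanSpace ℝ (Fin 2)) M]
  {D : RegularDiagram M}

/-- The strip swept out by the curve `γ` under a family of maps of the surface. -/
def stripMap (Φ : ℝ × M → M) (γ : ℝ → M) (q : ℝ × ℝ) : M := Φ (q.2, γ q.1)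

theorem stripMap_periodic {M : Type*} {Φ : ℝ × M → M} {γ : ℝ → M} (hp : Function.Periodic γ 1)
    (s : ℝ) : Function.Periodic (fun t => stripMap Φ γ (t, s)) 1 := fun t => by
  simp only [stripMap, hp t]

section Strip

variable {Φ : ℝ × M → M} (hΦ : D.IsPush Φ) {γ : ℝ → M} (hγ : ContMDiff 𝓘(ℝ, ℝ) (𝓡 2) ∞ γ)

include hΦ

theorem stripMap_zero (t : ℝ) : stripMap Φ γ (t, 0) = γ t := hΦ.zero _

include hγ

theorem tendsto_stripMap (t : ℝ) : Tendsto (stripMap Φ γ) (𝓝 (t, 0)) (𝓝 (γ t)) := by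
  have h1 : Tendsto (fun q : ℝ × ℝ => (q.2, γ q.1)) (𝓝 (t, 0)) (𝓝 (0, γ t)) :=
    (continuous_snd.prodMk (hγ.continuous.comp continuous_fst)).tendsto (t, (0 : ℝ))
  exact (hΦ.tendsto (γ t)).comp h1

theorem contMDiffAt_stripMap (t : ℝ) : ∀ᶠ q in 𝓝 (t, (0 : ℝ)),
    ContMDiffAt 𝓘(ℝ, ℝ × ℝ) (𝓡 2) ∞ (stripMap Φ γ) q := by
  have h1 : Tendsto (fun q : ℝ × ℝ => (q.2, γ q.1)) (𝓝 (t, 0)) (𝓝 (0, γ t)) :=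
    (continuous_snd.prodMk (hγ.continuous.comp continuous_fst)).tendsto (t, (0 : ℝ))
  filter_upwards [h1.eventually (hΦ.smooth (γ t))] with q hq
  refine ContMDiffAt.comp (f := fun q : ℝ × ℝ => (q.2, γ q.1)) q hq ?_
  exact (contMDiffAt_iff_contDiffAt.2 contDiffAt_snd).prodMk
    (ContMDiffAt.comp (f := Prod.fst) q hγ.contMDiffAt
      (contMDiffAt_iff_contDiffAt.2 contDiffAt_fst))

theorem contDiffAt_proj_stripMap (t : ℝ) : ∀ᶠ q in 𝓝 (t, (0 : ℝ)),
    ContDiffAt ℝ ∞ (fun q => D.proj (stripMap Φ γ q)) q :=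
  (contMDiffAt_stripMap hΦ hγ t).mono fun _ hq => D.contDiffAt_proj_comp le_rfl hq

theorem hasFDerivAt_proj_stripMap (t : ℝ) : HasFDerivAt (fun q => D.proj (stripMap Φ γ q))
    (fderiv ℝ (fun q => D.proj (stripMap Φ γ q)) (t, 0)) (t, 0) :=
  ((contDiffAt_proj_stripMap hΦ hγ t).self_of_nhds.differentiableAt (by simp)).hasFDerivAt

theorem continuousAt_fderiv_stripMap (t : ℝ) (v : ℝ × ℝ) :
    ContinuousAt (fun q => fderiv ℝ (fun q => D.proj (stripMap Φ γ q)) q v) (t, 0) :=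
  ((contDiffAt_proj_stripMap hΦ hγ t).self_of_nhds.fderiv_right (m := 0)
    (by simp)).continuousAt.clm_apply continuousAt_const

theorem fderiv_stripMap_fst (t : ℝ) :
    fderiv ℝ (fun q => D.proj (stripMap Φ γ q)) (t, 0) (1, 0) = deriv (fun r => D.proj (γ r)) t := by
  have h := (hasFDerivAt_proj_stripMap hΦ hγ t).comp_hasDerivAt (f := fun r : ℝ => (r, (0 : ℝ))) t
    ((hasDerivAt_id t).prodMk (hasDerivAt_const _ _))
  rw [← h.deriv]
  congr 1
  funext r
  exact congrArg D.proj (stripMap_zero hΦ r)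

theorem fderiv_stripMap_snd (t : ℝ) :
    fderiv ℝ (fun q => D.proj (stripMap Φ γ q)) (t, 0) (0, 1) = D.pushVelocity Φ (γ t) := by
  have h := (hasFDerivAt_proj_stripMap hΦ hγ t).comp_hasDerivAt (f := fun s : ℝ => (t, s)) 0
    ((hasDerivAt_const _ _).prodMk (hasDerivAt_id (0 : ℝ)))
  rw [← h.deriv]
  rfl

omit hγ hΦ in
theorem fderiv_stripMap_periodic (hp : Function.Periodic γ 1) (s : ℝ) :
    Function.Periodic (fun t => fderiv ℝ (fun q => D.proj (stripMap Φ γ q)) (t, s)) 1 := fun t => by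
  have h1 : (fun q => D.proj (stripMap Φ γ q)) =
      fun q : ℝ × ℝ => D.proj (stripMap Φ γ (q + ((1 : ℝ), (0 : ℝ)))) := by
    funext q
    simp [stripMap, hp q.1]
  have h2 := fderiv_comp_add_right (𝕜 := ℝ) (f := fun q => D.proj (stripMap Φ γ q))
    (x := (t, s)) ((1 : ℝ), (0 : ℝ))
  rw [← h1] at h2
  simpa using h2.symm

end Strip

/-- Distinct points stay apart for small times by continuity. Near the diagonal, the displacement is
zero at time `0`, so for small times it is a contraction in the space variable; two points with the
same image would have displacements that differ by exactly their difference. -/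
theorem IsPush.eventually_injective [IsManifold (𝓡 2) ∞ M] [T2Space M] [CompactSpace M]
    {Φ : ℝ × M → M} (hΦ : D.IsPush Φ) :
    ∀ᶠ s in 𝓝 (0 : ℝ), Function.Injective fun p => Φ (s, p) := by
  have := eventually_forall_of_compact (Y := M × M) isCompact_univ
    (P := fun p s => Φ (s, p.1) = Φ (s, p.2) → p.1 = p.2) (fun s p => ⟨p, mem_univ p, id⟩) ?_
  · filter_upwards [this] with s hs p p' h using hs (p, p') h
  rintro ⟨p, p'⟩ -
  have hc1 : Tendsto (fun q : (M × M) × ℝ => (q.2, q.1.1)) (𝓝 ((p, p'), 0)) (𝓝 (0, p)) :=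
    (continuous_snd.prodMk (continuous_fst.comp continuous_fst)).tendsto ((p, p'), (0 : ℝ))
  have hc2 : Tendsto (fun q : (M × M) × ℝ => (q.2, q.1.2)) (𝓝 ((p, p'), 0)) (𝓝 (0, p')) :=
    (continuous_snd.prodMk (continuous_snd.comp continuous_fst)).tendsto ((p, p'), (0 : ℝ))
  by_cases hpp : p = p'
  swap
  · have h1 : Tendsto (fun q : (M × M) × ℝ => (Φ (q.2, q.1.1), Φ (q.2, q.1.2))) (𝓝 ((p, p'), 0))
        (𝓝 (p, p')) := by
      rw [nhds_prod_eq (x := p) (y := p')]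
      exact ((hΦ.tendsto p).comp hc1).prodMk ((hΦ.tendsto p').comp hc2)
    filter_upwards [h1.eventually (isClosed_diagonal.isOpen_compl.mem_nhds hpp)] with q hq h
    exact absurd h hq
  subst hpp
  obtain ⟨r, g, hr0, hr, hr'⟩ := D.exists_sheet_retraction p
  have hrs := hr.mono fun z hz => hz.1
  have hev : ∀ᶠ p' in 𝓝 p, r (D.proj p') = p' := by
    have h1 : Tendsto (fun p' : M => (p', (0 : ℝ))) (𝓝 p) (𝓝 (p, 0)) :=
      (continuous_id.prodMk continuous_const).tendsto p
    filter_upwards [h1.eventually hr'] with p' h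
    simpa using h.1
  set F : ℝ × E3 → E3 := fun q => D.proj (Φ (q.1, r q.2)) - D.proj (r q.2) with hF
  have hFs : ContDiffAt ℝ ∞ F (0, D.proj p) := by
    refine (hΦ.contDiffAt_local hr0 hrs).self_of_nhds.sub ?_
    exact ContDiffAt.comp (f := Prod.snd) (x := ((0 : ℝ), D.proj p))
      (g := fun z => D.proj (r z)) (D.contDiffAt_proj_comp le_rfl hrs.self_of_nhds) contDiffAt_snd
  have hstrict := hFs.hasStrictFDerivAt (by simp)
  have hF0 : ∀ w, fderiv ℝ F (0, D.proj p) (0, w) = 0 := by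
    intro w
    have h1 := hstrict.hasFDerivAt.comp (f := fun z : E3 => ((0 : ℝ), z)) (D.proj p)
      (hasFDerivAt_prodMk_right (𝕜 := ℝ) (0 : ℝ) (D.proj p))
    have h2 : F ∘ (fun z : E3 => ((0 : ℝ), z)) = fun _ => 0 := by
      funext z; simp [hF, hΦ.zero]
    rw [h2] at h1
    have h3 := congrArg (fun A => A w) (h1.unique (hasFDerivAt_const _ _))
    simpa using h3
  -- Any constant below `1` would do: equal images turn the estimate into `‖d‖ ≤ c * ‖d‖`.
  have hsmall := hstrict.isLittleO.def (c := 1 / 2) (by norm_num)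
  have hc3 : Tendsto (fun q : (M × M) × ℝ => (((q.2, D.proj q.1.1) : ℝ × E3),
      ((q.2, D.proj q.1.2) : ℝ × E3))) (𝓝 ((p, p), 0)) (𝓝 ((0, D.proj p), (0, D.proj p))) := by
    have hcp := D.continuous_proj
    exact Continuous.tendsto (f := fun q : (M × M) × ℝ => (((q.2, D.proj q.1.1) : ℝ × E3),
      ((q.2, D.proj q.1.2) : ℝ × E3))) (by fun_prop) ((p, p), (0 : ℝ))
  have hc4 : Tendsto (fun q : (M × M) × ℝ => q.1.1) (𝓝 ((p, p), 0)) (𝓝 p) :=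
    (continuous_fst.comp continuous_fst).tendsto ((p, p), (0 : ℝ))
  have hc5 : Tendsto (fun q : (M × M) × ℝ => q.1.2) (𝓝 ((p, p), 0)) (𝓝 p) :=
    (continuous_snd.comp continuous_fst).tendsto ((p, p), (0 : ℝ))
  filter_upwards [hc3.eventually hsmall, hc4.eventually hev, hc5.eventually hev] with q h1 h2 h3 h4
  have h5 : ((q.2, D.proj q.1.1) : ℝ × E3) - (q.2, D.proj q.1.2) =
      (0, D.proj q.1.1 - D.proj q.1.2) := by simp
  rw [h5, hF0] at h1
  simp only [hF, h2, h3, h4] at h1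
  have h6 : ‖((0 : ℝ), D.proj q.1.1 - D.proj q.1.2)‖ = ‖D.proj q.1.1 - D.proj q.1.2‖ := by
    simp [Prod.norm_def]
  have h7 : D.proj (Φ (q.2, q.1.2)) - D.proj q.1.1 - (D.proj (Φ (q.2, q.1.2)) - D.proj q.1.2) - 0 =
      -(D.proj q.1.1 - D.proj q.1.2) := by abel
  rw [h6, h7, norm_neg] at h1
  have h8 : ‖D.proj q.1.1 - D.proj q.1.2‖ = 0 := by
    linarith [norm_nonneg (D.proj q.1.1 - D.proj q.1.2)]
  rw [norm_eq_zero, sub_eq_zero] at h8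
  rw [← h2, ← h3, h8]

section Double

variable {n : ℕ} {low up : Fin n → ℝ → M} (hpar : D.ParametrizesDoubleCurves low up)
  {Φ : ℝ × M → M} (hΦ : D.IsPush Φ)
  (hneg : ∀ x y, D.IsUnderOver x y → ⟪D.pushVelocity Φ x, D.normal y⟫ < 0)

include hpar hΦ hneg

/-- The pushed lower curves stay off the upper sheets. -/
theorem eventually_stripMap_off_upper [IsManifold (𝓡 2) ∞ M] (i : Fin n) (t₀ : ℝ) :
    ∀ᶠ q in 𝓝 ((t₀, up i t₀), (0 : ℝ)), 0 < q.2 →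
      D.proj q.1.2 ≠ D.proj (stripMap Φ (low i) (q.1.1, q.2)) := by
  obtain ⟨r, g, hr0, hr, hr'⟩ := D.exists_sheet_retraction (up i t₀)
  have hlow := hpar.contMDiff_low i
  have hproj : D.proj (low i t₀) = D.proj (up i t₀) := (hpar.isUnderOver i t₀).1
  have hev : ∀ᶠ y in 𝓝 (up i t₀), g (D.proj y) = 0 := by
    have h1 : Tendsto (fun y : M => (y, (0 : ℝ))) (𝓝 (up i t₀)) (𝓝 (up i t₀, 0)) :=
      (continuous_id.prodMk continuous_const).tendsto (up i t₀)
    filter_upwards [h1.eventually hr'] with y h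
    simpa using h.2
  set Z : ℝ × ℝ → E3 := fun q => D.proj (stripMap Φ (low i) q) with hZ
  have hZt : Tendsto Z (𝓝 (t₀, 0)) (𝓝 (D.proj (up i t₀))) := by
    rw [← hproj]
    exact (D.continuous_proj.tendsto _).comp (tendsto_stripMap hΦ hlow t₀)
  -- The signed displacement of the strip from the upper sheet. It is zero at time `0` and strictly
  -- decreasing in time, so the strip leaves the upper sheet immediately, uniformly near `t₀`.
  set f : ℝ × ℝ → ℝ := fun q => g (Z q) with hf
  have hfs : ∀ᶠ q in 𝓝 (t₀, (0 : ℝ)), ContDiffAt ℝ ∞ f q := by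
    filter_upwards [hZt.eventually hr, contDiffAt_proj_stripMap hΦ hlow t₀] with q h1 h2
    exact h1.2.1.comp q h2
  have hfd0 : fderiv ℝ f (t₀, 0) (0, 1) < 0 := by
    have h1 : HasFDerivAt g (fderiv ℝ g (D.proj (up i t₀))) (Z (t₀, 0)) := by
      have : Z (t₀, 0) = D.proj (up i t₀) := by rw [hZ, ← hproj]; exact congrArg _ (hΦ.zero _)
      rw [this]
      exact (hr.self_of_nhds.2.1.differentiableAt (by simp)).hasFDerivAt
    have h2 := h1.comp (t₀, (0 : ℝ)) (hasFDerivAt_proj_stripMap hΦ hlow t₀)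
    rw [show fderiv ℝ f (t₀, 0) = _ from h2.fderiv]
    rw [ContinuousLinearMap.comp_apply, fderiv_stripMap_snd hΦ hlow, D.sheet_fderiv hr0
      (hr.mono fun z hz => hz), real_inner_comm]
    exact hneg _ _ (hpar.isUnderOver i t₀)
  have hfd : ∀ᶠ q in 𝓝 (t₀, (0 : ℝ)), fderiv ℝ f q (0, 1) < 0 :=
    ((hfs.self_of_nhds.fderiv_right (m := 0) (by simp)).continuousAt.clm_apply
      continuousAt_const).eventually (gt_mem_nhds hfd0)
  obtain ⟨a, ha, hball⟩ := Metric.eventually_nhds_iff_ball.1 (hfs.and hfd)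
  have hft : ∀ᶠ t in 𝓝 t₀, f (t, 0) = 0 := by
    filter_upwards [(hpar.contMDiff_up i).continuous.continuousAt.eventually hev] with t ht
    have h1 : f (t, 0) = g (D.proj (low i t)) :=
      congrArg (fun p => g (D.proj p)) (stripMap_zero hΦ t)
    rw [h1, (hpar.isUnderOver i t).1, ht]
  have hc1 : Tendsto (fun q : (ℝ × M) × ℝ => (q.1.1, q.2)) (𝓝 ((t₀, up i t₀), 0))
      (𝓝 (t₀, 0)) :=
    (continuous_fst.fst.prodMk continuous_snd).tendsto ((t₀, up i t₀), (0 : ℝ))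
  have hc2 : Tendsto (fun q : (ℝ × M) × ℝ => q.1.1) (𝓝 ((t₀, up i t₀), 0)) (𝓝 t₀) :=
    continuous_fst.fst.tendsto ((t₀, up i t₀), (0 : ℝ))
  have hc3 : Tendsto (fun q : (ℝ × M) × ℝ => q.1.2) (𝓝 ((t₀, up i t₀), 0)) (𝓝 (up i t₀)) :=
    continuous_fst.snd.tendsto ((t₀, up i t₀), (0 : ℝ))
  filter_upwards [hc1.eventually (Metric.ball_mem_nhds _ ha), hc2.eventually hft,
    hc3.eventually hev] with q h1 h2 h3 hpos heq
  obtain ⟨⟨t, y⟩, s⟩ := q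
  simp only at h1 h2 h3 hpos heq
  have hmem : ∀ s' ∈ Icc 0 s, (t, s') ∈ Metric.ball (t₀, (0 : ℝ)) a := by
    intro s' hs'
    rw [Metric.mem_ball]
    rw [Prod.dist_eq, max_lt_iff] at h1 ⊢
    refine ⟨h1.1, ?_⟩
    have := h1.2
    simp only [Real.dist_eq, sub_zero] at this ⊢
    rw [abs_of_nonneg hs'.1]
    rw [abs_of_pos hpos] at this
    linarith [hs'.2]
  have hd : ∀ s' ∈ Icc 0 s, HasDerivAt (fun s => f (t, s)) (fderiv ℝ f (t, s') (0, 1)) s' := by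
    intro s' hs'
    have h4 := ((hball _ (hmem s' hs')).1.differentiableAt (by simp)).hasFDerivAt
    exact h4.comp_hasDerivAt (f := fun s : ℝ => (t, s)) s'
      ((hasDerivAt_const _ _).prodMk (hasDerivAt_id s'))
  have hanti : StrictAntiOn (fun s => f (t, s)) (Icc 0 s) := by
    refine strictAntiOn_of_deriv_neg (convex_Icc 0 s)
      (fun s' hs' => (hd s' hs').continuousAt.continuousWithinAt) fun s' hs' => ?_
    rw [interior_Icc] at hs'
    rw [(hd s' (Ioo_subset_Icc_self hs')).deriv]
    exact (hball _ (hmem s' (Ioo_subset_Icc_self hs'))).2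
  have h5 := hanti ⟨le_rfl, hpos.le⟩ ⟨hpos.le, le_rfl⟩ hpos
  simp only [h2] at h5
  rw [heq] at h3
  exact h5.ne h3

/-- Near the lower preimage the projection is injective, and near the upper one the pushed curve has
left the sheet. So the two sheets that form the double point curve give no new intersections with
its push-off. -/
theorem eventually_stripMap_off_pair [IsManifold (𝓡 2) ∞ M] (i : Fin n) (t₀ : ℝ) {y : M}
    (hy : y = low i t₀ ∨ y = up i t₀) : ∀ᶠ q in 𝓝 ((t₀, y), (0 : ℝ)), 0 < q.2 →
      D.proj q.1.2 = D.proj (stripMap Φ (low i) (q.1.1, q.2)) →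
        q.1.2 = stripMap Φ (low i) (q.1.1, q.2) := by
  rcases hy with rfl | rfl
  · have hc : Tendsto (fun q : (ℝ × M) × ℝ => (q.1.2, stripMap Φ (low i) (q.1.1, q.2)))
        (𝓝 ((t₀, low i t₀), 0)) (𝓝 (low i t₀, low i t₀)) := by
      rw [nhds_prod_eq (x := low i t₀) (y := low i t₀)]
      refine (continuous_fst.snd.tendsto ((t₀, low i t₀), (0 : ℝ))).prodMk ?_
      exact (tendsto_stripMap hΦ (hpar.contMDiff_low i) t₀).comp
        ((continuous_fst.fst.prodMk continuous_snd).tendsto ((t₀, low i t₀), (0 : ℝ)))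
    filter_upwards [hc.eventually (D.eventually_proj_injective (low i t₀))] with q hq _ using hq
  · filter_upwards [eventually_stripMap_off_upper hpar hΦ hneg i t₀] with q hq h1 h2
    exact absurd h2 (hq h1)

end Double

end RegularDiagram

/-! ### Orientation, size and transversality of the pushed curves -/

namespace RegularDiagram

variable {M : Type u} [TopologicalSpace M] [ChartedSpace (EuclideanSpace ℝ (Fin 2)) M]
  {D : RegularDiagram M}

section Double

variable {n : ℕ} {low up : Fin n → ℝ → M} (hpar : D.ParametrizesDoubleCurves low up)
  {Φ : ℝ × M → M} (hΦ : D.IsPush Φ)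
  (hneg : ∀ x y, D.IsUnderOver x y → ⟪D.pushVelocity Φ x, D.normal y⟫ < 0)
  (hor : ∀ i t, ∃ κ > 0, deriv (fun r => D.proj (low i r)) t =
    (κ : ℝ) • cross3 (D.normal (up i t)) (D.normal (low i t)))

include hpar hΦ

/-- These are open conditions, so they are checked at time `0`. There the normal direction of the
lower curve is `κ` times the component of the upper normal tangent to the lower sheet: its product
with the tangent push velocity is `κ` times a negative number, and with the upper normal it is `κ (1
- ⟪n, n'⟫²) > 0`. -/
theorem eventually_strip_geometry
    (hneg : ∀ x y, D.IsUnderOver x y → ⟪D.pushVelocity Φ x, D.normal y⟫ < 0)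
    (hor : ∀ i t, ∃ κ > 0, deriv (fun r => D.proj (low i r)) t =
      (κ : ℝ) • cross3 (D.normal (up i t)) (D.normal (low i t))) (i : Fin n) (t : ℝ) :
    ∀ᶠ q in 𝓝 (t, (0 : ℝ)),
      ⟪cross3 (D.normal (stripMap Φ (low i) q))
        (fderiv ℝ (fun q => D.proj (stripMap Φ (low i) q)) q (1, 0)),
        fderiv ℝ (fun q => D.proj (stripMap Φ (low i) q)) q (0, 1)⟫ < 0 ∧
      ⟪fderiv ℝ (fun q => D.proj (stripMap Φ (low i) q)) q (0, 1), D.normal (up i q.1)⟫ < 0 ∧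
      0 < ⟪cross3 (D.normal (stripMap Φ (low i) q))
        (fderiv ℝ (fun q => D.proj (stripMap Φ (low i) q)) q (1, 0)), D.normal (up i q.1)⟫ := by
  have hlow := hpar.contMDiff_low i
  have hn : ContinuousAt (fun q => D.normal (stripMap Φ (low i) q)) (t, 0) :=
    D.continuous_normal.continuousAt.comp
      (contMDiffAt_stripMap hΦ hlow t).self_of_nhds.continuousAt
  have hup : ContinuousAt (fun q : ℝ × ℝ => D.normal (up i q.1)) (t, 0) :=
    (D.continuous_normal.comp ((hpar.contMDiff_up i).continuous.comp continuous_fst)).continuousAt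
  have h1 := continuousAt_fderiv_stripMap hΦ hlow t (1, 0)
  have h2 := continuousAt_fderiv_stripMap hΦ hlow t (0, 1)
  obtain ⟨κ, hκ, hκ'⟩ := hor i t
  have hxy := hpar.isUnderOver i t
  have hξ := hneg _ _ hxy
  have hξn := hΦ.inner_normal (low i t)
  have e1 := fderiv_stripMap_fst hΦ hlow t
  have e2 := fderiv_stripMap_snd hΦ hlow t
  have e0 : stripMap Φ (low i) (t, 0) = low i t := stripMap_zero hΦ t
  have hcc := inner_cross3_self (D.normal (low i t)) (D.normal (up i t))
  have hcpos : 0 < ⟪cross3 (D.normal (low i t)) (D.normal (up i t)),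
      cross3 (D.normal (low i t)) (D.normal (up i t))⟫ := by
    rw [real_inner_self_eq_norm_sq]
    have := norm_pos_iff.2 (D.cross3_normal_ne_zero hxy.ne hxy.1)
    positivity
  rw [hcc, D.inner_normal_self, D.inner_normal_self] at hcpos
  refine ((hn.cross3 h1).inner h2).eventually (gt_mem_nhds ?_) |>.and
    (((h2.inner hup).eventually (gt_mem_nhds ?_)).and
      (((hn.cross3 h1).inner hup).eventually (lt_mem_nhds ?_)))
  · beta_reduce
    rw [e0, e1, e2, hκ', cross3_smul_right, cross3_cross3, inner_smul_left, inner_sub_left,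
      inner_smul_left, inner_smul_left, hξn, D.inner_normal_self, real_inner_comm]
    simp only [conj_trivial, one_mul, mul_zero, sub_zero]
    exact mul_neg_of_pos_of_neg hκ hξ
  · beta_reduce
    rw [e2]; exact hξ
  · beta_reduce
    rw [e0, e1, hκ', cross3_smul_right, cross3_cross3, inner_smul_left, inner_sub_left,
      inner_smul_left, inner_smul_left, D.inner_normal_self, D.inner_normal_self]
    simp only [conj_trivial, mul_one]
    refine mul_pos hκ ?_
    linarith

theorem eventually_strip_close {ε : ℝ} (hε : 0 < ε) (i : Fin n) (t : ℝ) :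
    ∀ᶠ q in 𝓝 (t, (0 : ℝ)),
      dist (D.proj (stripMap Φ (low i) q)) (D.proj (low i q.1)) < ε ∧
      dist (D.height (stripMap Φ (low i) q)) (D.height (low i q.1)) < ε ∧
      ‖fderiv ℝ (fun q => D.proj (stripMap Φ (low i) q)) q (1, 0) -
        deriv (fun r => D.proj (low i r)) q.1‖ < ε := by
  have hlow := hpar.contMDiff_low i
  have e0 : stripMap Φ (low i) (t, 0) = low i t := stripMap_zero hΦ t
  have hs := (contMDiffAt_stripMap hΦ hlow t).self_of_nhds.continuousAt
  have hl : ContinuousAt (fun q : ℝ × ℝ => low i q.1) (t, 0) :=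
    (hlow.continuous.comp continuous_fst).continuousAt
  have h1 := continuousAt_fderiv_stripMap hΦ hlow t (1, 0)
  have h2 : ContinuousAt (fun q : ℝ × ℝ => deriv (fun r => D.proj (low i r)) q.1) (t, 0) := by
    have h3 : ContDiff ℝ ∞ fun r => D.proj (low i r) :=
      contDiff_iff_contDiffAt.2 fun r => D.contDiffAt_proj_comp le_rfl hlow.contMDiffAt
    exact ((h3.continuous_deriv (by simp)).comp continuous_fst).continuousAt
  refine ((D.continuous_proj.continuousAt.comp hs).dist
    (D.continuous_proj.continuousAt.comp hl)).eventually (gt_mem_nhds ?_) |>.and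
    ((((D.continuous_height.continuousAt.comp hs).dist
    (D.continuous_height.continuousAt.comp hl)).eventually (gt_mem_nhds ?_)).and
      ((h1.sub h2).norm.eventually (gt_mem_nhds ?_)))
  · simpa [e0] using hε
  · simpa [e0] using hε
  · simp only [Pi.sub_apply]
    rw [fderiv_stripMap_fst hΦ hlow, sub_self, norm_zero]; exact hε

include hneg hor

/-- Close to time `0`, a further preimage can only be near the lower point, the upper point or a
third preimage. The first two are excluded, and the third sheet is transverse to the double point
curve, since the triple product of the normals is nonzero. -/
theorem eventually_double_transverse [IsManifold (𝓡 2) ∞ M] (i : Fin n) (t₀ : ℝ) (y₀ : M) :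
    ∀ᶠ q in 𝓝 ((t₀, y₀), (0 : ℝ)), 0 < q.2 → q.1.2 ≠ stripMap Φ (low i) (q.1.1, q.2) →
      D.proj q.1.2 = D.proj (stripMap Φ (low i) (q.1.1, q.2)) →
      ⟪fderiv ℝ (fun q => D.proj (stripMap Φ (low i) q)) (q.1.1, q.2) (1, 0),
        D.normal q.1.2⟫ ≠ 0 := by
  by_cases hp : y₀ = low i t₀ ∨ y₀ = up i t₀
  · filter_upwards [eventually_stripMap_off_pair hpar hΦ hneg i t₀ hp] with q h h1 h2 h3
    exact absurd (h h1 h3) h2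
  have hlow := hpar.contMDiff_low i
  have hc : Tendsto (fun q : (ℝ × M) × ℝ => (q.1.1, q.2)) (𝓝 ((t₀, y₀), 0)) (𝓝 (t₀, 0)) :=
    (continuous_fst.fst.prodMk continuous_snd).tendsto ((t₀, y₀), (0 : ℝ))
  have hc2 : Tendsto (fun q : (ℝ × M) × ℝ => q.1.2) (𝓝 ((t₀, y₀), 0)) (𝓝 y₀) :=
    continuous_fst.snd.tendsto ((t₀, y₀), (0 : ℝ))
  have hxy := hpar.isUnderOver i t₀
  rw [not_or] at hp
  by_cases hproj : D.proj y₀ = D.proj (low i t₀)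
  · have h1 := (continuousAt_fderiv_stripMap hΦ hlow t₀ (1, 0)).tendsto.comp hc
    have h2 := (D.continuous_normal.tendsto y₀).comp hc2
    have h3 := h1.inner (𝕜 := ℝ) h2
    obtain ⟨κ, hκ, hκ'⟩ := hor i t₀
    have h4 : ⟪fderiv ℝ (fun q => D.proj (stripMap Φ (low i) q)) (t₀, 0) (1, 0),
        D.normal y₀⟫ ≠ 0 := by
      rw [fderiv_stripMap_fst hΦ hlow, hκ', inner_smul_left]
      refine mul_ne_zero hκ.ne' (D.inner_cross3_normal_ne_zero hxy.ne.symm (Ne.symm hp.2)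
        (Ne.symm hp.1) hxy.1.symm (hxy.1.symm.trans hproj.symm))
    filter_upwards [h3.eventually_ne h4] with q hq _ _ _ using hq
  · have h1 : Tendsto (fun q : (ℝ × M) × ℝ => (D.proj q.1.2,
        D.proj (stripMap Φ (low i) (q.1.1, q.2)))) (𝓝 ((t₀, y₀), 0))
        (𝓝 (D.proj y₀, D.proj (low i t₀))) := by
      rw [nhds_prod_eq (x := D.proj y₀) (y := D.proj (low i t₀))]
      exact ((D.continuous_proj.tendsto _).comp hc2).prodMk
        ((D.continuous_proj.tendsto _).comp ((tendsto_stripMap hΦ hlow t₀).comp hc))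
    filter_upwards [h1.eventually (isClosed_diagonal.isOpen_compl.mem_nhds hproj)] with q hq _ _ h
    exact absurd h hq

omit hor in
-- Two further preimages over a pushed point must both be near third preimages over the original
-- double point. There is at most one of these, as no point has four preimages, and the projection
-- is injective near it.
theorem eventually_misses_triple [IsManifold (𝓡 2) ∞ M] (i : Fin n) (t₀ : ℝ) (y₀ z₀ : M) :
    ∀ᶠ q in 𝓝 ((t₀, y₀, z₀), (0 : ℝ)), 0 < q.2 →
      q.1.2.1 ≠ stripMap Φ (low i) (q.1.1, q.2) → q.1.2.2 ≠ stripMap Φ (low i) (q.1.1, q.2) →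
      D.proj q.1.2.1 = D.proj (stripMap Φ (low i) (q.1.1, q.2)) →
      D.proj q.1.2.2 = D.proj (stripMap Φ (low i) (q.1.1, q.2)) → q.1.2.1 = q.1.2.2 := by
  have hlow := hpar.contMDiff_low i
  have hcy : Tendsto (fun q : (ℝ × M × M) × ℝ => ((q.1.1, q.1.2.1), q.2)) (𝓝 ((t₀, y₀, z₀), 0))
      (𝓝 ((t₀, y₀), 0)) := Continuous.tendsto (by fun_prop) ((t₀, y₀, z₀), (0 : ℝ))
  have hcz : Tendsto (fun q : (ℝ × M × M) × ℝ => ((q.1.1, q.1.2.2), q.2)) (𝓝 ((t₀, y₀, z₀), 0))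
      (𝓝 ((t₀, z₀), 0)) := Continuous.tendsto (by fun_prop) ((t₀, y₀, z₀), (0 : ℝ))
  have hcyz : Tendsto (fun q : (ℝ × M × M) × ℝ => (q.1.2.1, q.1.2.2)) (𝓝 ((t₀, y₀, z₀), 0))
      (𝓝 (y₀, z₀)) := Continuous.tendsto (by fun_prop) ((t₀, y₀, z₀), (0 : ℝ))
  have hct : Tendsto (fun q : (ℝ × M × M) × ℝ => (q.1.1, q.2)) (𝓝 ((t₀, y₀, z₀), 0))
      (𝓝 (t₀, 0)) := Continuous.tendsto (by fun_prop) ((t₀, y₀, z₀), (0 : ℝ))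
  by_cases hpy : y₀ = low i t₀ ∨ y₀ = up i t₀
  · filter_upwards [hcy.eventually (eventually_stripMap_off_pair hpar hΦ hneg i t₀ hpy)]
      with q h h1 h2 _ h3
    exact absurd (h h1 h3) h2
  by_cases hpz : z₀ = low i t₀ ∨ z₀ = up i t₀
  · filter_upwards [hcz.eventually (eventually_stripMap_off_pair hpar hΦ hneg i t₀ hpz)]
      with q h h1 _ h2 _ h3
    exact absurd (h h1 h3) h2
  have hne : ∀ w₀, D.proj w₀ ≠ D.proj (low i t₀) →
      ∀ w : (ℝ × M × M) × ℝ → M, Tendsto w (𝓝 ((t₀, y₀, z₀), 0)) (𝓝 w₀) →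
      ∀ᶠ q in 𝓝 ((t₀, y₀, z₀), (0 : ℝ)),
        D.proj (w q) ≠ D.proj (stripMap Φ (low i) (q.1.1, q.2)) := by
    intro w₀ h w hw
    have h1 : Tendsto (fun q : (ℝ × M × M) × ℝ => (D.proj (w q),
        D.proj (stripMap Φ (low i) (q.1.1, q.2)))) (𝓝 ((t₀, y₀, z₀), 0))
        (𝓝 (D.proj w₀, D.proj (low i t₀))) := by
      rw [nhds_prod_eq (x := D.proj w₀) (y := D.proj (low i t₀))]
      exact ((D.continuous_proj.tendsto _).comp hw).prodMk
        ((D.continuous_proj.tendsto _).comp ((tendsto_stripMap hΦ hlow t₀).comp hct))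
    exact h1.eventually (isClosed_diagonal.isOpen_compl.mem_nhds h)
  by_cases hy : D.proj y₀ = D.proj (low i t₀)
  swap
  · filter_upwards [hne y₀ hy (fun q => q.1.2.1) ((continuous_fst.tendsto (y₀, z₀)).comp hcyz)]
      with q h _ _ _ h' _ using absurd h' h
  by_cases hz : D.proj z₀ = D.proj (low i t₀)
  swap
  · filter_upwards [hne z₀ hz (fun q => q.1.2.2) ((continuous_snd.tendsto (y₀, z₀)).comp hcyz)]
      with q h _ _ _ _ h' using absurd h' h
  have hxy := hpar.isUnderOver i t₀
  rw [not_or] at hpy hpz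
  have hyz : y₀ = z₀ := by
    by_contra hyz
    exact D.not_four_preimages hxy.ne (Ne.symm hpy.1) (Ne.symm hpz.1) (Ne.symm hpy.2)
      (Ne.symm hpz.2) hyz hxy.1 hy.symm hz.symm
  subst hyz
  filter_upwards [hcyz.eventually (D.eventually_proj_injective y₀)] with q h _ _ _ h1 h2
  exact h (h1.trans h2.symm)

omit hneg in
-- The hypothesis is about the lower curves before the push, because the push is injective. If the
-- upper points agree in the limit, regularity forces equal parameters. Otherwise the limit point is
-- the bottom of a triple point, and the two tangents `n₁ × n` and `n₂ × n` are independent because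
-- their cross product is a multiple of `n` by the triple product of the normals.
theorem eventually_self_transverse [T2Space M] (i j : Fin n) (t₀ t₁ : ℝ) :
    ∀ᶠ q in 𝓝 ((t₀, t₁), (0 : ℝ)), low i q.1.1 = low j q.1.2 → SameParam i q.1.1 j q.1.2 ∨
      cross3 (fderiv ℝ (fun q => D.proj (stripMap Φ (low i) q)) (q.1.1, q.2) (1, 0))
        (fderiv ℝ (fun q => D.proj (stripMap Φ (low j) q)) (q.1.2, q.2) (1, 0)) ≠ 0 := by
  have hci : Tendsto (fun q : (ℝ × ℝ) × ℝ => (q.1.1, q.2)) (𝓝 ((t₀, t₁), 0)) (𝓝 (t₀, 0)) :=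
    Continuous.tendsto (by fun_prop) ((t₀, t₁), (0 : ℝ))
  have hcj : Tendsto (fun q : (ℝ × ℝ) × ℝ => (q.1.2, q.2)) (𝓝 ((t₀, t₁), 0)) (𝓝 (t₁, 0)) :=
    Continuous.tendsto (by fun_prop) ((t₀, t₁), (0 : ℝ))
  by_cases hlow : low i t₀ = low j t₁
  swap
  · have h1 : Continuous fun q : (ℝ × ℝ) × ℝ => (low i q.1.1, low j q.1.2) :=
      ((hpar.contMDiff_low i).continuous.comp continuous_fst.fst).prodMk
        ((hpar.contMDiff_low j).continuous.comp continuous_fst.snd)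
    filter_upwards [(h1.tendsto ((t₀, t₁), (0 : ℝ))).eventually
      (isClosed_diagonal.isOpen_compl.mem_nhds hlow)] with q hq h
    exact absurd h hq
  by_cases hup : up i t₀ = up j t₁
  · obtain ⟨rfl, m, hm⟩ := hpar.injective i t₀ j t₁ hlow hup
    have hs : ContDiff ℝ ∞ fun r => D.proj (low i r) :=
      contDiff_iff_contDiffAt.2 fun r => D.contDiffAt_proj_comp le_rfl
        (hpar.contMDiff_low i).contMDiffAt
    have hst := (hs.contDiffAt (x := t₀)).hasStrictDerivAt (by simp)
    have hinj : ∀ᶠ p in 𝓝 (t₀, t₀), D.proj (low i p.1) = D.proj (low i p.2) → p.1 = p.2 := by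
      set d := deriv (fun r => D.proj (low i r)) t₀ with hd
      have hd0 : 0 < ‖d‖ := norm_pos_iff.2 (hpar.regular i t₀)
      -- Any positive constant below the speed `‖d‖` gives injectivity near `t₀`.
      filter_upwards [hst.hasStrictFDerivAt.isLittleO.def (c := ‖d‖ / 2) (by positivity)]
        with p hp heq
      rw [heq, sub_self, zero_sub, norm_neg] at hp
      simp only [ContinuousLinearMap.toSpanSingleton_apply, norm_smul] at hp
      have h3 : ‖p.1 - p.2‖ * (‖d‖ / 2) ≤ 0 := by linarith
      have h4 : ‖p.1 - p.2‖ ≤ 0 := by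
        by_contra hcon
        push Not at hcon
        have : 0 < ‖p.1 - p.2‖ * (‖d‖ / 2) := by positivity
        linarith
      exact sub_eq_zero.1 (norm_le_zero_iff.1 h4)
    -- The parameters agree only up to the period `m`; the shift brings both of them near `t₀`.
    have hc : Tendsto (fun q : (ℝ × ℝ) × ℝ => (q.1.1, q.1.2 - m)) (𝓝 ((t₀, t₁), 0))
        (𝓝 (t₀, t₀)) := by
      have : Continuous fun q : (ℝ × ℝ) × ℝ => (q.1.1, q.1.2 - (m : ℝ)) := by fun_prop
      have h := this.tendsto ((t₀, t₁), (0 : ℝ))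
      simpa [hm] using h
    filter_upwards [hc.eventually hinj] with q hq heq
    refine Or.inl ⟨rfl, m, ?_⟩
    have h1 : low i (q.1.2 - m) = low i q.1.2 := by
      have := (hpar.periodic_low i).int_mul m (q.1.2 - m)
      rw [mul_one, sub_add_cancel] at this
      exact this.symm
    have := hq (by simp only [h1, heq])
    linarith
  · have h1 := (continuousAt_fderiv_stripMap hΦ (hpar.contMDiff_low i) t₀ (1, 0)).tendsto.comp hci
    have h2 := (continuousAt_fderiv_stripMap hΦ (hpar.contMDiff_low j) t₁ (1, 0)).tendsto.comp hcj
    have h3 := ((continuous_cross3.tendsto _).comp (h1.prodMk_nhds h2))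
    have h4 : cross3 (fderiv ℝ (fun q => D.proj (stripMap Φ (low i) q)) (t₀, 0) (1, 0))
        (fderiv ℝ (fun q => D.proj (stripMap Φ (low j) q)) (t₁, 0) (1, 0)) ≠ 0 := by
      rw [fderiv_stripMap_fst hΦ (hpar.contMDiff_low i),
        fderiv_stripMap_fst hΦ (hpar.contMDiff_low j)]
      obtain ⟨κ, hκ, hκ'⟩ := hor i t₀
      obtain ⟨μ, hμ, hμ'⟩ := hor j t₁
      rw [hκ', hμ', hlow]
      intro h0
      have hx := hpar.isUnderOver i t₀
      have hy := hpar.isUnderOver j t₁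
      rw [hlow] at hx
      refine D.inner_cross3_normal_ne_zero hx.ne hy.ne hup hx.1 hy.1 ?_
      set a := D.normal (up i t₀)
      set b := D.normal (up j t₁)
      set c := D.normal (low j t₁)
      have h5 : cross3 (κ • cross3 a c) (μ • cross3 b c) = (κ * μ * ⟪cross3 c a, b⟫) • c := by
        ext k; fin_cases k <;> simp [inner_eq_sum_three] <;> ring
      rw [h5, smul_eq_zero] at h0
      have hc0 : c ≠ 0 := by
        rw [← norm_ne_zero_iff, D.norm_normal]; exact one_ne_zero
      have := h0.resolve_right hc0
      exact (mul_eq_zero.1 this).resolve_left (mul_pos hκ hμ).ne'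
    filter_upwards [h3.eventually_ne h4] with q hq _
    exact Or.inr hq

end Double

end RegularDiagram

/-! ### Existence of small push-offs -/

theorem linearIndependent_of_cross3_ne_zero {a b : E3} (h : cross3 a b ≠ 0) :
    LinearIndependent ℝ ![a, b] := by
  rw [LinearIndependent.pair_iff]
  intro s t hst
  have h1 : t • cross3 a b = cross3 a (s • a + t • b) := by
    ext i; fin_cases i <;> simp <;> ring
  have h2 : s • cross3 a b = cross3 (s • a + t • b) b := by
    ext i; fin_cases i <;> simp <;> ring
  rw [hst] at h1 h2
  have h3 : cross3 a 0 = 0 := by ext i; fin_cases i <;> simp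
  have h4 : cross3 0 b = 0 := by ext i; fin_cases i <;> simp
  rw [h3, smul_eq_zero] at h1
  rw [h4, smul_eq_zero] at h2
  exact ⟨h2.resolve_right h, h1.resolve_right h⟩

namespace RegularDiagram

variable {M : Type u} [TopologicalSpace M] [ChartedSpace (EuclideanSpace ℝ (Fin 2)) M]
  {D : RegularDiagram M}

/-- The curves `L` are pushed off the double point curves along the immersed strips `h`, which start
at the lower curves at time `0`, reach `L` at time `δ` and extend beyond both of them. -/
structure IsStrip (L : D.ImmersedCurves) (low up : Fin L.n → ℝ → M) (h : Fin L.n → ℝ × ℝ → M)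
    (δ η : ℝ) : Prop where
  pos : 0 < δ
  lt : δ < η
  parametrizes : D.ParametrizesDoubleCurves low up
  contMDiffAt : ∀ i t s, |s| < η → ContMDiffAt 𝓘(ℝ, ℝ × ℝ) (𝓡 2) ∞ (h i) (t, s)
  periodic : ∀ i s, Function.Periodic (fun t => h i (t, s)) 1
  zero : ∀ i t, h i (t, 0) = low i t
  curve : ∀ i t, h i (t, δ) = L.curve i t
  immersed : ∀ i t s, |s| < η → ⟪cross3 (D.normal (h i (t, s)))
    (fderiv ℝ (fun q => D.proj (h i q)) (t, s) (1, 0)),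
    fderiv ℝ (fun q => D.proj (h i q)) (t, s) (0, 1)⟫ < 0
  against_upper : ∀ i t s, |s| < η →
    ⟪fderiv ℝ (fun q => D.proj (h i q)) (t, s) (0, 1), D.normal (up i t)⟫ < 0

theorem hasDerivAt_fst_of_contMDiffAt {h : ℝ × ℝ → M} {t s : ℝ}
    (hh : ContMDiffAt 𝓘(ℝ, ℝ × ℝ) (𝓡 2) ∞ h (t, s)) :
    HasDerivAt (fun r => D.proj (h (r, s))) (fderiv ℝ (fun q => D.proj (h q)) (t, s) (1, 0)) t :=
  (((D.contDiffAt_proj_comp le_rfl hh).differentiableAt (by simp)).hasFDerivAt).comp_hasDerivAt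
    (f := fun r : ℝ => (r, s)) t ((hasDerivAt_id t).prodMk (hasDerivAt_const _ _))

theorem hasDerivAt_snd_of_contMDiffAt {h : ℝ × ℝ → M} {t s : ℝ}
    (hh : ContMDiffAt 𝓘(ℝ, ℝ × ℝ) (𝓡 2) ∞ h (t, s)) :
    HasDerivAt (fun r => D.proj (h (t, r))) (fderiv ℝ (fun q => D.proj (h q)) (t, s) (0, 1)) s :=
  (((D.contDiffAt_proj_comp le_rfl hh).differentiableAt (by simp)).hasFDerivAt).comp_hasDerivAt
    (f := fun r : ℝ => (t, r)) s ((hasDerivAt_const _ _).prodMk (hasDerivAt_id s))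

variable (D)

/-- The double point curves have arbitrarily small push-offs. -/
theorem exists_pushOff [IsManifold (𝓡 2) ∞ M] [T2Space M] [CompactSpace M] {ε : ℝ} (hε : 0 < ε) :
    ∃ (L : D.ImmersedCurves) (low up : Fin L.n → ℝ → M) (h : Fin L.n → ℝ × ℝ → M) (δ η : ℝ),
      IsStrip L low up h δ η ∧ D.IsPushOff L ε := by
  obtain ⟨n, low, up, hpar, hor⟩ := D.exists_parametrization
  obtain ⟨Φ, hΦ, hneg⟩ := D.exists_push
  have hper := fun i => stripMap_periodic (Φ := Φ) (hpar.periodic_low i)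
  have hperf := fun i => fderiv_stripMap_periodic (D := D) (Φ := Φ) (hpar.periodic_low i)
  have hlow := hpar.contMDiff_low
  have hcI := isCompact_Icc (a := (0 : ℝ)) (b := 1)
  have e1 : ∀ᶠ s in 𝓝 (0 : ℝ), ∀ i, ∀ t,
      ContMDiffAt 𝓘(ℝ, ℝ × ℝ) (𝓡 2) ∞ (stripMap Φ (low i)) (t, s) := by
    have : ∀ᶠ s in 𝓝 (0 : ℝ), ∀ p, ContMDiffAt (𝓘(ℝ, ℝ).prod (𝓡 2)) (𝓡 2) ∞ Φ (s, p) :=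
      eventually_forall_of_compact (Y := M) isCompact_univ
        (P := fun p s => ContMDiffAt (𝓘(ℝ, ℝ).prod (𝓡 2)) (𝓡 2) ∞ Φ (s, p))
        (fun s p => ⟨p, mem_univ p, id⟩)
        (fun p _ => (continuous_swap.tendsto (p, (0 : ℝ))).eventually (hΦ.smooth p))
    filter_upwards [this] with s hs i t
    refine ContMDiffAt.comp (f := fun q : ℝ × ℝ => (q.2, low i q.1)) (t, s) (hs (low i t)) ?_
    exact (contMDiffAt_iff_contDiffAt.2 contDiffAt_snd).prodMk
      (ContMDiffAt.comp (f := Prod.fst) (t, s) (hlow i).contMDiffAt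
        (contMDiffAt_iff_contDiffAt.2 contDiffAt_fst))
  have e2 : ∀ᶠ s in 𝓝 (0 : ℝ), ∀ i, ∀ t,
      ⟪cross3 (D.normal (stripMap Φ (low i) (t, s)))
        (fderiv ℝ (fun q => D.proj (stripMap Φ (low i) q)) (t, s) (1, 0)),
        fderiv ℝ (fun q => D.proj (stripMap Φ (low i) q)) (t, s) (0, 1)⟫ < 0 ∧
      ⟪fderiv ℝ (fun q => D.proj (stripMap Φ (low i) q)) (t, s) (0, 1), D.normal (up i t)⟫ < 0 ∧
      0 < ⟪cross3 (D.normal (stripMap Φ (low i) (t, s)))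
        (fderiv ℝ (fun q => D.proj (stripMap Φ (low i) q)) (t, s) (1, 0)), D.normal (up i t)⟫ :=
    eventually_all.2 fun i =>
    eventually_forall_of_compact hcI
      (P := fun t s => ⟪cross3 (D.normal (stripMap Φ (low i) (t, s)))
        (fderiv ℝ (fun q => D.proj (stripMap Φ (low i) q)) (t, s) (1, 0)),
        fderiv ℝ (fun q => D.proj (stripMap Φ (low i) q)) (t, s) (0, 1)⟫ < 0 ∧
      ⟪fderiv ℝ (fun q => D.proj (stripMap Φ (low i) q)) (t, s) (0, 1), D.normal (up i t)⟫ < 0 ∧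
      0 < ⟪cross3 (D.normal (stripMap Φ (low i) (t, s)))
        (fderiv ℝ (fun q => D.proj (stripMap Φ (low i) q)) (t, s) (1, 0)), D.normal (up i t)⟫)
      (fun s t => ⟨Int.fract t, fract_mem_Icc t, fun h => by
      have a := (hper i s).map_fract_one t
      have b := (hperf i s).map_fract_one t
      have c := (hpar.periodic_up i).map_fract_one t
      beta_reduce at a b
      beta_reduce at h
      rw [a, b, c] at h
      exact h⟩) (fun t _ => eventually_strip_geometry hpar hΦ hneg hor i t)
  have hderper : ∀ i, Function.Periodic (deriv (fun r => D.proj (low i r))) 1 := fun i t => by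
    have h1 : (fun r => D.proj (low i r)) = fun r => D.proj (low i (r + 1)) := by
      funext r; rw [hpar.periodic_low i r]
    conv_rhs => rw [h1]
    rw [deriv_comp_add_const (f := fun r => D.proj (low i r))]
  have e3 : ∀ᶠ s in 𝓝 (0 : ℝ), ∀ i, ∀ t,
      dist (D.proj (stripMap Φ (low i) (t, s))) (D.proj (low i t)) < ε ∧
      dist (D.height (stripMap Φ (low i) (t, s))) (D.height (low i t)) < ε ∧
      ‖fderiv ℝ (fun q => D.proj (stripMap Φ (low i) q)) (t, s) (1, 0) -
        deriv (fun r => D.proj (low i r)) t‖ < ε :=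
    eventually_all.2 fun i =>
    eventually_forall_of_compact hcI
      (P := fun t s => dist (D.proj (stripMap Φ (low i) (t, s))) (D.proj (low i t)) < ε ∧
      dist (D.height (stripMap Φ (low i) (t, s))) (D.height (low i t)) < ε ∧
      ‖fderiv ℝ (fun q => D.proj (stripMap Φ (low i) q)) (t, s) (1, 0) -
        deriv (fun r => D.proj (low i r)) t‖ < ε)
      (fun s t => ⟨Int.fract t, fract_mem_Icc t, fun h => by
      have a := (hper i s).map_fract_one t
      have b := (hperf i s).map_fract_one t
      have c := (hpar.periodic_low i).map_fract_one t
      have d := (hderper i).map_fract_one t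
      beta_reduce at a b
      beta_reduce at h
      rw [a, b, c, d] at h
      exact h⟩) (fun t _ => eventually_strip_close hpar hΦ hε i t)
  have e4 := hΦ.eventually_injective
  have e5 : ∀ᶠ s in 𝓝 (0 : ℝ), ∀ i, ∀ ty : ℝ × M,
      0 < s → ty.2 ≠ stripMap Φ (low i) (ty.1, s) →
      D.proj ty.2 = D.proj (stripMap Φ (low i) (ty.1, s)) →
      ⟪fderiv ℝ (fun q => D.proj (stripMap Φ (low i) q)) (ty.1, s) (1, 0), D.normal ty.2⟫ ≠ 0 :=
    eventually_all.2 fun i =>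
    eventually_forall_of_compact (hcI.prod isCompact_univ)
      (P := fun ty s => 0 < s → ty.2 ≠ stripMap Φ (low i) (ty.1, s) →
      D.proj ty.2 = D.proj (stripMap Φ (low i) (ty.1, s)) →
      ⟪fderiv ℝ (fun q => D.proj (stripMap Φ (low i) q)) (ty.1, s) (1, 0), D.normal ty.2⟫ ≠ 0)
      (fun s ty => ⟨(Int.fract ty.1, ty.2), ⟨fract_mem_Icc ty.1, mem_univ _⟩, fun h => by
        have a := (hper i s).map_fract_one ty.1
        have b := (hperf i s).map_fract_one ty.1
        beta_reduce at a b
        beta_reduce at h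
        simp only [a, b] at h
        exact h⟩)
      (fun ty _ => eventually_double_transverse hpar hΦ hneg hor i ty.1 ty.2)
  have e6 : ∀ᶠ s in 𝓝 (0 : ℝ), ∀ i, ∀ ty : ℝ × M × M,
      0 < s → ty.2.1 ≠ stripMap Φ (low i) (ty.1, s) →
      ty.2.2 ≠ stripMap Φ (low i) (ty.1, s) →

      D.proj ty.2.1 = D.proj (stripMap Φ (low i) (ty.1, s)) →
      D.proj ty.2.2 = D.proj (stripMap Φ (low i) (ty.1, s)) →
      ty.2.1 = ty.2.2 :=
    eventually_all.2 fun i =>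
    eventually_forall_of_compact (hcI.prod isCompact_univ)
      (P := fun (ty : ℝ × M × M) s => 0 < s → ty.2.1 ≠ stripMap Φ (low i) (ty.1, s) →
      ty.2.2 ≠ stripMap Φ (low i) (ty.1, s) →

      D.proj ty.2.1 = D.proj (stripMap Φ (low i) (ty.1, s)) →
      D.proj ty.2.2 = D.proj (stripMap Φ (low i) (ty.1, s)) →
      ty.2.1 = ty.2.2)
      (fun s ty => ⟨(Int.fract ty.1, ty.2), ⟨fract_mem_Icc ty.1, mem_univ _⟩, fun h => by
        have a := (hper i s).map_fract_one ty.1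
        beta_reduce at a
        simp only [a] at h
        exact h⟩)
      (fun ty _ => eventually_misses_triple hpar hΦ hneg i ty.1 ty.2.1 ty.2.2)
  have e7 : ∀ᶠ s in 𝓝 (0 : ℝ), ∀ i j, ∀ tt : ℝ × ℝ, low i tt.1 = low j tt.2 →
      SameParam i tt.1 j tt.2 ∨
      cross3 (fderiv ℝ (fun q => D.proj (stripMap Φ (low i) q)) (tt.1, s) (1, 0))
        (fderiv ℝ (fun q => D.proj (stripMap Φ (low j) q)) (tt.2, s) (1, 0)) ≠ 0 :=
    eventually_all.2 fun i => eventually_all.2 fun j =>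
    eventually_forall_of_compact (hcI.prod hcI)
      (P := fun tt s => low i tt.1 = low j tt.2 → SameParam i tt.1 j tt.2 ∨
      cross3 (fderiv ℝ (fun q => D.proj (stripMap Φ (low i) q)) (tt.1, s) (1, 0))
        (fderiv ℝ (fun q => D.proj (stripMap Φ (low j) q)) (tt.2, s) (1, 0)) ≠ 0)
      (fun s tt => ⟨(Int.fract tt.1, Int.fract tt.2), ⟨fract_mem_Icc _, fract_mem_Icc _⟩,
        fun h hl => by
        have a := (hpar.periodic_low i).map_fract_one tt.1
        have b := (hpar.periodic_low j).map_fract_one tt.2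
        have c := (hperf i s).map_fract_one tt.1
        have d := (hperf j s).map_fract_one tt.2
        beta_reduce at c d
        simp only [a, b, c, d] at h
        exact (h hl).imp_left SameParam.of_fract⟩)
      (fun tt _ => eventually_self_transverse hpar hΦ hor i j tt.1 tt.2)
  -- All conditions hold for all times below a common `η`. The curves of `L` are taken at time `η /
  -- 2`, so the strips extend beyond both of their boundary curves and have coordinates on both
  -- sides of each.
  obtain ⟨η, hη, hall⟩ := Metric.eventually_nhds_iff_ball.1
    (e1.and (e2.and (e3.and (e4.and (e5.and (e6.and e7))))))
  have hgood : ∀ s, |s| < η → _ := fun s hs => hall s (by rwa [mem_ball_zero_iff])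
  have hδ0 : 0 < η / 2 := by positivity
  have hδη : η / 2 < η := by linarith
  set δ := η / 2 with hδ
  obtain ⟨g1, g2, g3, g4, g5, g6, g7⟩ := hgood δ (by rwa [abs_of_pos hδ0])
  have hcd : ∀ i t, HasDerivAt (fun r => D.proj (stripMap Φ (low i) (r, δ)))
      (fderiv ℝ (fun q => D.proj (stripMap Φ (low i) q)) (t, δ) (1, 0)) t := fun i t =>
    hasDerivAt_fst_of_contMDiffAt (g1 i t)
  have hsame : ∀ i s j t, stripMap Φ (low i) (s, δ) = stripMap Φ (low j) (t, δ) →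
      low i s = low j t := fun i s j t h => g4 h
  let L : D.ImmersedCurves :=
    { n := n
      curve := fun i t => stripMap Φ (low i) (t, δ)
      contMDiff := fun i t => ContMDiffAt.comp (f := fun t : ℝ => (t, δ)) t (g1 i t)
        (contMDiffAt_iff_contDiffAt.2 (contDiffAt_id.prodMk contDiffAt_const))
      periodic := fun i => hper i δ
      immersed := fun i t h0 => by
        rw [(hcd i t).deriv] at h0
        have h1 := (g2 i t).1
        beta_reduce at h1
        rw [h0] at h1
        simp [inner_eq_sum_three] at h1
      self_transverse := fun i s j t h => by
        rw [(hcd i s).deriv, (hcd j t).deriv]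
        exact (g7 i j (s, t) (hsame i s j t h)).imp_right linearIndependent_of_cross3_ne_zero
      -- Three branches of `L` through one point come from three lower curves through one point.
      -- Their upper points would be distinct, which gives four preimages over one point of ℝ³.
      no_triple := fun i s j t k r h h' => by
        by_contra hcon
        push Not at hcon
        obtain ⟨h1, h2, h3⟩ := hcon
        have hl := hsame _ _ _ _ h
        have hl' := hsame _ _ _ _ h'
        have a := hpar.isUnderOver i s
        have b := hpar.isUnderOver j t
        have c := hpar.isUnderOver k r
        rw [hl, hl'] at a
        rw [hl'] at b
        refine D.not_four_preimages a.ne b.ne c.ne (fun h => h1 (hpar.injective _ _ _ _ hl h))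
          (fun h => h3 (hpar.injective _ _ _ _ (hl.trans hl') h))
          (fun h => h2 (hpar.injective _ _ _ _ hl' h)) a.1 b.1 c.1
      double_transverse := fun i t y hy h => by
        rw [(hcd i t).deriv]
        exact g5 i (t, y) hδ0 hy h
      misses_triple := fun i t y z hy hz h h' => g6 i (t, y, z) hδ0 hy hz h h' }
  refine ⟨L, low, up, fun i => stripMap Φ (low i), δ, η, ⟨hδ0, hδη, hpar, fun i t s hs =>
    (hgood s hs).1 i t, hper, fun i t => stripMap_zero hΦ t, fun i t => rfl,
    fun i t s hs => ((hgood s hs).2.1 i t).1, fun i t s hs => ((hgood s hs).2.1 i t).2.1⟩,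
    low, up, hpar, fun i => ?_⟩
  have hs' : ∀ s ∈ Icc (0 : ℝ) 1, |δ * s| < η := fun s hs => by
    rw [abs_of_nonneg (mul_nonneg hδ0.le hs.1)]
    nlinarith [hs.2]
  -- The homotopy is the strip with its time interval `[0, δ]` rescaled to `[0, 1]`.
  refine ⟨fun t s => stripMap Φ (low i) (t, δ * s), ?_, fun s hs => hper i (δ * s),
    fun t => by beta_reduce; rw [mul_zero]; exact stripMap_zero hΦ t,
    fun t => by beta_reduce; rw [mul_one], ?_, ?_, ?_⟩
  · rintro ⟨t, s⟩ ⟨-, hs⟩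
    refine ContMDiffAt.contMDiffWithinAt ?_
    refine ContMDiffAt.comp (f := fun q : ℝ × ℝ => (q.1, δ * q.2)) (t, s)
      ((hgood _ (hs' s hs)).1 i t) ?_
    exact contMDiffAt_iff_contDiffAt.2
      (contDiffAt_fst.prodMk (contDiffAt_const.mul contDiffAt_snd))
  · intro t s hs
    have hg := hgood _ (hs' s hs)
    refine ⟨?_, (hg.2.2.1 i t).1, (hg.2.2.1 i t).2.1⟩
    have h1 := hasDerivAt_snd_of_contMDiffAt (D := D) (hg.1 i t)
    have h2 : HasDerivAt (fun r : ℝ => δ * r) δ s := by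
      simpa using (hasDerivAt_id s).const_mul δ
    have h3 := h1.scomp s h2
    have h4 : derivWithin (fun r => D.proj (stripMap Φ (low i) (t, δ * r))) (Icc 0 1) s = _ :=
      h3.hasDerivWithinAt.derivWithin (uniqueDiffOn_Icc_zero_one s hs)
    rw [h4, inner_smul_left]
    exact mul_neg_of_pos_of_neg hδ0 (hg.2.1 i t).2.1
  · intro t
    have : L.velocity i t = _ := (hcd i t).deriv
    rw [this]
    exact (g3 i t).2.2
  · intro t
    have : L.velocity i t = _ := (hcd i t).deriv
    rw [ImmersedCurves.normalDir, this]
    exact (g2 i t).2.2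

end RegularDiagram

/-! ### Box coordinates on the surface -/

/-- Two maps that are continuous and inverse to each other near a point are the two directions of
an open partial homeomorphism. -/
theorem exists_openPartialHomeomorph {X Y : Type*} [TopologicalSpace X] [TopologicalSpace Y]
    {f : X → Y} {g : Y → X} {a : X} (hf : ∀ᶠ x in 𝓝 a, ContinuousAt f x)
    (hg : ∀ᶠ y in 𝓝 (f a), ContinuousAt g y) (hgf : ∀ᶠ x in 𝓝 a, g (f x) = x)
    (hfg : ∀ᶠ y in 𝓝 (f a), f (g y) = y) :
    ∃ e : OpenPartialHomeomorph X Y, a ∈ e.source ∧ ⇑e = f ∧ ⇑e.symm = g := by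
  obtain ⟨U, hU, hUo, haU⟩ := eventually_nhds_iff.1 (hf.and hgf)
  obtain ⟨V, hV, hVo, haV⟩ := eventually_nhds_iff.1 (hg.and hfg)
  have hcf : ContinuousOn f U := fun x hx => (hU x hx).1.continuousWithinAt
  have hcg : ContinuousOn g V := fun x hx => (hV x hx).1.continuousWithinAt
  refine ⟨{ toFun := f
            invFun := g
            source := U ∩ f ⁻¹' V
            target := V ∩ g ⁻¹' U
            map_source' := ?_
            map_target' := ?_
            left_inv' := fun x hx => (hU x hx.1).2
            right_inv' := fun y hy => (hV y hy.1).2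
            open_source := hcf.isOpen_inter_preimage hUo hVo
            open_target := hcg.isOpen_inter_preimage hVo hUo
            continuousOn_toFun := hcf.mono inter_subset_left
            continuousOn_invFun := hcg.mono inter_subset_left }, ⟨haU, haV⟩, rfl, rfl⟩
  · intro x hx
    refine ⟨hx.2, ?_⟩
    rw [mem_preimage, (hU x hx.1).2]
    exact hx.1
  · intro y hy
    refine ⟨hy.2, ?_⟩
    rw [mem_preimage, (hV y hy.1).2]
    exact hy.1

namespace RegularDiagram

variable {M : Type u} [TopologicalSpace M] [ChartedSpace (EuclideanSpace ℝ (Fin 2)) M]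
  {D : RegularDiagram M}

/-- A parametrized surface piece `h : ℝ × ℝ → M` that is immersed at `q₀` is a local homeomorphism
there, with an inverse that extends differentiably to space. -/
structure IsBox (D : RegularDiagram M) (h : ℝ × ℝ → M) (e : OpenPartialHomeomorph (ℝ × ℝ) M)
    (σ : E3 → ℝ × ℝ) (q₀ : ℝ × ℝ) : Prop where
  mem_source : q₀ ∈ e.source
  coe_eq : ⇑e = h
  symm_eq : ⇑e.symm = fun p => σ (D.proj p)
  differentiableAt : DifferentiableAt ℝ σ (D.proj (h q₀))
  differentiableAt_proj : DifferentiableAt ℝ (fun q => D.proj (h q)) q₀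

theorem exists_isBox [IsManifold (𝓡 2) ∞ M] {h : ℝ × ℝ → M} {q₀ : ℝ × ℝ}
    (hh : ∀ᶠ q in 𝓝 q₀, ContMDiffAt 𝓘(ℝ, ℝ × ℝ) (𝓡 2) ∞ h q)
    (him : ⟪cross3 (D.normal (h q₀)) (fderiv ℝ (fun q => D.proj (h q)) q₀ (1, 0)),
      fderiv ℝ (fun q => D.proj (h q)) q₀ (0, 1)⟫ ≠ 0) : ∃ e σ, D.IsBox h e σ q₀ := by
  have hne : (∞ : WithTop ℕ∞) ≠ 0 := by simp
  obtain ⟨r, g, -, -, hrg⟩ := D.exists_sheet_retraction (h q₀)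
  have hd : DifferentiableAt ℝ (fun q => D.proj (h q)) q₀ :=
    (D.contDiffAt_proj_comp le_rfl hh.self_of_nhds).differentiableAt hne
  have hperp := fun v => D.inner_normal_fderiv (hh.self_of_nhds.mdifferentiableAt hne) v
  set A := fderiv ℝ (fun q => D.proj (h q)) q₀ with hA
  set n := D.normal (h q₀) with hn
  -- Thickening the surface piece along `n` makes the inverse function theorem in ℝ³ applicable; the
  -- first component of the inverse is the required extension `σ` of the coordinates to space.
  let F : (ℝ × ℝ) × ℝ → E3 := fun z => D.proj (h z.1) + z.2 • n
  have hF0 : F (q₀, 0) = D.proj (h q₀) := by simp [F]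
  have hFd : HasFDerivAt F (A.comp (ContinuousLinearMap.fst ℝ (ℝ × ℝ) ℝ) +
      (ContinuousLinearMap.snd ℝ (ℝ × ℝ) ℝ).smulRight n) (q₀, 0) :=
    HasFDerivAt.add (HasFDerivAt.comp (g := fun q => D.proj (h q)) (f := Prod.fst)
      (q₀, (0 : ℝ)) hd.hasFDerivAt hasFDerivAt_fst)
      ((ContinuousLinearMap.snd ℝ (ℝ × ℝ) ℝ).hasFDerivAt.smul_const n)
  have hFs : ∀ᶠ z in 𝓝 (q₀, (0 : ℝ)), ContDiffAt ℝ ∞ F z := by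
    filter_upwards [(continuous_fst.tendsto (q₀, (0 : ℝ))).eventually hh] with z hz
    exact ((D.contDiffAt_proj_comp le_rfl hz).comp z contDiffAt_fst).add
      (contDiffAt_snd.smul contDiffAt_const)
  have hinj : Function.Injective (fderiv ℝ F (q₀, 0)) := by
    rw [hFd.fderiv, injective_iff_map_eq_zero]
    rintro ⟨⟨a, b⟩, c⟩ h0
    have hab : A (a, b) = a • A (1, 0) + b • A (0, 1) := by
      rw [← map_smul, ← map_smul, ← map_add]
      simp
    have h0 : A (a, b) + c • n = 0 := h0
    have hc : c = 0 := by
      have := congrArg (fun w => ⟪n, w⟫) h0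
      simp only [inner_add_right, inner_smul_right, inner_zero_right] at this
      rw [hperp, hn, D.inner_normal_self] at this
      linarith
    rw [hc, zero_smul, add_zero, hab] at h0
    -- The vector `n × ∂₁h` is orthogonal to `∂₁h`, and its product with `∂₂h` is nonzero by `him`.
    have hb : b = 0 := by
      have := congrArg (fun w => ⟪cross3 n (A (1, 0)), w⟫) h0
      simp only [inner_add_right, inner_smul_right, inner_cross3_right, inner_zero_right,
        mul_zero, zero_add] at this
      exact (mul_eq_zero.1 this).resolve_right him
    rw [hb, zero_smul, add_zero] at h0
    have ha : a = 0 := by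
      refine (smul_eq_zero.1 h0).resolve_right fun h1 => him ?_
      rw [h1]
      simp [inner_eq_sum_three]
    rw [ha, hb, hc]
    rfl
  obtain ⟨ψ, hψ0, hψF, hFψ, hψs⟩ := exists_smooth_local_inverse hFs hinj (by simp)
  rw [hF0] at hψ0 hFψ hψs
  have hproj : Tendsto D.proj (𝓝 (h q₀)) (𝓝 (D.proj (h q₀))) := D.continuous_proj.tendsto _
  have hψc : Tendsto ψ (𝓝 (D.proj (h q₀))) (𝓝 (q₀, 0)) := by
    have := hψs.self_of_nhds.continuousAt.tendsto
    rwa [hψ0] at this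
  have hhc : Tendsto h (𝓝 q₀) (𝓝 (h q₀)) := hh.self_of_nhds.continuousAt
  obtain ⟨e, he, hef, heg⟩ := exists_openPartialHomeomorph (f := h)
    (g := fun p => (ψ (D.proj p)).1) (a := q₀) (hh.mono fun q hq => hq.continuousAt)
    (by
      filter_upwards [hproj.eventually hψs] with p hp
      exact continuous_fst.continuousAt.comp
        (hp.continuousAt.comp D.continuous_proj.continuousAt))
    (by
      have h1 : Tendsto (fun q : ℝ × ℝ => (q, (0 : ℝ))) (𝓝 q₀) (𝓝 (q₀, 0)) :=
        (continuous_id.prodMk continuous_const).tendsto q₀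
      filter_upwards [h1.eventually hψF] with q hq
      simp only [F, zero_smul, add_zero] at hq
      rw [hq])
    (by
      have h1 : Tendsto (fun p : M => (p, (0 : ℝ))) (𝓝 (h q₀)) (𝓝 (h q₀, 0)) :=
        (continuous_id.prodMk continuous_const).tendsto (h q₀)
      have h2 : Tendsto (fun p : M => (h (ψ (D.proj p)).1, (ψ (D.proj p)).2)) (𝓝 (h q₀))
          (𝓝 (h q₀, 0)) :=
        ((hhc.comp (continuous_fst.tendsto (q₀, (0 : ℝ)))).prodMk_nhds
          (continuous_snd.tendsto (q₀, (0 : ℝ)))).comp (hψc.comp hproj)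
      -- The point `p` and the point of the piece with the computed coordinates differ in space by a
      -- multiple of `n`, and both lie on the sheet; the retraction along `n` identifies them.
      filter_upwards [h1.eventually hrg, h2.eventually hrg, hproj.eventually hFψ] with p hp hp' hz
      simp only [zero_smul, add_zero] at hp
      have h3 : D.proj (h (ψ (D.proj p)).1) + (ψ (D.proj p)).2 • n = D.proj p := hz
      have h4 := hp'.1
      rw [h3, hp.1] at h4
      exact h4.symm)
  exact ⟨e, fun z => (ψ z).1, he, hef, heg,
    differentiableAt_fst.comp _ (hψs.self_of_nhds.differentiableAt hne), hd⟩

namespace IsBox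

variable {h : ℝ × ℝ → M} {e : OpenPartialHomeomorph (ℝ × ℝ) M} {σ : E3 → ℝ × ℝ} {q₀ : ℝ × ℝ}
  (hb : D.IsBox h e σ q₀)

include hb

theorem symm_apply : e.symm (h q₀) = q₀ := by
  rw [← hb.coe_eq]
  exact e.left_inv hb.mem_source

theorem mem_target : h q₀ ∈ e.target := by
  rw [← hb.coe_eq]
  exact e.map_source hb.mem_source

theorem eventually_left_inv : ∀ᶠ q in 𝓝 q₀, e.symm (h q) = q := by
  have := e.eventually_left_inverse hb.mem_source
  rwa [hb.coe_eq] at this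

theorem eventually_right_inv : ∀ᶠ p in 𝓝 (h q₀), h (e.symm p) = p := by
  have := e.eventually_right_inverse hb.mem_target
  rwa [hb.coe_eq] at this

theorem tendsto : Tendsto h (𝓝 q₀) (𝓝 (h q₀)) := by
  have := e.continuousAt hb.mem_source
  rwa [hb.coe_eq] at this

theorem tendsto_symm : Tendsto e.symm (𝓝 (h q₀)) (𝓝 q₀) := by
  have := (e.continuousAt_symm hb.mem_target).tendsto
  rwa [hb.symm_apply] at this

theorem map_nhds : map h (𝓝 q₀) = 𝓝 (h q₀) := by
  have := e.map_nhds_eq hb.mem_source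
  rwa [hb.coe_eq] at this

/-- The coordinates of an arc, and its velocity in terms of their derivatives. -/
theorem exists_hasDerivAt {γ : ℝ → M} {τ : ℝ} {w : E3} (h0 : γ τ = h q₀) (hγ : ContinuousAt γ τ)
    (hw : HasDerivAt (fun t => D.proj (γ t)) w τ) :
    ∃ a b : ℝ, HasDerivAt (fun t => (e.symm (γ t)).1) a τ ∧
      HasDerivAt (fun t => (e.symm (γ t)).2) b τ ∧
      w = a • fderiv ℝ (fun q => D.proj (h q)) q₀ (1, 0) +
        b • fderiv ℝ (fun q => D.proj (h q)) q₀ (0, 1) := by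
  have hσ := hb.differentiableAt
  rw [← h0] at hσ
  have h1 : HasDerivAt (fun t => e.symm (γ t)) (fderiv ℝ σ (D.proj (γ τ)) w) τ := by
    rw [hb.symm_eq]
    exact hσ.hasFDerivAt.comp_hasDerivAt (f := fun t => D.proj (γ t)) τ hw
  set v := fderiv ℝ σ (D.proj (γ τ)) w with hv
  refine ⟨v.1, v.2, h1.fst, h1.snd, ?_⟩
  have h2 : e.symm (γ τ) = q₀ := by rw [h0, hb.symm_apply]
  have h3 : HasFDerivAt (fun q => D.proj (h q)) (fderiv ℝ (fun q => D.proj (h q)) q₀)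
      (e.symm (γ τ)) := by
    rw [h2]; exact hb.differentiableAt_proj.hasFDerivAt
  have h4 := h3.comp_hasDerivAt τ h1
  have hγ' := hγ.tendsto
  rw [h0] at hγ'
  have h5 := (h4.congr_of_eventuallyEq (by
    filter_upwards [hγ'.eventually hb.eventually_right_inv] with t ht
    rw [Function.comp_apply, ht])).unique hw
  rw [← h5, ← map_smul, ← map_smul, ← map_add]
  simp

end IsBox

end RegularDiagram

/-! ### Connected pieces and sides of a box -/

/-- The open square with centre `q₀` and radius `ρ`. -/
def square (q₀ : ℝ × ℝ) (ρ : ℝ) : Set (ℝ × ℝ) :=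
  Ioo (q₀.1 - ρ) (q₀.1 + ρ) ×ˢ Ioo (q₀.2 - ρ) (q₀.2 + ρ)

theorem square_mem_nhds (q₀ : ℝ × ℝ) {ρ : ℝ} (hρ : 0 < ρ) : square q₀ ρ ∈ 𝓝 q₀ :=
  prod_mem_nhds (Ioo_mem_nhds (by linarith) (by linarith))
    (Ioo_mem_nhds (by linarith) (by linarith))

theorem convex_square (q₀ : ℝ × ℝ) (ρ : ℝ) : Convex ℝ (square q₀ ρ) :=
  (convex_Ioo _ _).prod (convex_Ioo _ _)

theorem isPreconnected_square_fst_lt (q₀ : ℝ × ℝ) (ρ : ℝ) :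
    IsPreconnected (square q₀ ρ ∩ {q | q.1 < q₀.1}) :=
  ((convex_square q₀ ρ).inter
    (convex_halfSpace_lt (LinearMap.fst ℝ ℝ ℝ).isLinear q₀.1)).isPreconnected

theorem isPreconnected_square_fst_gt (q₀ : ℝ × ℝ) (ρ : ℝ) :
    IsPreconnected (square q₀ ρ ∩ {q | q₀.1 < q.1}) :=
  ((convex_square q₀ ρ).inter
    (convex_halfSpace_gt (LinearMap.fst ℝ ℝ ℝ).isLinear q₀.1)).isPreconnected

theorem isPreconnected_square_snd_lt (q₀ : ℝ × ℝ) (ρ : ℝ) :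
    IsPreconnected (square q₀ ρ ∩ {q | q.2 < q₀.2}) :=
  ((convex_square q₀ ρ).inter
    (convex_halfSpace_lt (LinearMap.snd ℝ ℝ ℝ).isLinear q₀.2)).isPreconnected

theorem isPreconnected_square_snd_gt (q₀ : ℝ × ℝ) (ρ : ℝ) :
    IsPreconnected (square q₀ ρ ∩ {q | q₀.2 < q.2}) :=
  ((convex_square q₀ ρ).inter
    (convex_halfSpace_gt (LinearMap.snd ℝ ℝ ℝ).isLinear q₀.2)).isPreconnected

/-- The punctured square is the union of its four open halves (left, bottom, right, top), each of
which meets the next near a corner. -/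
theorem isPreconnected_square_ne (q₀ : ℝ × ℝ) {ρ : ℝ} (hρ : 0 < ρ) :
    IsPreconnected (square q₀ ρ ∩ {q | q ≠ q₀}) := by
  have hmem : ∀ a b : ℝ, a = 1 ∨ a = -1 → b = 1 ∨ b = -1 →
      (q₀.1 + a * (ρ / 2), q₀.2 + b * (ρ / 2)) ∈ square q₀ ρ := by
    rintro a b (rfl | rfl) (rfl | rfl) <;> constructor <;> constructor <;> simp <;> linarith
  have h1 := (isPreconnected_square_fst_lt q₀ ρ).union
    (q₀.1 + (-1) * (ρ / 2), q₀.2 + (-1) * (ρ / 2))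
    (mem_inter (hmem _ _ (.inr rfl) (.inr rfl)) (by simp [hρ]))
    (mem_inter (hmem _ _ (.inr rfl) (.inr rfl)) (by simp [hρ]))
    (isPreconnected_square_snd_lt q₀ ρ)
  have h2 := h1.union (q₀.1 + 1 * (ρ / 2), q₀.2 + (-1) * (ρ / 2))
    (.inr (mem_inter (hmem _ _ (.inl rfl) (.inr rfl)) (by simp [hρ])))
    (mem_inter (hmem _ _ (.inl rfl) (.inr rfl)) (by simp [hρ]))
    (isPreconnected_square_fst_gt q₀ ρ)
  have h3 := h2.union (q₀.1 + 1 * (ρ / 2), q₀.2 + 1 * (ρ / 2))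
    (.inr (mem_inter (hmem _ _ (.inl rfl) (.inl rfl)) (by simp [hρ])))
    (mem_inter (hmem _ _ (.inl rfl) (.inl rfl)) (by simp [hρ]))
    (isPreconnected_square_snd_gt q₀ ρ)
  convert h3 using 1
  ext q
  simp only [mem_inter_iff, mem_ofPred_eq, mem_union, ← and_or_left, ne_eq, Prod.ext_iff]
  refine and_congr_right fun _ => ⟨fun h => ?_, fun h h' => ?_⟩
  · rcases lt_trichotomy q.1 q₀.1 with h1 | h1 | h1 <;>
    rcases lt_trichotomy q.2 q₀.2 with h2 | h2 | h2 <;> simp_all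
  · rw [h'.1, h'.2] at h
    simp at h

namespace RegularDiagram

variable {M : Type u} [TopologicalSpace M] [ChartedSpace (EuclideanSpace ℝ (Fin 2)) M]
  {D : RegularDiagram M}

namespace IsBox

variable {h : ℝ × ℝ → M} {e : OpenPartialHomeomorph (ℝ × ℝ) M} {σ : E3 → ℝ × ℝ} {q₀ : ℝ × ℝ}
  (hb : D.IsBox h e σ q₀)

include hb

/-- Transports a connected region of a small square to the surface. The resulting set is connected,
lies in a prescribed neighbourhood, and contains every point close to the centre whose coordinates
are in `Q`. -/
theorem exists_isPreconnected {Q : Set (ℝ × ℝ)}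
    (hQ : ∀ ρ > 0, IsPreconnected (square q₀ ρ ∩ Q)) {W : Set M} (hW : W ∈ 𝓝 (h q₀)) :
    ∃ C ⊆ W, IsPreconnected C ∧ (∀ p ∈ C, e.symm p ∈ Q ∧ h (e.symm p) = p) ∧
      ∀ᶠ p in 𝓝 (h q₀), e.symm p ∈ Q → p ∈ C := by
  have h1 : ∀ᶠ q in 𝓝 q₀, q ∈ e.source ∧ h q ∈ W :=
    (e.open_source.eventually_mem hb.mem_source).and (hb.tendsto.eventually hW)
  obtain ⟨ρ, hρ, h2⟩ := Metric.eventually_nhds_iff.1 h1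
  have h3 : ∀ q ∈ square q₀ ρ, q ∈ e.source ∧ h q ∈ W := fun q hq => by
    refine h2 (max_lt ?_ ?_) <;> rw [Real.dist_eq, abs_lt] <;>
      constructor <;> linarith [hq.1.1, hq.1.2, hq.2.1, hq.2.2]
  refine ⟨h '' (square q₀ ρ ∩ Q), ?_, ?_, ?_, ?_⟩
  · rintro _ ⟨q, hq, rfl⟩
    exact (h3 q hq.1).2
  · refine (hQ ρ hρ).image h fun q hq => ?_
    rw [← hb.coe_eq]
    exact (e.continuousAt (h3 q hq.1).1).continuousWithinAt
  · rintro _ ⟨q, hq, rfl⟩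
    rw [← hb.coe_eq, e.left_inv (h3 q hq.1).1]
    exact ⟨hq.2, rfl⟩
  · filter_upwards [hb.tendsto_symm.eventually (square_mem_nhds q₀ hρ), hb.eventually_right_inv]
      with p hp hp' hpQ
    exact ⟨e.symm p, ⟨hp, hpQ⟩, hp'⟩

/-- Since `ν` is orthogonal to the coordinate line, only the rate `b` of the second coordinate
contributes to the product of the velocity of the arc with `ν`. -/
theorem hasDerivAt_snd_of_adjacent {A : Set M} {ν : E3}
    (hs : ⟪fderiv ℝ (fun q => D.proj (h q)) q₀ (1, 0), ν⟫ = 0)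
    (hA : D.AdjacentOnSide A (h q₀) ν) : ∃ (γ : ℝ → M) (b : ℝ),
      Tendsto γ (𝓝[>] 0) (𝓝 (h q₀)) ∧ (∀ᶠ t in 𝓝[>] (0 : ℝ), γ t ∈ A) ∧ (e.symm (γ 0)).2 = q₀.2 ∧
      HasDerivAt (fun t => (e.symm (γ t)).2) b 0 ∧
      0 < b * ⟪fderiv ℝ (fun q => D.proj (h q)) q₀ (0, 1), ν⟫ := by
  obtain ⟨γ, w, h0, hc, hw, hν, hev⟩ := hA
  obtain ⟨a, b, -, hb', rfl⟩ := hb.exists_hasDerivAt h0 hc hw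
  refine ⟨γ, b, ?_, hev, by rw [h0, hb.symm_apply], hb', ?_⟩
  · have := hc.tendsto
    rw [h0] at this
    exact this.mono_left nhdsWithin_le_nhds
  · rwa [inner_add_left, inner_smul_left, inner_smul_left, hs, mul_zero, zero_add] at hν

/-- The second coordinate increases against `ν`, so an arc to the side of `ν` decreases it to first
order and hence enters the lower half of the box. -/
theorem frequently_lt_of_adjacent {A : Set M} {ν : E3}
    (hs : ⟪fderiv ℝ (fun q => D.proj (h q)) q₀ (1, 0), ν⟫ = 0)
    (ht : ⟪fderiv ℝ (fun q => D.proj (h q)) q₀ (0, 1), ν⟫ < 0)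
    (hA : D.AdjacentOnSide A (h q₀) ν) :
    ∃ᶠ p in 𝓝 (h q₀), p ∈ A ∧ (e.symm p).2 < q₀.2 := by
  obtain ⟨γ, b, hγ, hev, h0, hd, hpos⟩ := hb.hasDerivAt_snd_of_adjacent hs hA
  have hneg : b < 0 := by
    by_contra hb0
    exact absurd hpos (not_lt.2 (mul_nonpos_of_nonneg_of_nonpos (not_lt.1 hb0) ht.le))
  have h2 : ∀ᶠ t in 𝓝[>] (0 : ℝ), (e.symm (γ t)).2 < q₀.2 := by
    have := (eventually_nhdsWithin_sign_eq_of_deriv_neg (f := fun t => (e.symm (γ t)).2 - q₀.2)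
      (x₀ := 0) (by rw [(hd.sub_const _).deriv]; exact hneg) (by rw [h0, sub_self]))
    filter_upwards [this.filter_mono (nhdsWithin_le_nhds), self_mem_nhdsWithin] with t h1 h2
    have h3 : SignType.sign (0 - t) = -1 := sign_neg (by linarith [mem_Ioi.1 h2])
    rw [h3, sign_eq_neg_one_iff] at h1
    linarith
  exact hγ.frequently (hev.and h2).frequently

theorem frequently_gt_of_adjacent {A : Set M} {ν : E3}
    (hs : ⟪fderiv ℝ (fun q => D.proj (h q)) q₀ (1, 0), ν⟫ = 0)
    (ht : ⟪fderiv ℝ (fun q => D.proj (h q)) q₀ (0, 1), ν⟫ < 0)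
    (hA : D.AdjacentOnSide A (h q₀) (-ν)) :
    ∃ᶠ p in 𝓝 (h q₀), p ∈ A ∧ q₀.2 < (e.symm p).2 := by
  obtain ⟨γ, b, hγ, hev, h0, hd, hpos⟩ := hb.hasDerivAt_snd_of_adjacent (ν := -ν)
    (by rw [inner_neg_right, hs, neg_zero]) hA
  rw [inner_neg_right] at hpos
  have hneg : 0 < b := by
    by_contra hb0
    nlinarith
  have h2 : ∀ᶠ t in 𝓝[>] (0 : ℝ), q₀.2 < (e.symm (γ t)).2 := by
    have := (eventually_nhdsWithin_sign_eq_of_deriv_pos (f := fun t => (e.symm (γ t)).2 - q₀.2)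
      (x₀ := 0) (by rw [(hd.sub_const _).deriv]; exact hneg) (by rw [h0, sub_self]))
    filter_upwards [this.filter_mono (nhdsWithin_le_nhds), self_mem_nhdsWithin] with t h1 h2
    have h3 : SignType.sign (t - 0) = 1 := sign_pos (by linarith [mem_Ioi.1 h2])
    rw [h3, sign_eq_one_iff] at h1
    linarith
  exact hγ.frequently (hev.and h2).frequently

end IsBox

/-- The transverse arcs of a surface piece lead to its two sides. -/
theorem adjacentOnSide_of_eventually {h : ℝ × ℝ → M} {t s : ℝ}
    (hh : ContMDiffAt 𝓘(ℝ, ℝ × ℝ) (𝓡 2) ∞ h (t, s)) {A : Set M} {ν : E3} {κ : ℝ}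
    (hν : 0 < κ * ⟪fderiv ℝ (fun q => D.proj (h q)) (t, s) (0, 1), ν⟫)
    (hA : ∀ᶠ τ in 𝓝[>] (0 : ℝ), h (t, s + κ * τ) ∈ A) : D.AdjacentOnSide A (h (t, s)) ν := by
  have h1 : HasDerivAt (fun τ : ℝ => s + κ * τ) κ 0 := by
    simpa using ((hasDerivAt_id (0 : ℝ)).const_mul κ).const_add s
  have h0 : (fun τ : ℝ => s + κ * τ) 0 = s := by simp
  have h2 := hasDerivAt_snd_of_contMDiffAt (D := D) hh
  rw [← h0] at h2
  refine ⟨fun τ => h (t, s + κ * τ), _, by simp, ?_,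
    HasDerivAt.scomp (g₁ := fun r => D.proj (h (t, r))) (0 : ℝ) h2 h1, ?_, hA⟩
  · refine ContinuousAt.comp (f := fun τ : ℝ => (t, s + κ * τ)) (x := 0) ?_ ?_
    · simpa using hh.continuousAt
    · exact (continuous_const.prodMk (continuous_const.add
        (continuous_const.mul continuous_id))).continuousAt
  · simpa [inner_smul_left] using hν

theorem AdjacentOnSide.mono {A B : Set M} {x : M} {ν : E3} (h : D.AdjacentOnSide A x ν)
    (hAB : A ⊆ B) : D.AdjacentOnSide B x ν := by
  obtain ⟨γ, w, h0, hc, hw, hν, hev⟩ := h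
  exact ⟨γ, w, h0, hc, hw, hν, hev.mono fun t ht => hAB ht⟩

end RegularDiagram

/-! ### Counting how often the strips cover a point -/

/-- The number of points in the fibre of a locally injective map on a compact space, near a given
fibre: each point `a` of the given fibre contributes `1` over the points with `P a`. -/
theorem ncard_fiber_eventually {Z Y : Type*} [TopologicalSpace Z] [CompactSpace Z] [T2Space Z]
    [TopologicalSpace Y] [T2Space Y] {H : Z → Y} (hH : Continuous H) {y₀ : Y} {P : Z → Y → Prop}
    (hP : ∀ a, H a = y₀ → ∀ N ∈ 𝓝 a, ∀ᶠ y in 𝓝 y₀, P a y → ∃ b ∈ N, H b = y)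
    (hP' : ∀ a, H a = y₀ → ∃ N ∈ 𝓝 a, InjOn H N ∧ ∀ b ∈ N, P a (H b)) :
    (H ⁻¹' {y₀}).Finite ∧
      ∀ᶠ y in 𝓝 y₀, (H ⁻¹' {y}).ncard = {a | H a = y₀ ∧ P a y}.ncard := by
  have hex : ∀ a, ∃ N, H a = y₀ → N ∈ 𝓝 a ∧ InjOn H N ∧ ∀ b ∈ N, P a (H b) := fun a => by
    by_cases ha : H a = y₀
    · obtain ⟨N, hN⟩ := hP' a ha
      exact ⟨N, fun _ => hN⟩
    · exact ⟨∅, fun h => absurd h ha⟩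
  choose N hN using hex
  have hfin : (H ⁻¹' {y₀}).Finite := by
    have hc : IsCompact (H ⁻¹' {y₀}) := (isClosed_singleton.preimage hH).isCompact
    obtain ⟨t, hsub⟩ := hc.elim_nhds_subcover' (fun a _ => N a) (fun a ha => (hN a ha).1)
    refine (t.finite_toSet.image Subtype.val).subset fun b hb => ?_
    obtain ⟨a, ha, hba⟩ := mem_iUnion₂.1 (hsub hb)
    have h1 := hN a a.2
    refine ⟨a, ha, h1.2.1 (mem_of_mem_nhds h1.1) hba ?_⟩
    rw [show H a = y₀ from a.2, show H b = y₀ from hb]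
  obtain ⟨U, hU, hdis⟩ := hfin.t2_separation
  refine ⟨hfin, ?_⟩
  -- A continuous map from a compact space to a Hausdorff space is closed, so nearby fibres stay
  -- inside any neighbourhood of the given fibre.
  have h1 : ∀ᶠ y in 𝓝 y₀, ∀ b ∈ H ⁻¹' {y}, ∃ a, H a = y₀ ∧ b ∈ N a ∩ U a :=
    hH.isClosedMap.eventually_nhds_fiber y₀ fun a ha => by
      filter_upwards [(hN a ha).1, (hU a).2.mem_nhds (hU a).1] with b hb hb'
      exact ⟨a, ha, hb, hb'⟩
  have h2 : ∀ᶠ y in 𝓝 y₀, ∀ a ∈ H ⁻¹' {y₀}, P a y → ∃ b ∈ N a ∩ U a, H b = y :=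
    (eventually_all_finite hfin).2 fun a ha =>
      hP a ha _ (inter_mem (hN a ha).1 ((hU a).2.mem_nhds (hU a).1))
  filter_upwards [h1, h2] with y hy hy'
  -- The bijection sends a point of the nearby fibre to the point of the given fibre in whose
  -- separated neighbourhood it lies.
  choose! f hf using hy
  refine ncard_congr (fun b _ => f b) (fun b hb => ⟨(hf b hb).1, ?_⟩) ?_ ?_
  · have := (hN _ (hf b hb).1).2.2 b (hf b hb).2.1
    rwa [show H b = y from hb] at this
  · intro b b' hb hb' heq
    have h3 := (hf b' hb').2.1
    rw [← heq] at h3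
    refine (hN _ (hf b hb).1).2.1 (hf b hb).2.1 h3 ?_
    rw [show H b = y from hb, show H b' = y from hb']
  · rintro a ⟨ha, haP⟩
    obtain ⟨b, hb, hby⟩ := hy' a ha haP
    refine ⟨b, hby, ?_⟩
    by_contra hne
    exact (hdis (hf b hby).1 ha hne).le_bot ⟨(hf b hby).2.2, hb.2⟩

namespace RegularDiagram

variable {M : Type u} [TopologicalSpace M] [ChartedSpace (EuclideanSpace ℝ (Fin 2)) M]
  {D : RegularDiagram M}

/-- The parameters of `n` annuli of width `δ`. -/
abbrev Annuli (n : ℕ) (δ : ℝ) : Type := Fin n × UnitAddCircle × Icc (0 : ℝ) δ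

theorem sameParam_iff {n : ℕ} {i j : Fin n} {s t : ℝ} :
    SameParam i s j t ↔ i = j ∧ (s : UnitAddCircle) = t := by
  refine and_congr_right fun _ => ?_
  rw [eq_comm (a := (s : UnitAddCircle)), ← sub_eq_zero, ← AddCircle.coe_sub,
    AddCircle.coe_eq_zero_iff]
  refine exists_congr fun m => ?_
  rw [zsmul_one, eq_sub_iff_add_eq', eq_comm]

/-- The surface point with given annulus parameters. -/
noncomputable def stripPoint {n : ℕ} {δ : ℝ} (h : Fin n → ℝ × ℝ → M) (b : Annuli n δ) : M :=
  h b.1 (Function.surjInv QuotientAddGroup.mk_surjective b.2.1, b.2.2)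

/-- The quotient map from `ℝ` to the circle is open, so properties near a parameter may be tested on
real lifts. -/
theorem eventually_annuli {n : ℕ} {δ : ℝ} {i : Fin n} {t : ℝ} {s : Icc (0 : ℝ) δ}
    {Q : Annuli n δ → Prop} (hQ : ∀ᶠ z : ℝ × Icc (0 : ℝ) δ in 𝓝 (t, s), Q (i, ↑z.1, z.2)) :
    ∀ᶠ b in 𝓝 ((i, ↑t, s) : Annuli n δ), Q b := by
  rw [nhds_prod_eq, eventually_prod_iff] at hQ
  obtain ⟨pa, ha, pb, hb, hab⟩ := hQ
  have h1 : (𝓝 t).map ((↑) : ℝ → UnitAddCircle) = 𝓝 (t : UnitAddCircle) :=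
    QuotientAddGroup.isOpenMap_coe.map_nhds_eq continuous_quotient_mk'.continuousAt
  have h2 : ∀ᶠ T in 𝓝 (t : UnitAddCircle), ∃ t' : ℝ, (t' : UnitAddCircle) = T ∧ pa t' := by
    rw [← h1, eventually_map]
    filter_upwards [ha] with t' ht'
    exact ⟨t', rfl, ht'⟩
  rw [nhds_prod_eq, nhds_prod_eq, nhds_discrete]
  have h3 : ∀ᶠ j in (pure i : Filter (Fin n)), j = i := rfl
  filter_upwards [h3.prod_mk (h2.prod_mk hb)] with b hb
  obtain ⟨hi, ⟨t', ht', hpa⟩, hpb⟩ := hb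
  obtain ⟨j, T, s'⟩ := b
  simp only at hi
  subst hi
  have := hab hpa hpb
  simp only [ht'] at this
  exact this

theorem tendsto_annuli {n : ℕ} {δ : ℝ} (i : Fin n) (t : ℝ) (s : Icc (0 : ℝ) δ) :
    Tendsto (fun z : ℝ × Icc (0 : ℝ) δ => ((i, ↑z.1, z.2) : Annuli n δ)) (𝓝 (t, s))
      (𝓝 (i, ↑t, s)) :=
  (continuous_const.prodMk ((AddCircle.continuous_mk' 1 |>.comp continuous_fst).prodMk
    continuous_snd)).tendsto (t, s)

namespace IsStrip

variable {L : D.ImmersedCurves} {low up : Fin L.n → ℝ → M} {h : Fin L.n → ℝ × ℝ → M} {δ η : ℝ}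
  (hs : IsStrip L low up h δ η)

include hs

theorem abs_lt {s : ℝ} (h0 : s ∈ Icc 0 δ) : |s| < η := by
  rw [abs_of_nonneg h0.1]
  exact h0.2.trans_lt hs.lt

theorem eventually_contMDiffAt (i : Fin L.n) (t : ℝ) {s : ℝ} (h0 : |s| < η) :
    ∀ᶠ q in 𝓝 (t, s), ContMDiffAt 𝓘(ℝ, ℝ × ℝ) (𝓡 2) ∞ (h i) q := by
  have h1 : Tendsto (fun q : ℝ × ℝ => |q.2|) (𝓝 (t, s)) (𝓝 |s|) :=
    (continuous_snd.tendsto (t, s)).abs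
  filter_upwards [h1.eventually_lt_const h0] with q hq
  exact hs.contMDiffAt i q.1 q.2 hq

theorem stripPoint_coe (i : Fin L.n) (t : ℝ) (s : Icc (0 : ℝ) δ) :
    stripPoint h (i, ↑t, s) = h i (t, s) := by
  have h1 : ((Function.surjInv QuotientAddGroup.mk_surjective (t : UnitAddCircle) : ℝ) :
      UnitAddCircle) = t := Function.surjInv_eq _ _
  obtain ⟨-, m, hm⟩ := sameParam_iff (i := i) (j := i).2 ⟨rfl, h1⟩
  have h2 := (hs.periodic i s).int_mul m
    (Function.surjInv QuotientAddGroup.mk_surjective (t : UnitAddCircle))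
  rw [mul_one, ← hm] at h2
  exact h2.symm

theorem continuous_stripPoint : Continuous (stripPoint h : Annuli L.n δ → M) := by
  refine continuous_iff_continuousAt.2 ?_
  rintro ⟨i, T, s⟩
  obtain ⟨t, rfl⟩ := QuotientAddGroup.mk_surjective T
  intro W hW
  rw [hs.stripPoint_coe] at hW
  refine eventually_annuli (Q := fun b => stripPoint h b ∈ W) ?_
  simp only [hs.stripPoint_coe]
  have h1 : Tendsto (fun z : ℝ × Icc (0 : ℝ) δ => (z.1, (z.2 : ℝ))) (𝓝 (t, s)) (𝓝 (t, (s : ℝ))) :=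
    (continuous_fst.prodMk (continuous_subtype_val.comp continuous_snd)).tendsto (t, s)
  exact ((hs.contMDiffAt i t s (hs.abs_lt s.2)).continuousAt.tendsto.comp h1).eventually hW

theorem exists_isBox [IsManifold (𝓡 2) ∞ M] (i : Fin L.n) (t : ℝ) {s : ℝ} (h0 : |s| < η) :
    ∃ e σ, D.IsBox (h i) e σ (t, s) :=
  RegularDiagram.exists_isBox (hs.eventually_contMDiffAt i t h0) (hs.immersed i t s h0).ne

variable [T2Space M]

/-- A property that holds near the parameters of a point holds for the parameters of all nearby
points. -/
theorem eventually_fiber {p₀ : M} {Q : Annuli L.n δ → Prop}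
    (hQ : ∀ i t (s : Icc (0 : ℝ) δ), h i (t, (s : ℝ)) = p₀ →
      ∀ᶠ z : ℝ × Icc (0 : ℝ) δ in 𝓝 (t, s), Q (i, ↑z.1, z.2)) :
    ∀ᶠ p in 𝓝 p₀, ∀ i t, ∀ s : Icc (0 : ℝ) δ, h i (t, s) = p → Q (i, ↑t, s) := by
  have := hs.continuous_stripPoint.isClosedMap.eventually_nhds_fiber (p := Q) p₀ (by
    rintro ⟨i, T, s⟩ hb
    obtain ⟨t, rfl⟩ := QuotientAddGroup.mk_surjective T
    exact eventually_annuli (hQ i t s ((hs.stripPoint_coe i t s).symm.trans hb)))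
  filter_upwards [this] with p hp i t s hp'
  exact hp _ ((hs.stripPoint_coe i t s).trans hp')

theorem ncard_fiber {p₀ : M} {e : Annuli L.n δ → OpenPartialHomeomorph (ℝ × ℝ) M}
    (he : ∀ b, ∃ (t : ℝ) (σ : _), ↑t = b.2.1 ∧ D.IsBox (h b.1) (e b) σ (t, b.2.2)) :
    (stripPoint h ⁻¹' {p₀} : Set (Annuli L.n δ)).Finite ∧
      ∀ᶠ p in 𝓝 p₀, (stripPoint h ⁻¹' {p} : Set (Annuli L.n δ)).ncard =
        {b : Annuli L.n δ | stripPoint h b = p₀ ∧ ((e b).symm p).2 ∈ Icc 0 δ}.ncard := by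
  have h1 : ∀ (t : ℝ) (s : Icc (0 : ℝ) δ), Tendsto (fun z : ℝ × Icc (0 : ℝ) δ => (z.1, (z.2 : ℝ)))
      (𝓝 (t, s)) (𝓝 (t, (s : ℝ))) := fun t s =>
    (continuous_fst.prodMk (continuous_subtype_val.comp continuous_snd)).tendsto (t, s)
  -- A point `p` near the image of `b` has a strip parameter near `b` exactly when its time
  -- coordinate in the box at `b` lies in `[0, δ]`.
  refine ncard_fiber_eventually (P := fun b p => ((e b).symm p).2 ∈ Icc 0 δ)
    hs.continuous_stripPoint ?_ ?_
  · rintro ⟨i, T, s⟩ rfl N hN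
    obtain ⟨t, σ, ht, hb⟩ := he (i, T, s)
    simp only at ht hb
    obtain rfl := ht
    rw [hs.stripPoint_coe]
    have h2 := (tendsto_annuli i t s).eventually hN
    rw [nhds_prod_eq, nhds_subtype, eventually_prod_iff] at h2
    obtain ⟨pa, ha, pb, hpb, hab⟩ := h2
    rw [eventually_comap] at hpb
    have h3 := hb.tendsto_symm
    rw [nhds_prod_eq] at h3
    filter_upwards [h3.eventually (ha.prod_mk hpb), hb.eventually_right_inv] with p hp hp' hI
    exact ⟨(i, ↑((e (i, ↑t, s)).symm p).1, ⟨_, hI⟩), hab hp.1 (hp.2 ⟨_, hI⟩ rfl),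
      (hs.stripPoint_coe _ _ _).trans hp'⟩
  · rintro ⟨i, T, s⟩ rfl
    obtain ⟨t, σ, ht, hb⟩ := he (i, T, s)
    simp only at ht hb
    obtain rfl := ht
    refine ⟨{b | ∃ t' : ℝ, ↑t' = b.2.1 ∧ b.1 = i ∧
      (e (i, ↑t, s)).symm (h i (t', b.2.2)) = (t', (b.2.2 : ℝ))}, ?_, ?_, ?_⟩
    · refine eventually_annuli ?_
      filter_upwards [(h1 t s).eventually hb.eventually_left_inv] with z hz
      exact ⟨z.1, rfl, rfl, hz⟩
    · rintro ⟨j, T, s⟩ ⟨t, ht, hj, heq⟩ ⟨j', T', s'⟩ ⟨t', ht', hj', heq'⟩ hH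
      simp only at ht ht' hj hj' heq heq'
      subst ht ht' hj hj'
      rw [hs.stripPoint_coe, hs.stripPoint_coe] at hH
      rw [hH, heq'] at heq
      rw [Prod.mk.injEq] at heq
      rw [heq.1, Subtype.ext heq.2]
    · rintro ⟨j, T, s⟩ ⟨t, ht, hj, heq⟩
      simp only at ht hj heq
      subst ht hj
      rw [hs.stripPoint_coe, heq]
      exact s.2

end IsStrip

end RegularDiagram

namespace RegularDiagram

variable {M : Type u} [TopologicalSpace M] [ChartedSpace (EuclideanSpace ℝ (Fin 2)) M]
  {D : RegularDiagram M}

theorem IsBox.frequently_gt {h : ℝ × ℝ → M} {e : OpenPartialHomeomorph (ℝ × ℝ) M}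
    {σ : E3 → ℝ × ℝ} {q₀ : ℝ × ℝ} (hb : D.IsBox h e σ q₀) :
    ∃ᶠ p in 𝓝 (h q₀), q₀.2 < (e.symm p).2 := by
  rw [← hb.map_nhds, frequently_map]
  have h1 : Tendsto (fun s : ℝ => (q₀.1, s)) (𝓝[>] q₀.2) (𝓝 q₀) :=
    ((continuous_const.prodMk continuous_id).tendsto q₀.2).mono_left nhdsWithin_le_nhds
  have h2 : ∃ᶠ s in 𝓝[>] q₀.2, q₀.2 < ((q₀.1, s) : ℝ × ℝ).2 :=
    Eventually.frequently self_mem_nhdsWithin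
  refine ((h1.frequently (p := fun q => q₀.2 < q.2) h2).and_eventually
    hb.eventually_left_inv).mono ?_
  rintro q ⟨hq, hq'⟩
  rwa [hq']

theorem isClosed_lowerSet [IsManifold (𝓡 2) ∞ M] [T2Space M] [CompactSpace M] :
    IsClosed D.lowerSet := by
  have : D.lowerSet = Prod.fst '' D.doublePairs := by
    ext x
    constructor
    · rintro ⟨y, hy⟩
      exact ⟨(x, y), hy, rfl⟩
    · rintro ⟨⟨x, y⟩, hy, rfl⟩
      exact ⟨y, hy⟩
  rw [this]
  exact (D.isClosed_doublePairs.isCompact.image continuous_fst).isClosed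

namespace IsStrip

variable {L : D.ImmersedCurves} {low up : Fin L.n → ℝ → M} {h : Fin L.n → ℝ × ℝ → M} {δ η : ℝ}
  (hs : IsStrip L low up h δ η)

/-- The number of times that the strips between the lower curves and `L` cover a point. -/
noncomputable def count (_hs : IsStrip L low up h δ η) (p : M) : ℕ :=
  (stripPoint h ⁻¹' {p} : Set (Annuli L.n δ)).ncard

include hs

theorem zero_mem : (0 : ℝ) ∈ Icc 0 δ := ⟨le_rfl, hs.pos.le⟩

theorem width_mem : δ ∈ Icc 0 δ := ⟨hs.pos.le, le_rfl⟩

theorem mem_lowerSet (i : Fin L.n) (t : ℝ) : h i (t, 0) ∈ D.lowerSet := by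
  rw [hs.zero]
  exact ⟨up i t, hs.parametrizes.isUnderOver i t⟩

theorem mem_support (i : Fin L.n) (t : ℝ) : h i (t, δ) ∈ L.support := by
  rw [hs.curve]
  exact ⟨i, t, rfl⟩

theorem exists_of_mem {p : M} (hp : p ∈ D.lowerSet ∪ L.support) :
    ∃ i t s, (s = 0 ∨ s = δ) ∧ h i (t, s) = p := by
  rcases hp with ⟨y, hy⟩ | ⟨i, t, rfl⟩
  · obtain ⟨i, t, rfl, -⟩ := hs.parametrizes.surjective p y hy
    exact ⟨i, t, 0, .inl rfl, hs.zero i t⟩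
  · exact ⟨i, t, δ, .inr rfl, hs.curve i t⟩

theorem edge_mem {s : ℝ} (h0 : s = 0 ∨ s = δ) : s ∈ Icc 0 δ := by
  rcases h0 with rfl | rfl
  exacts [hs.zero_mem, hs.width_mem]

theorem velocity_eq (i : Fin L.n) (t : ℝ) :
    L.velocity i t = fderiv ℝ (fun q => D.proj (h i q)) (t, δ) (1, 0) := by
  have h1 := hasDerivAt_fst_of_contMDiffAt (D := D) (hs.contMDiffAt i t δ (hs.abs_lt hs.width_mem))
  simp only [hs.curve] at h1
  exact h1.deriv

theorem deriv_low (i : Fin L.n) (t : ℝ) :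
    deriv (fun r => D.proj (low i r)) t = fderiv ℝ (fun q => D.proj (h i q)) (t, 0) (1, 0) := by
  have h1 := hasDerivAt_fst_of_contMDiffAt (D := D) (hs.contMDiffAt i t 0 (hs.abs_lt hs.zero_mem))
  simp only [hs.zero] at h1
  exact h1.deriv

variable [T2Space M]

theorem isClosed_support : IsClosed L.support := by
  rw [← isOpen_compl_iff, isOpen_iff_eventually]
  intro p₀ hp₀
  have := hs.eventually_fiber (p₀ := p₀) (Q := fun b => (b.2.2 : ℝ) ≠ δ) fun i t s hp => by
    have h1 : (s : ℝ) ≠ δ := fun h1 => hp₀ (by rw [← hp, h1]; exact hs.mem_support i t)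
    exact (continuous_subtype_val.comp continuous_snd).continuousAt.eventually_ne h1
  filter_upwards [this] with p hp
  rintro ⟨i, t, rfl⟩
  exact hp i t ⟨δ, hs.width_mem⟩ (hs.curve i t) rfl

variable [IsManifold (𝓡 2) ∞ M]

/-- Off the boundary curves all strip parameters of `p₀` have times strictly between `0` and `δ`, so
each of them persists at nearby points. -/
theorem count_eventually_eq {p₀ : M} (hp₀ : p₀ ∉ D.lowerSet ∪ L.support) :
    ∀ᶠ p in 𝓝 p₀, hs.count p = hs.count p₀ := by
  have hex : ∀ b : Annuli L.n δ, ∃ (e : OpenPartialHomeomorph (ℝ × ℝ) M) (t : ℝ) (σ : _),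
      ↑t = b.2.1 ∧ D.IsBox (h b.1) e σ (t, b.2.2) := by
    rintro ⟨i, T, s⟩
    obtain ⟨t, rfl⟩ := QuotientAddGroup.mk_surjective T
    obtain ⟨e, σ, hb⟩ := hs.exists_isBox i t (hs.abs_lt s.2)
    exact ⟨e, t, σ, rfl, hb⟩
  choose e he using hex
  obtain ⟨hfin, hev⟩ := hs.ncard_fiber (p₀ := p₀) he
  have h1 : ∀ᶠ p in 𝓝 p₀, ∀ b ∈ (stripPoint h ⁻¹' {p₀} : Set (Annuli L.n δ)),
      ((e b).symm p).2 ∈ Icc 0 δ := by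
    refine (eventually_all_finite hfin).2 ?_
    rintro ⟨i, T, s⟩ rfl
    obtain ⟨t, σ, ht, hb⟩ := he (i, T, s)
    simp only at ht hb
    obtain rfl := ht
    rw [hs.stripPoint_coe] at hp₀ ⊢
    have h0 : (s : ℝ) ≠ 0 := fun h0 => hp₀ (.inl (by rw [h0]; exact hs.mem_lowerSet i t))
    have h1 : (s : ℝ) ≠ δ := fun h1 => hp₀ (.inr (by rw [h1]; exact hs.mem_support i t))
    exact ((continuous_snd.tendsto _).comp hb.tendsto_symm).eventually
      (Icc_mem_nhds (lt_of_le_of_ne s.2.1 h0.symm) (lt_of_le_of_ne s.2.2 h1))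
  filter_upwards [hev, h1] with p hp hp'
  rw [count, count, hp]
  congr 1
  ext b
  exact ⟨fun hb => hb.1, fun hb => ⟨hb, hp' b hb⟩⟩

/-- The boundary curves of the strips with times in `E` run through `h i (t, s₀)` only with the
parameter `(t, s₀)`. -/
def IsSimpleAt (_hs : IsStrip L low up h δ η) (E : Set ℝ) (i : Fin L.n) (t s₀ : ℝ) : Prop :=
  ∀ j t' s', s' ∈ E → h j (t', s') = h i (t, s₀) → SameParam j t' i t ∧ s' = s₀

omit [IsManifold (𝓡 2) ∞ M] [T2Space M] in
theorem isSimpleAt_curve {i : Fin L.n} {t : ℝ} (hl : L.curve i t ∉ D.lowerSet)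
    (hsim : ∀ j s, L.curve j s = L.curve i t → SameParam j s i t) :
    hs.IsSimpleAt {0, δ} i t δ := by
  rintro j t' s' (rfl | rfl) heq
  · rw [hs.curve] at heq
    exact absurd (heq ▸ hs.mem_lowerSet j t') hl
  · rw [hs.curve, hs.curve] at heq
    exact ⟨hsim j t' heq, rfl⟩

omit [IsManifold (𝓡 2) ∞ M] [T2Space M] in
theorem isSimpleAt_low {i : Fin L.n} {t : ℝ} (hd : D.IsDoublePoint (low i t) (up i t)) :
    hs.IsSimpleAt {0} i t 0 := by
  rintro j t' s' rfl heq
  rw [hs.zero, hs.zero] at heq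
  refine ⟨hs.parametrizes.injective _ _ _ _ heq ?_, rfl⟩
  have h1 := hs.parametrizes.isUnderOver j t'
  rw [heq] at h1
  exact (hd.2 _ h1.1.symm).resolve_left h1.ne.symm

omit [IsManifold (𝓡 2) ∞ M] [T2Space M] in
theorem isSimpleAt_low_of_not_mem {i : Fin L.n} {t : ℝ}
    (hd : D.IsDoublePoint (low i t) (up i t)) (hx : low i t ∉ L.support) :
    hs.IsSimpleAt {0, δ} i t 0 := by
  rintro j t' s' (rfl | rfl) heq
  · exact hs.isSimpleAt_low hd j t' _ rfl heq
  · rw [hs.zero] at heq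
    exact absurd (heq ▸ hs.mem_support j t') hx

variable {i : Fin L.n} {t s₀ : ℝ} {e : OpenPartialHomeomorph (ℝ × ℝ) M} {σ : E3 → ℝ × ℝ}

omit [IsManifold (𝓡 2) ∞ M] in
/-- Near a simple boundary point, the boundary curves lie on the coordinate line. -/
theorem eventually_snd_eq {E : Set ℝ} (hE : E ⊆ {0, δ}) (hb : D.IsBox (h i) e σ (t, s₀))
    (hsim : hs.IsSimpleAt E i t s₀) :
    ∀ᶠ p in 𝓝 (h i (t, s₀)), ∀ j t' s', s' ∈ E → h j (t', s') = p → (e.symm p).2 = s₀ := by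
  have hEc : IsClosed E := ((finite_singleton δ).insert 0 |>.subset hE).isClosed
  have := hs.eventually_fiber (p₀ := h i (t, s₀)) (Q := fun b => (b.2.2 : ℝ) ∈ E
      → (e.symm (stripPoint h b)).2 = s₀) fun j t' s hp => by
    by_cases hs0 : (s : ℝ) ∈ E
    · obtain ⟨⟨rfl, m, hm⟩, hs'⟩ := hsim j t' s hs0 hp
      have h1 : Tendsto (fun z : ℝ × Icc (0 : ℝ) δ => (z.1 + (m : ℝ), (z.2 : ℝ))) (𝓝 (t', s))
          (𝓝 (t, s₀)) := by
        rw [hm, ← hs']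
        exact ((continuous_fst.add continuous_const).prodMk
          (continuous_subtype_val.comp continuous_snd)).tendsto (t', s)
      have h3 : ∀ᶠ z : ℝ × Icc (0 : ℝ) δ in 𝓝 (t', s), (z.2 : ℝ) ∈ E → (z.2 : ℝ) = s₀ := by
        have hc : ContinuousAt (fun z : ℝ × Icc (0 : ℝ) δ => (z.2 : ℝ)) (t', s) :=
          (continuous_subtype_val.comp continuous_snd).continuousAt
        rcases hE hs0 with h0 | h0
        · filter_upwards [hc.eventually_ne (y := δ) (by rw [h0]; exact hs.pos.ne)] with z hz hz'
          rw [(hE hz').resolve_right hz, ← hs', h0]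
        · filter_upwards [hc.eventually_ne (y := 0) (by rw [h0]; exact hs.pos.ne')] with z hz hz'
          rw [(hE hz').resolve_left hz, ← hs', h0]
      filter_upwards [h1.eventually hb.eventually_left_inv, h3] with z hz hz' hz0
      have h2 := (hs.periodic j z.2).int_mul m z.1
      simp only [mul_one] at h2
      rw [hs.stripPoint_coe, ← h2, hz]
      exact hz' hz0
    · filter_upwards [((continuous_subtype_val.comp continuous_snd).tendsto (t', s)).eventually
        (hEc.isOpen_compl.eventually_mem hs0)] with z hz hz'
      exact absurd hz' hz
  filter_upwards [this] with p hp j t' s' hs' heq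
  have := hp j t' ⟨s', hs.edge_mem (hE hs')⟩ heq hs'
  rwa [hs.stripPoint_coe, heq] at this

omit [IsManifold (𝓡 2) ∞ M] in
theorem eventually_mem_cutSurface (hb : D.IsBox (h i) e σ (t, s₀))
    (hsim : hs.IsSimpleAt {0, δ} i t s₀) :
    ∀ᶠ p in 𝓝 (h i (t, s₀)), (e.symm p).2 ≠ s₀ → p ∈ D.cutSurface L.support := by
  filter_upwards [hs.eventually_snd_eq subset_rfl hb hsim] with p hp hne hmem
  obtain ⟨j, t', s', h0, heq⟩ := hs.exists_of_mem hmem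
  exact hne (hp j t' s' h0 heq)

/-- Only the parameter `(i, t, s₀)` can be at the edge of a strip. The other `m` parameters are
interior and persist, while this one survives exactly on the strip side of the box. -/
theorem exists_count_eventually_eq (hb : D.IsBox (h i) e σ (t, s₀)) (hs₀ : s₀ ∈ Icc 0 δ)
    (hsim : hs.IsSimpleAt {0, δ} i t s₀) : ∃ m, ∀ᶠ p in 𝓝 (h i (t, s₀)),
      ((e.symm p).2 ∈ Icc 0 δ → hs.count p = m + 1) ∧ ((e.symm p).2 ∉ Icc 0 δ → hs.count p = m) := by
  -- The box at each parameter is arbitrary, except that the given box `e` has to be used at the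
  -- distinguished one.
  have hex : ∀ b : Annuli L.n δ, ∃ (e' : OpenPartialHomeomorph (ℝ × ℝ) M),
      (∃ (t : ℝ) (σ : _), ↑t = b.2.1 ∧ D.IsBox (h b.1) e' σ (t, b.2.2)) ∧
      (b = (i, ↑t, ⟨s₀, hs₀⟩) → e' = e) := by
    intro b
    by_cases hb0 : b = (i, ↑t, ⟨s₀, hs₀⟩)
    · subst hb0
      exact ⟨e, ⟨t, σ, rfl, hb⟩, fun _ => rfl⟩
    obtain ⟨j, T, s⟩ := b
    obtain ⟨t, rfl⟩ := QuotientAddGroup.mk_surjective T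
    obtain ⟨e, σ, hb⟩ := hs.exists_isBox j t (hs.abs_lt s.2)
    exact ⟨e, ⟨t, σ, rfl, hb⟩, fun h => absurd h hb0⟩
  choose e' he' he0 using hex
  obtain ⟨hfin, hev⟩ := hs.ncard_fiber (p₀ := h i (t, s₀)) he'
  set b₀ : Annuli L.n δ := (i, ↑t, ⟨s₀, hs₀⟩) with hb₀
  have hb₀mem : stripPoint h b₀ = h i (t, s₀) := hs.stripPoint_coe _ _ _
  have h1 : ∀ᶠ p in 𝓝 (h i (t, s₀)),
      ∀ b ∈ (stripPoint h ⁻¹' {h i (t, s₀)} : Set (Annuli L.n δ)) \ {b₀},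
      ((e' b).symm p).2 ∈ Icc 0 δ := by
    refine (eventually_all_finite hfin.sdiff).2 ?_
    rintro ⟨j, T, s⟩ ⟨hmem, hne⟩
    obtain ⟨t', σ', ht, hb'⟩ := he' (j, T, s)
    simp only at ht hb'
    obtain rfl := ht
    rw [mem_preimage, mem_singleton_iff, hs.stripPoint_coe] at hmem
    have hno : ¬ ((s : ℝ) = 0 ∨ (s : ℝ) = δ) := fun h0 => hne (by
      obtain ⟨h1, h2⟩ := hsim j t' s h0 hmem
      obtain ⟨rfl, h3⟩ := sameParam_iff.1 h1
      rw [mem_singleton_iff, hb₀, h3]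
      congr 2
      exact Subtype.ext h2)
    push Not at hno
    rw [← hmem]
    exact ((continuous_snd.tendsto _).comp hb'.tendsto_symm).eventually
      (Icc_mem_nhds (lt_of_le_of_ne s.2.1 hno.1.symm) (lt_of_le_of_ne s.2.2 hno.2))
  refine ⟨((stripPoint h ⁻¹' {h i (t, s₀)} : Set (Annuli L.n δ)) \ {b₀}).ncard, ?_⟩
  have he0' := he0 b₀ rfl
  filter_upwards [hev, h1] with p hp hp'
  refine ⟨fun hI => ?_, fun hI => ?_⟩
  · rw [count, hp,
      ncard_sdiff_singleton_add_one (show b₀ ∈ stripPoint h ⁻¹' {h i (t, s₀)} from hb₀mem) hfin]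
    congr 1
    ext b
    refine ⟨fun hb => hb.1, fun hb => ⟨hb, ?_⟩⟩
    by_cases hbb : b = b₀
    · rw [hbb, he0']; exact hI
    · exact hp' b ⟨hb, hbb⟩
  · rw [count, hp]
    congr 1
    ext b
    refine ⟨fun hb => ⟨hb.1, fun hbb => hI ?_⟩, fun hb => ⟨hb.1, hp' b hb⟩⟩
    have := hb.2
    rwa [mem_singleton_iff.1 hbb, he0'] at this

theorem exists_count_curve (hb : D.IsBox (h i) e σ (t, δ)) (hsim : hs.IsSimpleAt {0, δ} i t δ) :
    ∃ m, ∀ᶠ p in 𝓝 (h i (t, δ)), ((e.symm p).2 < δ → hs.count p = m + 1) ∧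
      (δ < (e.symm p).2 → hs.count p = m) := by
  obtain ⟨m, hm⟩ := hs.exists_count_eventually_eq hb hs.width_mem hsim
  have h1 := ((continuous_snd.tendsto _).comp hb.tendsto_symm).eventually_const_lt hs.pos
  refine ⟨m, ?_⟩
  filter_upwards [hm, h1] with p hp h0
  exact ⟨fun h => hp.1 ⟨h0.le, h.le⟩, fun h => hp.2 fun h' => h'.2.not_gt h⟩

theorem exists_count_low (hb : D.IsBox (h i) e σ (t, 0)) (hsim : hs.IsSimpleAt {0, δ} i t 0) :
    ∃ m, ∀ᶠ p in 𝓝 (h i (t, 0)), ((e.symm p).2 < 0 → hs.count p = m) ∧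
      (0 < (e.symm p).2 → hs.count p = m + 1) := by
  obtain ⟨m, hm⟩ := hs.exists_count_eventually_eq hb hs.zero_mem hsim
  have h1 := ((continuous_snd.tendsto _).comp hb.tendsto_symm).eventually_lt_const hs.pos
  refine ⟨m, ?_⟩
  filter_upwards [hm, h1] with p hp h0
  exact ⟨fun h => hp.2 fun h' => h'.1.not_gt h, fun h => hp.1 ⟨h.le, h0.le⟩⟩

end IsStrip

end RegularDiagram

/-! ### Isolation of the crossings of `L` with itself and with other sheets -/

namespace RegularDiagram

variable {M : Type u} [TopologicalSpace M] [ChartedSpace (EuclideanSpace ℝ (Fin 2)) M]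
  {D : RegularDiagram M}

/-- Near a double point that is not a triple point, there are no triple points. -/
theorem IsDoublePoint.eventually [IsManifold (𝓡 2) ∞ M] [CompactSpace M] {x y : M}
    (hd : D.IsDoublePoint x y) :
    ∀ᶠ q : M × M in 𝓝 (x, y), D.IsUnderOver q.1 q.2 → D.IsDoublePoint q.1 q.2 := by
  have hx := D.eventually_proj_injective x
  have hy := D.eventually_proj_injective y
  rw [nhds_prod_eq, eventually_prod_iff] at hx hy
  obtain ⟨pa, ha, pb, hb, hab⟩ := hx
  obtain ⟨pa', ha', pb', hb', hab'⟩ := hy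
  -- By closedness of the projection, the preimages of nearby points are near `x` or near `y`, and
  -- the projection is injective near each of the two.
  have h2 : ∀ᶠ q in 𝓝 (D.proj x), ∀ z ∈ D.proj ⁻¹' {q}, pa z ∨ pa' z :=
    D.continuous_proj.isClosedMap.eventually_nhds_fiber (D.proj x) fun z hz => by
      rcases hd.2 z hz with rfl | rfl
      · exact ha.mono fun w hw => .inl hw
      · exact ha'.mono fun w hw => .inr hw
  have h3 : Tendsto (fun q : M × M => D.proj q.1) (𝓝 (x, y)) (𝓝 (D.proj x)) :=
    (D.continuous_proj.comp continuous_fst).tendsto (x, y)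
  rw [nhds_prod_eq] at h3 ⊢
  filter_upwards [h3.eventually h2, hb.prod_mk hb'] with q hq hq' hU
  refine ⟨hU, fun z hz => ?_⟩
  rcases hq z hz with h | h
  · exact .inl (hab h hq'.1 hz)
  · exact .inr (hab' h hq'.2 (hz.trans hU.1))

namespace IsStrip

variable {L : D.ImmersedCurves} {low up : Fin L.n → ℝ → M} {h : Fin L.n → ℝ × ℝ → M} {δ η : ℝ}
  (hs : IsStrip L low up h δ η) [T2Space M] [IsManifold (𝓡 2) ∞ M]

include hs

/-- Over a crossing with another sheet, a point of `L` is isolated among the points that lie over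
the other sheet. -/
theorem eventually_support_off_sheet {x y : M} (hxy : y ≠ x) (hp : D.proj y = D.proj x) :
    ∀ᶠ q : M × M in 𝓝 (x, y), D.proj q.1 = D.proj q.2 → q.1 ∈ L.support → q.1 = x := by
  obtain ⟨r, g, hr, hg, hrg⟩ := D.exists_sheet_retraction y
  have h1 : Tendsto (fun p : M => (p, (0 : ℝ))) (𝓝 y) (𝓝 (y, 0)) :=
    (continuous_id.prodMk continuous_const).tendsto y
  have h0 : ∀ᶠ z in 𝓝 y, g (D.proj z) = 0 := by
    filter_upwards [h1.eventually hrg] with z hz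
    simpa using hz.2
  have hne : (∞ : WithTop ℕ∞) ≠ 0 := by simp
  have h2 : ∀ᶠ p in 𝓝 x, ∀ i t, ∀ s : Icc (0 : ℝ) δ, h i (t, s) = p → (s : ℝ) = δ →
      g (D.proj p) = 0 → p = x := by
    have := hs.eventually_fiber (p₀ := x) (Q := fun b => (b.2.2 : ℝ) = δ →
      g (D.proj (stripPoint h b)) = 0 → stripPoint h b = x) fun i t s hx => by
        by_cases hsδ : (s : ℝ) = δ
        · rw [hsδ, hs.curve] at hx
          -- The curve of `L` crosses the sheet of `y` transversely, so the displacement `g` from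
          -- that sheet has nonzero derivative along the curve and vanishes only at `t` nearby.
          have hd := L.double_transverse i t y (by rwa [hx]) (by rwa [hx])
          have h2 : HasDerivAt (fun r => D.proj (L.curve i r)) _ t :=
            ((D.contDiffAt_proj_comp le_rfl ((L.contMDiff i).contMDiffAt (x := t))).differentiableAt
              hne).hasDerivAt
          have h4 : HasDerivAt (fun r => g (D.proj (L.curve i r)))
              (fderiv ℝ g (D.proj y) (deriv (fun r => D.proj (L.curve i r)) t)) t :=
            HasFDerivAt.comp_hasDerivAt (f := fun r => D.proj (L.curve i r)) t
              (by rw [hx, ← hp]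
                  exact (hg.self_of_nhds.2.1.differentiableAt hne).hasFDerivAt) h2
          rw [D.sheet_fderiv hr hg, real_inner_comm] at h4
          have h5 := h4.eventually_ne (c := 0) hd
          rw [eventually_nhdsWithin_iff] at h5
          filter_upwards [(continuous_fst.tendsto (t, s)).eventually h5] with z hz hzδ hz0
          rw [hs.stripPoint_coe, hzδ, hs.curve] at hz0 ⊢
          by_contra hne
          exact hz (fun hzt => hne (by rw [hzt, hx])) hz0
        · filter_upwards [(continuous_subtype_val.comp continuous_snd).continuousAt.eventually_ne
            (x := (t, s)) hsδ] with z hz hz'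
          exact absurd hz' hz
    filter_upwards [this] with p hp i t s hps hsδ hg0
    have := hp i t s hps hsδ
    rw [hs.stripPoint_coe, hps] at this
    exact this hg0
  rw [nhds_prod_eq]
  filter_upwards [h2.prod_mk h0] with q hq hqq
  rintro ⟨i, t, ht⟩
  exact hq.1 i t ⟨δ, hs.width_mem⟩ ((hs.curve i t).trans ht) rfl (by rw [hqq, hq.2])

omit [T2Space M] [IsManifold (𝓡 2) ∞ M] in
/-- Near a point of `L`, a transverse curve of `L` meets the coordinate line only in that point. -/
theorem eventually_snd_ne {i : Fin L.n} {t : ℝ} {e : OpenPartialHomeomorph (ℝ × ℝ) M}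
    {σ : E3 → ℝ × ℝ} (hb : D.IsBox (h i) e σ (t, δ)) {j : Fin L.n} {t' : ℝ}
    (heq : L.curve j t' = L.curve i t) (hne : ¬ SameParam i t j t') :
    ∀ᶠ r in 𝓝 t', (e.symm (L.curve j r)).2 = δ → r = t' := by
  have hli := (L.self_transverse i t j t' heq.symm).resolve_left hne
  have hne : (∞ : WithTop ℕ∞) ≠ 0 := by simp
  have h2 : HasDerivAt (fun r => D.proj (L.curve j r)) (L.velocity j t') t' :=
    ((D.contDiffAt_proj_comp le_rfl ((L.contMDiff j).contMDiffAt (x := t'))).differentiableAt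
      hne).hasDerivAt
  obtain ⟨a, b, -, hd, hw⟩ := hb.exists_hasDerivAt (γ := L.curve j) (by rw [heq, hs.curve])
    (L.contMDiff j).continuous.continuousAt h2
  -- With `b = 0` the two velocities would be parallel.
  have hb0 : b ≠ 0 := by
    rintro rfl
    rw [zero_smul, add_zero, ← hs.velocity_eq] at hw
    have := LinearIndependent.pair_iff.1 hli a (-1) (by
      change a • L.velocity i t + (-1 : ℝ) • L.velocity j t' = 0
      rw [hw]; simp)
    simp at this
  have h5 := hd.eventually_ne (c := δ) hb0
  rw [eventually_nhdsWithin_iff] at h5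
  filter_upwards [h5] with r hr hr0
  by_contra hrt
  exact hr hrt hr0

/-- The crossings of the curves of `L` are isolated. -/
theorem eventually_not_crossing (p₀ : M) : ∀ᶠ p in 𝓝 p₀, p ≠ p₀ →
    ∀ i t j s, L.curve i t = p → L.curve j s = p → SameParam j s i t := by
  -- The crossings near `p₀` are controlled through pairs of parameters in the fibre over `(p₀,
  -- p₀)`.
  have hcl := (hs.continuous_stripPoint.prodMap hs.continuous_stripPoint).isClosedMap
  have := hcl.eventually_nhds_fiber (p := fun b : Annuli L.n δ × Annuli L.n δ =>
    (b.1.2.2 : ℝ) = δ → (b.2.2.2 : ℝ) = δ → stripPoint h b.1 = stripPoint h b.2 →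
      b.1 = b.2 ∨ stripPoint h b.1 = p₀) (p₀, p₀) (by
    rintro ⟨⟨i, T, s⟩, ⟨j, T', s'⟩⟩ hp
    obtain ⟨t, rfl⟩ := QuotientAddGroup.mk_surjective T
    obtain ⟨t', rfl⟩ := QuotientAddGroup.mk_surjective T'
    rw [mem_preimage, mem_singleton_iff, Prod.map_apply, Prod.mk.injEq, hs.stripPoint_coe,
      hs.stripPoint_coe] at hp
    have hc : Continuous fun b : Annuli L.n δ => (b.2.2 : ℝ) := by fun_prop
    rw [nhds_prod_eq]
    by_cases h1 : (s : ℝ) = δ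
    swap
    · have h3 : ∀ᶠ b in 𝓝 ((i, ↑t, s) : Annuli L.n δ), (b.2.2 : ℝ) ≠ δ :=
        hc.continuousAt.eventually_ne h1
      filter_upwards [h3.prod_inl (𝓝 _)] with b hb hb'
      exact absurd hb' hb
    by_cases h2 : (s' : ℝ) = δ
    swap
    · have h3 : ∀ᶠ b in 𝓝 ((j, ↑t', s') : Annuli L.n δ), (b.2.2 : ℝ) ≠ δ :=
        hc.continuousAt.eventually_ne h2
      filter_upwards [h3.prod_inr (𝓝 _)] with b hb _ hb'
      exact absurd hb' hb
    rw [h1, h2] at hp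
    obtain ⟨e, σ, hb⟩ := hs.exists_isBox i t (hs.abs_lt hs.width_mem)
    have hbox : ∀ᶠ b in 𝓝 ((i, ↑t, s) : Annuli L.n δ), (b.2.2 : ℝ) = δ → b.1 = i ∧
        ∃ r : ℝ, b.2.1 = (r : UnitAddCircle) ∧ e.symm (stripPoint h b) = (r, δ) := by
      refine eventually_annuli ?_
      have h3 : Tendsto (fun z : ℝ × Icc (0 : ℝ) δ => (z.1, (z.2 : ℝ))) (𝓝 (t, s))
          (𝓝 (t, (s : ℝ))) :=
        (continuous_fst.prodMk (continuous_subtype_val.comp continuous_snd)).tendsto (t, s)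
      rw [h1] at h3
      filter_upwards [h3.eventually hb.eventually_left_inv] with z hz hzδ
      refine ⟨rfl, z.1, rfl, ?_⟩
      rw [hs.stripPoint_coe, hz, hzδ]
    -- Two parameters near the same one with a common image coincide, as the box is injective. Near
    -- different parameters the branches cross transversely and meet at `p₀` only.
    by_cases hsame : SameParam i t j t'
    · obtain ⟨rfl, h3⟩ := sameParam_iff.1 hsame
      obtain rfl : s = s' := Subtype.ext (h1.trans h2.symm)
      rw [← h3]
      filter_upwards [hbox.prod_mk hbox] with b hb ha ha' heq
      left
      obtain ⟨hi, r, hr, he⟩ := hb.1 ha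
      obtain ⟨hi', r', hr', he'⟩ := hb.2 ha'
      rw [heq, he', Prod.mk.injEq] at he
      refine Prod.ext (hi.trans hi'.symm) (Prod.ext ?_ (Subtype.ext (ha.trans ha'.symm)))
      rw [hr, hr', he.1]
    · have hev := hs.eventually_snd_ne hb (by
        rw [← hs.curve, ← hs.curve, hp.1, hp.2]) hsame
      have hbox' : ∀ᶠ b in 𝓝 ((j, ↑t', s') : Annuli L.n δ), (b.2.2 : ℝ) = δ →
          (e.symm (stripPoint h b)).2 = δ → stripPoint h b = p₀ := by
        refine eventually_annuli ?_
        filter_upwards [(continuous_fst.tendsto (t', s')).eventually hev] with z hz hzδ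
        rw [hs.stripPoint_coe, hzδ, hs.curve]
        intro h0
        rw [hz h0, ← hs.curve, hp.2]
      filter_upwards [hbox.prod_mk hbox'] with b hb ha ha' heq
      right
      obtain ⟨-, r, -, he⟩ := hb.1 ha
      rw [heq] at he ⊢
      exact hb.2 ha' (by rw [he]))
  have hdiag : Tendsto (fun p : M => (p, p)) (𝓝 p₀) (𝓝 (p₀, p₀)) :=
    (continuous_id.prodMk continuous_id).tendsto p₀
  filter_upwards [hdiag.eventually this] with p hp hne i t j s hit hjs
  have h1 := hp (((i, ↑t, ⟨δ, hs.width_mem⟩), (j, ↑s, ⟨δ, hs.width_mem⟩))) (by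
    rw [mem_preimage, mem_singleton_iff, Prod.map_apply, hs.stripPoint_coe, hs.stripPoint_coe,
      hs.curve, hs.curve, hit, hjs]) rfl rfl (by
    rw [hs.stripPoint_coe, hs.stripPoint_coe, hs.curve, hs.curve, hit, hjs])
  simp only [hs.stripPoint_coe, hs.curve, hit, hne, or_false, Prod.mk.injEq] at h1
  exact sameParam_iff.2 ⟨h1.1.symm, h1.2.1.symm⟩

/-- At simple points of `L` the box exhibits points off `L`. If `L` filled a neighbourhood of `p₀`,
then a neighbouring point off the coordinate line would be an interior point of `L`, yet simple,
because crossings are isolated. -/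
theorem frequently_not_mem_support [CompactSpace M] {p₀ : M} (hp₀ : p₀ ∉ D.lowerSet) :
    ∃ᶠ p in 𝓝 p₀, p ∉ L.support := by
  have hsimple : ∀ i t, L.curve i t ∉ D.lowerSet →
      (∀ j s, L.curve j s = L.curve i t → SameParam j s i t) →
      ∃ᶠ p in 𝓝 (L.curve i t), p ∉ L.support := fun i t hl hsim => by
    obtain ⟨e, σ, hb⟩ := hs.exists_isBox i t (hs.abs_lt hs.width_mem)
    have h1 := hb.frequently_gt.and_eventually
      (hs.eventually_mem_cutSurface hb (hs.isSimpleAt_curve hl hsim))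
    rw [hs.curve] at h1
    exact h1.mono fun p hp hps => hp.2 hp.1.ne' (.inr hps)
  intro hall
  simp only [not_not] at hall
  obtain ⟨i, t, rfl⟩ := hall.self_of_nhds
  obtain ⟨e, σ, hb⟩ := hs.exists_isBox i t (hs.abs_lt hs.width_mem)
  have h1 := hb.frequently_gt
  have h0 := hb.symm_apply
  rw [hs.curve] at h1 h0
  obtain ⟨p, hgt, hp, hpl, hpc⟩ := (h1.and_eventually (hall.eventually_nhds.and
    ((D.isClosed_lowerSet.isOpen_compl.eventually_mem hp₀).and
      (hs.eventually_not_crossing (L.curve i t))))).exists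
  obtain ⟨j, s, rfl⟩ := hp.self_of_nhds
  have hne : L.curve j s ≠ L.curve i t := fun heq => by
    rw [heq, h0] at hgt
    exact lt_irrefl _ hgt
  exact hsimple j s hpl (fun k r hk => hpc hne _ _ _ _ rfl hk) (by simpa using hp)

end IsStrip

end RegularDiagram

/-! ### Locally constant colors and powers of the kink map -/

/-- A locally constant partial function that is defined densely near a connected set is constant
there. The function is given by its graph `F`, on the domain `V`. -/
theorem IsPreconnected.exists_eventually_eq {X R : Type*} [TopologicalSpace X] {C V : Set X}
    (hC : IsPreconnected C) (hne : C.Nonempty) {F : X → R → Prop}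
    (hfun : ∀ p v w, F p v → F p w → v = w)
    (hloc : ∀ p ∈ C, ∃ v, ∀ᶠ q in 𝓝 p, q ∈ V → F q v) (hV : ∀ p ∈ C, ∃ᶠ q in 𝓝 p, q ∈ V) :
    ∃ v, ∀ p ∈ C, ∀ᶠ q in 𝓝 p, q ∈ V → F q v := by
  obtain ⟨p₀, hp₀⟩ := hne
  obtain ⟨v, hv⟩ := hloc p₀ hp₀
  refine ⟨v, fun p hp => ?_⟩
  by_contra hcon
  have ho1 : IsOpen {p | ∀ᶠ q in 𝓝 p, q ∈ V → F q v} := isOpen_setOfPred_eventually_nhds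
  -- The sets of points with local value `v` and with another local value are open and cover `C`. If
  -- both met `C`, they would share a point of `C`, and near it the dense domain contains a point
  -- with two values.
  have ho2 : IsOpen {p | ∃ w, w ≠ v ∧ ∀ᶠ q in 𝓝 p, q ∈ V → F q w} := by
    rw [isOpen_iff_eventually]
    rintro p ⟨w, hw, hp⟩
    exact hp.eventually_nhds.mono fun q hq => ⟨w, hw, hq⟩
  obtain ⟨q, hqC, hq1, w, hw, hq2⟩ := hC _ _ ho1 ho2 (fun q hq => by
    obtain ⟨w, hw⟩ := hloc q hq
    by_cases hwv : w = v
    · exact .inl (hwv ▸ hw)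
    · exact .inr ⟨w, hwv, hw⟩) ⟨p₀, hp₀, hv⟩ (by
    obtain ⟨w, hw⟩ := hloc p hp
    refine ⟨p, hp, w, ?_, hw⟩
    rintro rfl
    exact hcon hw)
  obtain ⟨q', hq'V, h1, h2⟩ := ((hV q hqC).and_eventually (hq1.and hq2)).exists
  exact hw (hfun q' w v (h2 hq'V) (h1 hq'V))

section Kink

variable {R : Type v} [Rack R]

/-- The kink map as a permutation of the rack. -/
def kinkPerm (R : Type v) [Rack R] : Equiv.Perm R where
  toFun := rackKink
  invFun a := a ◃ a
  left_inv := self_act_rackKink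
  right_inv := rackKink_self_act

theorem act_kinkPerm_pow (a b : R) (m : ℕ) :
    b ◃ (kinkPerm R ^ m) a = (kinkPerm R ^ m) (b ◃ a) := by
  induction m with
  | zero => rfl
  | succ m ih =>
    rw [pow_succ', Equiv.Perm.mul_apply, Equiv.Perm.mul_apply, ← ih]
    exact rackKink_act _ _

theorem kinkPerm_pow_act (a b : R) (m : ℕ) : (kinkPerm R ^ m) b ◃ a = b ◃ a := by
  induction m with
  | zero => rfl
  | succ m ih =>
    rw [pow_succ', Equiv.Perm.mul_apply, ← ih]
    exact rackKink_left _ _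

theorem kinkPerm_pow_succ_apply (a : R) (m : ℕ) :
    (kinkPerm R ^ (m + 1)) a = rackKink ((kinkPerm R ^ m) a) := by
  rw [pow_succ']
  rfl

/-- The coloring relation of the associated quandle and the relation of the rack, for colors that
are changed by powers of the kink map. -/
theorem kinkPerm_pow_relation_iff (a b c : R) (k m : ℕ) :
    (kinkPerm R ^ m) c = (kinkPerm R ^ k) b ◃ (kinkPerm R ^ (m + 1)) a ↔
      c = b ◃ rackKink a := by
  rw [kinkPerm_pow_act, act_kinkPerm_pow, pow_succ, Equiv.Perm.mul_apply,
    (kinkPerm R ^ m).injective.eq_iff, rackKink_act]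
  rfl

end Kink

/-! ### Sheets and their behaviour near the boundary curves of the strips -/

namespace RegularDiagram

variable {M : Type u} [TopologicalSpace M] [ChartedSpace (EuclideanSpace ℝ (Fin 2)) M]
  {D : RegularDiagram M}

theorem cutSurface_subset {S T : Set M} (h : S ⊆ T) : D.cutSurface T ⊆ D.cutSurface S :=
  compl_subset_compl.2 (union_subset_union_right _ h)

namespace Sheet

variable {S : Set M}

theorem subset (A : D.Sheet S) : A.1 ⊆ D.cutSurface S := by
  obtain ⟨A, p, hp, rfl⟩ := A
  exact connectedComponentIn_subset _ _

theorem isPreconnected (A : D.Sheet S) : IsPreconnected A.1 := by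
  obtain ⟨A, p, hp, rfl⟩ := A
  exact isPreconnected_connectedComponentIn

theorem nonempty (A : D.Sheet S) : A.1.Nonempty := by
  obtain ⟨A, p, hp, rfl⟩ := A
  exact ⟨p, mem_connectedComponentIn hp⟩

theorem isOpen (A : D.Sheet S) (hS : IsOpen (D.cutSurface S)) : IsOpen A.1 := by
  have : LocallyConnectedSpace M := ChartedSpace.locallyConnectedSpace (EuclideanSpace ℝ (Fin 2)) M
  obtain ⟨A, p, hp, rfl⟩ := A
  exact hS.connectedComponentIn

theorem eq_of_mem {A B : D.Sheet S} {p : M} (hA : p ∈ A.1) (hB : p ∈ B.1) : A = B := by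
  obtain ⟨A, q, hq, rfl⟩ := A
  obtain ⟨B, r, hr, rfl⟩ := B
  exact Subtype.ext ((connectedComponentIn_eq hA).trans (connectedComponentIn_eq hB).symm)

theorem exists_subset {C : Set M} (hC : IsPreconnected C) (hne : C.Nonempty)
    (hS : C ⊆ D.cutSurface S) : ∃ A : D.Sheet S, C ⊆ A.1 := by
  obtain ⟨p, hp⟩ := hne
  exact ⟨⟨_, p, hS hp, rfl⟩, hC.subset_connectedComponentIn hp hS⟩

theorem exists_mem {p : M} (hp : p ∈ D.cutSurface S) : ∃ A : D.Sheet S, p ∈ A.1 :=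
  ⟨⟨_, p, hp, rfl⟩, mem_connectedComponentIn hp⟩

theorem exists_superset (A : D.Sheet S) : ∃ B : D.Sheet ∅, A.1 ⊆ B.1 :=
  exists_subset A.isPreconnected A.nonempty (A.subset.trans (cutSurface_subset (empty_subset S)))

end Sheet

namespace IsBox

variable {h : ℝ × ℝ → M} {e : OpenPartialHomeomorph (ℝ × ℝ) M} {σ : E3 → ℝ × ℝ} {q₀ : ℝ × ℝ}
  (hb : D.IsBox h e σ q₀)

include hb

theorem frequently_lt : ∃ᶠ p in 𝓝 (h q₀), (e.symm p).2 < q₀.2 := by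
  rw [← hb.map_nhds, frequently_map]
  have h1 : Tendsto (fun s : ℝ => (q₀.1, s)) (𝓝[<] q₀.2) (𝓝 q₀) :=
    ((continuous_const.prodMk continuous_id).tendsto q₀.2).mono_left nhdsWithin_le_nhds
  have h2 : ∃ᶠ s in 𝓝[<] q₀.2, ((q₀.1, s) : ℝ × ℝ).2 < q₀.2 :=
    Eventually.frequently self_mem_nhdsWithin
  refine ((h1.frequently (p := fun q => q.2 < q₀.2) h2).and_eventually
    hb.eventually_left_inv).mono ?_
  rintro q ⟨hq, hq'⟩
  rwa [hq']

/-- A connected part of the box that avoids the cuts lies in a single sheet. -/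
theorem exists_sheet {S : Set M} {Q : Set (ℝ × ℝ)}
    (hQ : ∀ ρ > 0, IsPreconnected (square q₀ ρ ∩ Q))
    (hne : ∃ᶠ p in 𝓝 (h q₀), e.symm p ∈ Q)
    (hS : ∀ᶠ p in 𝓝 (h q₀), e.symm p ∈ Q → p ∈ D.cutSurface S) :
    ∃ A : D.Sheet S, ∀ᶠ p in 𝓝 (h q₀), e.symm p ∈ Q → p ∈ A.1 := by
  obtain ⟨C, hCW, hC, hCQ, hev⟩ := hb.exists_isPreconnected hQ hS
  have hCne : C.Nonempty := by
    obtain ⟨p, hp, hp'⟩ := (hne.and_eventually hev).exists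
    exact ⟨p, hp' hp⟩
  obtain ⟨A, hA⟩ := Sheet.exists_subset hC hCne fun p hp => hCW hp (hCQ p hp).1
  exact ⟨A, hev.mono fun p hp hpQ => hA (hp hpQ)⟩

theorem exists_sheet_lt {S : Set M}
    (hS : ∀ᶠ p in 𝓝 (h q₀), (e.symm p).2 ≠ q₀.2 → p ∈ D.cutSurface S) :
    ∃ A : D.Sheet S, ∀ᶠ p in 𝓝 (h q₀), (e.symm p).2 < q₀.2 → p ∈ A.1 :=
  hb.exists_sheet (Q := {q | q.2 < q₀.2}) (fun ρ _ => isPreconnected_square_snd_lt q₀ ρ)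
    hb.frequently_lt (hS.mono fun _ hp hlt => hp (ne_of_lt hlt))

theorem exists_sheet_gt {S : Set M}
    (hS : ∀ᶠ p in 𝓝 (h q₀), (e.symm p).2 ≠ q₀.2 → p ∈ D.cutSurface S) :
    ∃ A : D.Sheet S, ∀ᶠ p in 𝓝 (h q₀), q₀.2 < (e.symm p).2 → p ∈ A.1 :=
  hb.exists_sheet (Q := {q | q₀.2 < q.2}) (fun ρ _ => isPreconnected_square_snd_gt q₀ ρ)
    hb.frequently_gt (hS.mono fun _ hp hlt => hp (ne_of_gt hlt))

end IsBox

theorem adjacentOnSide_of_lt {h : ℝ × ℝ → M} {e : OpenPartialHomeomorph (ℝ × ℝ) M} {t s : ℝ}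
    (hh : ContMDiffAt 𝓘(ℝ, ℝ × ℝ) (𝓡 2) ∞ h (t, s)) (he : ∀ᶠ q in 𝓝 (t, s), e.symm (h q) = q)
    {A : Set M} {ν : E3} (hν : ⟪fderiv ℝ (fun q => D.proj (h q)) (t, s) (0, 1), ν⟫ < 0)
    (hA : ∀ᶠ p in 𝓝 (h (t, s)), (e.symm p).2 < s → p ∈ A) : D.AdjacentOnSide A (h (t, s)) ν := by
  refine adjacentOnSide_of_eventually hh (κ := -1) (by linarith) ?_
  have h1 : Tendsto (fun τ : ℝ => (t, s + -1 * τ)) (𝓝[>] 0) (𝓝 (t, s)) := by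
    have : Continuous fun τ : ℝ => (t, s + -1 * τ) := by fun_prop
    simpa using (this.tendsto 0).mono_left nhdsWithin_le_nhds
  filter_upwards [h1.eventually he, (hh.continuousAt.tendsto.comp h1).eventually hA,
    self_mem_nhdsWithin] with τ hτ hτ' h0
  refine hτ' ?_
  rw [Function.comp_apply, hτ]
  have := mem_Ioi.1 h0
  simp only
  linarith

theorem adjacentOnSide_of_gt {h : ℝ × ℝ → M} {e : OpenPartialHomeomorph (ℝ × ℝ) M} {t s : ℝ}
    (hh : ContMDiffAt 𝓘(ℝ, ℝ × ℝ) (𝓡 2) ∞ h (t, s)) (he : ∀ᶠ q in 𝓝 (t, s), e.symm (h q) = q)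
    {A : Set M} {ν : E3} (hν : ⟪fderiv ℝ (fun q => D.proj (h q)) (t, s) (0, 1), ν⟫ < 0)
    (hA : ∀ᶠ p in 𝓝 (h (t, s)), s < (e.symm p).2 → p ∈ A) :
    D.AdjacentOnSide A (h (t, s)) (-ν) := by
  refine adjacentOnSide_of_eventually hh (κ := 1) (by rw [inner_neg_right]; linarith) ?_
  have h1 : Tendsto (fun τ : ℝ => (t, s + 1 * τ)) (𝓝[>] 0) (𝓝 (t, s)) := by
    have : Continuous fun τ : ℝ => (t, s + 1 * τ) := by fun_prop
    simpa using (this.tendsto 0).mono_left nhdsWithin_le_nhds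
  filter_upwards [h1.eventually he, (hh.continuousAt.tendsto.comp h1).eventually hA,
    self_mem_nhdsWithin] with τ hτ hτ' h0
  refine hτ' ?_
  rw [Function.comp_apply, hτ]
  have := mem_Ioi.1 h0
  simp only
  linarith

end RegularDiagram

/-! ### The correspondence of colorings -/

namespace RegularDiagram

variable {M : Type u} [TopologicalSpace M] [ChartedSpace (EuclideanSpace ℝ (Fin 2)) M]
  {D : RegularDiagram M}

namespace IsStrip

variable {L : D.ImmersedCurves} {low up : Fin L.n → ℝ → M} {h : Fin L.n → ℝ × ℝ → M} {δ η : ℝ}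
  (hs : IsStrip L low up h δ η) {R : Type v} [Rack R]

/-- The colors of the diagram cut along `L` arise from the colors of the diagram by the powers of
the kink map that are given by the number of strips over each point. -/
def Corresponds (hs : IsStrip L low up h δ η) (c : D.Sheet ∅ → R) (c' : D.Sheet L.support → R) :
    Prop :=
  ∀ (A : D.Sheet ∅) (B : D.Sheet L.support) (p : M), p ∈ A.1 → p ∈ B.1 →
    c' B = (kinkPerm R ^ hs.count p) (c A)

include hs

theorem inner_curve_normalDir (i : Fin L.n) (t : ℝ) :
    ⟪fderiv ℝ (fun q => D.proj (h i q)) (t, δ) (1, 0), L.normalDir i t⟫ = 0 := by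
  rw [ImmersedCurves.normalDir, hs.velocity_eq, real_inner_comm, inner_cross3_right]

/-- The normal direction of `L` points back into the strip, towards smaller times, where the count
is larger. -/
theorem inner_transverse_normalDir (i : Fin L.n) (t : ℝ) :
    ⟪fderiv ℝ (fun q => D.proj (h i q)) (t, δ) (0, 1), L.normalDir i t⟫ < 0 := by
  rw [ImmersedCurves.normalDir, hs.velocity_eq, real_inner_comm, ← hs.curve]
  exact hs.immersed i t δ (hs.abs_lt hs.width_mem)

/-- The lower and upper curves have the same image in ℝ³, so the velocity of the lower curve is
tangent to the upper sheet. -/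
theorem inner_low_normal_up (i : Fin L.n) (t : ℝ) :
    ⟪fderiv ℝ (fun q => D.proj (h i q)) (t, 0) (1, 0), D.normal (up i t)⟫ = 0 := by
  have h1 : (fun r => D.proj (low i r)) = fun r => D.proj (up i r) :=
    funext fun r => (hs.parametrizes.isUnderOver i r).1
  rw [← hs.deriv_low, h1, real_inner_comm]
  exact D.inner_normal_fderiv (((hs.parametrizes.contMDiff_up i).mdifferentiable (by simp)) t) 1

theorem inner_transverse_normal_up (i : Fin L.n) (t : ℝ) :
    ⟪fderiv ℝ (fun q => D.proj (h i q)) (t, 0) (0, 1), D.normal (up i t)⟫ < 0 :=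
  hs.against_upper i t 0 (hs.abs_lt hs.zero_mem)

variable [T2Space M] [CompactSpace M] [IsManifold (𝓡 2) ∞ M]

omit hs [T2Space M] [CompactSpace M] [IsManifold (𝓡 2) ∞ M] in
theorem _root_.RegularDiagram.cutSurface_empty : D.cutSurface ∅ = D.lowerSetᶜ := by
  rw [cutSurface, union_empty]

omit hs in
variable (D) in
theorem _root_.RegularDiagram.isOpen_cutSurface_empty : IsOpen (D.cutSurface ∅) := by
  rw [cutSurface_empty]
  exact D.isClosed_lowerSet.isOpen_compl

theorem isOpen_cutSurface : IsOpen (D.cutSurface L.support) :=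
  (D.isClosed_lowerSet.union hs.isClosed_support).isOpen_compl

theorem frequently_mem_cutSurface {p : M} (hp : p ∈ D.cutSurface ∅) :
    ∃ᶠ q in 𝓝 p, q ∈ D.cutSurface L.support := by
  rw [cutSurface_empty] at hp
  refine ((hs.frequently_not_mem_support hp).and_eventually
    (D.isClosed_lowerSet.isOpen_compl.eventually_mem hp)).mono ?_
  rintro q ⟨h1, h2⟩ (h3 | h3)
  exacts [h2 h3, h1 h3]

/-- Along a sheet cut by `L` both the count and the sheet of `D` are locally constant, so the
prescribed color does not depend on the point. -/
theorem exists_corresponds_of_coloring (c : D.Sheet ∅ → R) :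
    ∃ c' : D.Sheet L.support → R, hs.Corresponds c c' := by
  have key : ∀ B : D.Sheet L.support, ∃ v, ∀ p ∈ B.1, ∀ᶠ q in 𝓝 p, q ∈ D.cutSurface L.support →
      ∃ A : D.Sheet ∅, q ∈ A.1 ∧ v = (kinkPerm R ^ hs.count q) (c A) := fun B => by
    refine B.isPreconnected.exists_eventually_eq B.nonempty (V := D.cutSurface L.support)
      (F := fun q v => ∃ A : D.Sheet ∅, q ∈ A.1 ∧ v = (kinkPerm R ^ hs.count q) (c A)) ?_ ?_ ?_
    · rintro p v w ⟨A, hA, rfl⟩ ⟨A', hA', rfl⟩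
      rw [Sheet.eq_of_mem hA hA']
    · intro p hp
      obtain ⟨A, hA⟩ := B.exists_superset
      refine ⟨(kinkPerm R ^ hs.count p) (c A), ?_⟩
      filter_upwards [hs.count_eventually_eq (B.subset hp),
        (A.isOpen D.isOpen_cutSurface_empty).eventually_mem (hA hp)] with q hq hqA _
      exact ⟨A, hqA, by rw [hq]⟩
    · intro p hp
      exact hs.frequently_mem_cutSurface (cutSurface_subset (empty_subset _) (B.subset hp))
  choose c' hc' using key
  refine ⟨c', fun A B p hA hB => ?_⟩
  obtain ⟨A', hA', hv⟩ := (hc' B p hB).self_of_nhds (B.subset hB)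
  rw [hv, Sheet.eq_of_mem hA hA']

/-- The graph of the color that a point of the diagram gets from a coloring of the diagram cut along
`L`. -/
def HasColor (hs : IsStrip L low up h δ η) (c' : D.Sheet L.support → R) (p : M) (v : R) : Prop :=
  ∃ B : D.Sheet L.support, p ∈ B.1 ∧ c' B = (kinkPerm R ^ hs.count p) v

omit [CompactSpace M] [IsManifold (𝓡 2) ∞ M] [T2Space M] in
theorem HasColor.unique {c' : D.Sheet L.support → R} {p : M} {v w : R} (hv : hs.HasColor c' p v)
    (hw : hs.HasColor c' p w) : v = w := by
  obtain ⟨B, hB, h1⟩ := hv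
  obtain ⟨B', hB', h2⟩ := hw
  rw [Sheet.eq_of_mem hB hB', h2] at h1
  exact ((kinkPerm R ^ hs.count p).injective h1).symm

theorem exists_hasColor_of_mem (c' : D.Sheet L.support → R) {p₀ : M}
    (hp₀ : p₀ ∈ D.cutSurface L.support) :
    ∃ v, ∀ᶠ q in 𝓝 p₀, q ∈ D.cutSurface L.support → hs.HasColor c' q v := by
  obtain ⟨B, hB⟩ := Sheet.exists_mem hp₀
  refine ⟨(kinkPerm R ^ hs.count p₀).symm (c' B), ?_⟩
  filter_upwards [hs.count_eventually_eq hp₀,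
    (B.isOpen hs.isOpen_cutSurface).eventually_mem hB] with q hq hqB _
  exact ⟨B, hqB, by rw [hq, Equiv.apply_symm_apply]⟩

omit [CompactSpace M] in
-- Across `L` the count jumps by one and the relation along `L` changes the color by `ι`; the two
-- effects cancel, so both sides determine the same color.
theorem exists_hasColor_of_simple {c' : D.Sheet L.support → R} (hc' : L.CurveRelation c')
    {i : Fin L.n} {t : ℝ} (hl : L.curve i t ∉ D.lowerSet)
    (hsim : ∀ j s, L.curve j s = L.curve i t → SameParam j s i t) :
    ∃ v, ∀ᶠ q in 𝓝 (L.curve i t), q ∈ D.cutSurface L.support → hs.HasColor c' q v := by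
  obtain ⟨e, σ, hb⟩ := hs.exists_isBox i t (hs.abs_lt hs.width_mem)
  have hsA := hs.isSimpleAt_curve hl hsim
  have hcut := hs.eventually_mem_cutSurface hb hsA
  have hh := hs.contMDiffAt i t δ (hs.abs_lt hs.width_mem)
  obtain ⟨m, hm⟩ := hs.exists_count_curve hb hsA
  obtain ⟨xi, hxi⟩ := hb.exists_sheet_gt hcut
  obtain ⟨xj, hxj⟩ := hb.exists_sheet_lt hcut
  have h1 := adjacentOnSide_of_gt hh hb.eventually_left_inv
    (hs.inner_transverse_normalDir i t) hxi
  have h2 := adjacentOnSide_of_lt hh hb.eventually_left_inv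
    (hs.inner_transverse_normalDir i t) hxj
  have hline : ∀ᶠ p in 𝓝 (h i (t, δ)), p ∈ D.cutSurface L.support → (e.symm p).2 ≠ δ := by
    filter_upwards [hb.eventually_right_inv] with p hp hmem heq
    refine hmem (.inr ?_)
    rw [← hp, show e.symm p = ((e.symm p).1, δ) from Prod.ext rfl heq]
    exact hs.mem_support _ _
  rw [hs.curve] at h1 h2 hm hxi hxj hline
  have hrel := hc' i t hl hsim xi xj h1 h2
  refine ⟨(kinkPerm R ^ m).symm (c' xi), ?_⟩
  filter_upwards [hm, hxi, hxj, hline] with p hp hpi hpj hne hmem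
  rcases lt_or_gt_of_ne (hne hmem) with hlt | hgt
  · exact ⟨xj, hpj hlt, by rw [hrel, hp.1 hlt, kinkPerm_pow_succ_apply, Equiv.apply_symm_apply]⟩
  · exact ⟨xi, hpi hgt, by rw [hp.2 hgt, Equiv.apply_symm_apply]⟩

/-- At a crossing of `L` no relation is imposed, but a punctured box around it is connected and
contains only simple points of `L`, so the color is the same in all sectors. -/
theorem exists_hasColor {c' : D.Sheet L.support → R} (hc' : L.CurveRelation c') {p₀ : M}
    (hp₀ : p₀ ∈ D.cutSurface ∅) :
    ∃ v, ∀ᶠ q in 𝓝 p₀, q ∈ D.cutSurface L.support → hs.HasColor c' q v := by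
  by_cases hmem : p₀ ∈ L.support
  swap
  · refine hs.exists_hasColor_of_mem c' ?_
    rw [cutSurface_empty] at hp₀
    rintro (h1 | h1)
    exacts [hp₀ h1, hmem h1]
  obtain ⟨i, t, rfl⟩ := hmem
  obtain ⟨e, σ, hb⟩ := hs.exists_isBox i t (hs.abs_lt hs.width_mem)
  have hW := (D.isOpen_cutSurface_empty.eventually_mem hp₀).and
    (hs.eventually_not_crossing (L.curve i t))
  have h0 := hb.symm_apply
  rw [← hs.curve] at hW
  obtain ⟨C, hCW, hC, hCQ, hev⟩ := hb.exists_isPreconnected (Q := {q | q ≠ (t, δ)})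
    (fun ρ hρ => isPreconnected_square_ne _ hρ) hW
  have hCne : C.Nonempty := by
    obtain ⟨p, hp, hp'⟩ := (hb.frequently_gt.and_eventually hev).exists
    exact ⟨p, hp' fun h1 => by rw [h1] at hp; exact lt_irrefl _ hp⟩
  obtain ⟨v, hv⟩ := hC.exists_eventually_eq hCne (V := D.cutSurface L.support)
    (F := hs.HasColor c') (fun p v w => HasColor.unique hs) (fun p hp => by
      obtain ⟨h1, h2⟩ := hCW hp
      by_cases hmem : p ∈ L.support
      · obtain ⟨j, s, rfl⟩ := hmem
        rw [cutSurface_empty] at h1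
        refine hs.exists_hasColor_of_simple hc' h1 fun k r hk => h2 ?_ _ _ _ _ rfl hk
        intro heq
        refine (hCQ _ hp).1 ?_
        rw [heq, h0]
      · refine hs.exists_hasColor_of_mem c' ?_
        rw [cutSurface_empty] at h1
        rintro (h3 | h3)
        exacts [h1 h3, hmem h3])
    (fun p hp => hs.frequently_mem_cutSurface (hCW hp).1)
  refine ⟨v, ?_⟩
  rw [← hs.curve]
  filter_upwards [hev, hb.eventually_right_inv] with q hq hq' hqV
  refine (hv q (hq fun h1 => ?_)).self_of_nhds hqV
  rw [h1] at hq'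
  exact hqV (.inr (hq' ▸ hs.mem_support i t))

theorem exists_corresponds_of_curveRelation {c' : D.Sheet L.support → R}
    (hc' : L.CurveRelation c') : ∃ c : D.Sheet ∅ → R, hs.Corresponds c c' := by
  have key : ∀ A : D.Sheet ∅, ∃ v, ∀ p ∈ A.1, ∀ᶠ q in 𝓝 p, q ∈ D.cutSurface L.support →
      hs.HasColor c' q v := fun A =>
    A.isPreconnected.exists_eventually_eq A.nonempty (fun p v w => HasColor.unique hs)
      (fun p hp => hs.exists_hasColor hc' (A.subset hp))
      (fun p hp => hs.frequently_mem_cutSurface (A.subset hp))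
  choose c hc using key
  refine ⟨c, fun A B p hA hB => ?_⟩
  obtain ⟨B', hB', hv⟩ := (hc A p hA).self_of_nhds (B.subset hB)
  rw [Sheet.eq_of_mem hB hB', hv]

namespace Corresponds

variable {hs} {c c₂ : D.Sheet ∅ → R} {c' c₂' : D.Sheet L.support → R}

omit [T2Space M] [CompactSpace M] [IsManifold (𝓡 2) ∞ M] in
theorem eq_right (hc : hs.Corresponds c c') (hc₂ : hs.Corresponds c c₂') : c' = c₂' := by
  funext B
  obtain ⟨p, hp⟩ := B.nonempty
  obtain ⟨A, hA⟩ := B.exists_superset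
  rw [hc A B p (hA hp) hp, hc₂ A B p (hA hp) hp]

/-- Every sheet of `D` contains a point off `L`, where the color is recovered by inverting a power
of `ι`. -/
theorem eq_left (hc : hs.Corresponds c c') (hc₂ : hs.Corresponds c₂ c') : c = c₂ := by
  funext A
  obtain ⟨p, hp⟩ := A.nonempty
  obtain ⟨q, hqV, hqA⟩ := ((hs.frequently_mem_cutSurface (A.subset hp)).and_eventually
    ((A.isOpen D.isOpen_cutSurface_empty).eventually_mem hp)).exists
  obtain ⟨B, hB⟩ := Sheet.exists_mem hqV
  exact (kinkPerm R ^ hs.count q).injective ((hc A B q hqA hB).symm.trans (hc₂ A B q hqA hB))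

/-- Both sides of `L` belong to one sheet of `D`, and the counts on them are `m` and `m + 1`. -/
theorem curveRelation (hc : hs.Corresponds c c') : L.CurveRelation c' := by
  intro i t hl hsim xi xj hi hj
  obtain ⟨e, σ, hb⟩ := hs.exists_isBox i t (hs.abs_lt hs.width_mem)
  obtain ⟨m, hm⟩ := hs.exists_count_curve hb (hs.isSimpleAt_curve hl hsim)
  obtain ⟨A, hA⟩ := Sheet.exists_mem (D := D) (S := ∅) (p := L.curve i t)
    (by rw [cutSurface_empty]; exact hl)
  have hAo := (A.isOpen D.isOpen_cutSurface_empty).eventually_mem hA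
  rw [← hs.curve] at hi hj hAo
  obtain ⟨p, ⟨hpi, hpgt⟩, hpm, hpA⟩ := ((hb.frequently_gt_of_adjacent
    (hs.inner_curve_normalDir i t) (hs.inner_transverse_normalDir i t) hi).and_eventually
    (hm.and hAo)).exists
  obtain ⟨q, ⟨hqj, hqlt⟩, hqm, hqA⟩ := ((hb.frequently_lt_of_adjacent
    (hs.inner_curve_normalDir i t) (hs.inner_transverse_normalDir i t) hj).and_eventually
    (hm.and hAo)).exists
  rw [hc A xi p hpA hpi, hc A xj q hqA hqj, hpm.2 hpgt, hqm.1 hqlt, kinkPerm_pow_succ_apply]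

omit [CompactSpace M] in
/-- The colors at a double point of the diagram that does not lie on `L`. -/
theorem relation_iff (hc : hs.Corresponds c c') {i : Fin L.n} {t : ℝ}
    (hd : D.IsDoublePoint (low i t) (up i t)) (hx : low i t ∉ L.support)
    {A Aj Ak : D.Sheet ∅} {B Bj Bk : D.Sheet L.support} {y : M} (hyA : y ∈ Aj.1) (hyB : y ∈ Bj.1)
    {e : OpenPartialHomeomorph (ℝ × ℝ) M} {σ : E3 → ℝ × ℝ} (hb : D.IsBox (h i) e σ (t, 0))
    (h1 : ∃ᶠ p in 𝓝 (h i (t, 0)), (p ∈ A.1 ∧ p ∈ B.1) ∧ 0 < (e.symm p).2)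
    (h2 : ∃ᶠ p in 𝓝 (h i (t, 0)), (p ∈ Ak.1 ∧ p ∈ Bk.1) ∧ (e.symm p).2 < 0) :
    c' Bk = c' Bj ◃ c' B ↔ c Ak = c Aj ◃ rackKink (c A) := by
  obtain ⟨m, hm⟩ := hs.exists_count_low hb (hs.isSimpleAt_low_of_not_mem hd hx)
  obtain ⟨p, ⟨⟨hpA, hpB⟩, hp⟩, hpm⟩ := (h1.and_eventually hm).exists
  obtain ⟨q, ⟨⟨hqA, hqB⟩, hq⟩, hqm⟩ := (h2.and_eventually hm).exists
  rw [hc A B p hpA hpB, hc Aj Bj y hyA hyB, hc Ak Bk q hqA hqB, hpm.2 hp, hqm.1 hq]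
  exact kinkPerm_pow_relation_iff _ _ _ _ _

end Corresponds

end IsStrip

end RegularDiagram

/-! ### The relations along the double point curves -/

namespace RegularDiagram

variable {M : Type u} [TopologicalSpace M] [ChartedSpace (EuclideanSpace ℝ (Fin 2)) M]
  {D : RegularDiagram M}

theorem IsDoublePoint.upper_not_mem {x y : M} (hd : D.IsDoublePoint x y) : y ∉ D.lowerSet := by
  rintro ⟨z, hz, hlt⟩
  rcases hd.2 z (hz.symm.trans hd.1.1.symm) with rfl | rfl
  · exact lt_asymm hlt hd.1.2
  · exact lt_irrefl _ hlt

namespace IsStrip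

variable {L : D.ImmersedCurves} {low up : Fin L.n → ℝ → M} {h : Fin L.n → ℝ × ℝ → M} {δ η : ℝ}
  {hs : IsStrip L low up h δ η} {R : Type v} [Rack R] [T2Space M] [CompactSpace M]
  [IsManifold (𝓡 2) ∞ M]

namespace Corresponds

omit [CompactSpace M] in
theorem doubleCurveRelation {c : D.Sheet ∅ → AssocQuandle R} {c' : D.Sheet L.support → R}
    (hc : hs.Corresponds (R := R) c c') (hrel : D.DoubleCurveRelation ∅ c) :
    D.DoubleCurveRelation L.support c' := by
  intro x y hd hx hy xi xj xk hyj hi hk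
  obtain ⟨i, t, rfl, rfl⟩ := hs.parametrizes.surjective x y hd.1
  obtain ⟨e, σ, hb⟩ := hs.exists_isBox i t (hs.abs_lt hs.zero_mem)
  obtain ⟨A, hA⟩ := xi.exists_superset
  obtain ⟨Aj, hAj⟩ := xj.exists_superset
  obtain ⟨Ak, hAk⟩ := xk.exists_superset
  have hr := hrel _ _ hd (notMem_empty _) (notMem_empty _) A Aj Ak (hAj hyj) (hi.mono hA)
    (hk.mono hAk)
  rw [← hs.zero] at hi hk
  refine (hc.relation_iff hd hx (hAj hyj) hyj hb ?_ ?_).2 hr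
  · exact (hb.frequently_gt_of_adjacent (hs.inner_low_normal_up i t)
      (hs.inner_transverse_normal_up i t) hi).mono fun p hp => ⟨⟨hA hp.1, hp.1⟩, hp.2⟩
  · exact (hb.frequently_lt_of_adjacent (hs.inner_low_normal_up i t)
      (hs.inner_transverse_normal_up i t) hk).mono fun p hp => ⟨⟨hAk hp.1, hp.1⟩, hp.2⟩

omit [CompactSpace M] in
theorem relation_of_not_mem {c : D.Sheet ∅ → R} {c' : D.Sheet L.support → R}
    (hc : hs.Corresponds c c') (hrel : D.DoubleCurveRelation L.support c') {i : Fin L.n} {t : ℝ}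
    (hd : D.IsDoublePoint (low i t) (up i t)) (hx : low i t ∉ L.support)
    (hy : up i t ∉ L.support) {A Aj Ak : D.Sheet ∅} (hyj : up i t ∈ Aj.1)
    (hi : D.AdjacentOnSide A.1 (low i t) (-D.normal (up i t)))
    (hk : D.AdjacentOnSide Ak.1 (low i t) (D.normal (up i t))) :
    c Ak = c Aj ◃ rackKink (c A) := by
  obtain ⟨e, σ, hb⟩ := hs.exists_isBox i t (hs.abs_lt hs.zero_mem)
  have hcut := hs.eventually_mem_cutSurface hb (hs.isSimpleAt_low_of_not_mem hd hx)
  have hh := hs.contMDiffAt i t 0 (hs.abs_lt hs.zero_mem)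
  obtain ⟨xi, hxi⟩ := hb.exists_sheet_gt hcut
  obtain ⟨xk, hxk⟩ := hb.exists_sheet_lt hcut
  obtain ⟨xj, hxj⟩ := Sheet.exists_mem (D := D) (S := L.support) (p := up i t) (by
    rintro (h1 | h1)
    exacts [hd.upper_not_mem h1, hy h1])
  have h1 := adjacentOnSide_of_gt hh hb.eventually_left_inv
    (hs.inner_transverse_normal_up i t) hxi
  have h2 := adjacentOnSide_of_lt hh hb.eventually_left_inv
    (hs.inner_transverse_normal_up i t) hxk
  rw [hs.zero] at h1 h2
  have hr := hrel _ _ hd hx hy xi xj xk hxj h1 h2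
  rw [← hs.zero] at hi hk
  refine (hc.relation_iff hd hx hyj hxj hb ?_ ?_).1 hr
  · exact ((hb.frequently_gt_of_adjacent (hs.inner_low_normal_up i t)
      (hs.inner_transverse_normal_up i t) hi).and_eventually hxi).mono
      fun p hp => ⟨⟨hp.1.1, hp.2 hp.1.2⟩, hp.1.2⟩
  · exact ((hb.frequently_lt_of_adjacent (hs.inner_low_normal_up i t)
      (hs.inner_transverse_normal_up i t) hk).and_eventually hxk).mono
      fun p hp => ⟨⟨hp.1.1, hp.2 hp.1.2⟩, hp.1.2⟩

/-- The rack coloring is only constrained at double points off `L`. The three sheets of `D` at a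
double point remain the adjacent ones at nearby double points on the same curve, and points of `L`
are isolated there, so the relation can be read off at a neighbour. -/
theorem doubleCurveRelation_symm {c : D.Sheet ∅ → AssocQuandle R} {c' : D.Sheet L.support → R}
    (hc : hs.Corresponds (R := R) c c') (hrel : D.DoubleCurveRelation L.support c') :
    D.DoubleCurveRelation ∅ c := by
  intro x y hd _ _ A Aj Ak hyj hi hk
  obtain ⟨i, t, rfl, rfl⟩ := hs.parametrizes.surjective x y hd.1
  obtain ⟨e, σ, hb⟩ := hs.exists_isBox i t (hs.abs_lt hs.zero_mem)
  -- The point may lie on `L`, so only the lower curves, with time set `{0}`, are known to be simple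
  -- here; this suffices for the sheets of `D`.
  have hcut : ∀ᶠ p in 𝓝 (h i (t, 0)), (e.symm p).2 ≠ 0 → p ∈ D.cutSurface ∅ := by
    filter_upwards [hs.eventually_snd_eq (by simp) hb (hs.isSimpleAt_low hd)] with p hp hne
    rw [cutSurface_empty]
    rintro ⟨z, hz⟩
    obtain ⟨j, t', rfl, -⟩ := hs.parametrizes.surjective p z hz
    exact hne (hp j t' 0 rfl (hs.zero j t'))
  rw [← hs.zero] at hi hk
  obtain ⟨A', hA'⟩ := hb.exists_sheet_gt hcut
  obtain ⟨Ak', hAk'⟩ := hb.exists_sheet_lt hcut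
  obtain rfl : A = A' := by
    obtain ⟨p, hp, hp'⟩ := ((hb.frequently_gt_of_adjacent (hs.inner_low_normal_up i t)
      (hs.inner_transverse_normal_up i t) hi).and_eventually hA').exists
    exact Sheet.eq_of_mem hp.1 (hp' hp.2)
  obtain rfl : Ak = Ak' := by
    obtain ⟨p, hp, hp'⟩ := ((hb.frequently_lt_of_adjacent (hs.inner_low_normal_up i t)
      (hs.inner_transverse_normal_up i t) hk).and_eventually hAk').exists
    exact Sheet.eq_of_mem hp.1 (hp' hp.2)
  have hline : Tendsto (fun r : ℝ => (r, (0 : ℝ))) (𝓝 t) (𝓝 (t, 0)) :=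
    (continuous_id.prodMk continuous_const).tendsto t
  have hlow : Tendsto (low i) (𝓝 t) (𝓝 (low i t)) :=
    (hs.parametrizes.contMDiff_low i).continuous.tendsto t
  have hup : Tendsto (up i) (𝓝 t) (𝓝 (up i t)) :=
    (hs.parametrizes.contMDiff_up i).continuous.tendsto t
  have hproj : ∀ r, D.proj (low i r) = D.proj (up i r) := fun r =>
    (hs.parametrizes.isUnderOver i r).1
  have hne := (hs.parametrizes.isUnderOver i t).ne
  have hinj : ∀ᶠ r in 𝓝 t, D.proj (low i r) = D.proj (low i t) → r = t := by
    filter_upwards [hline.eventually hb.eventually_left_inv] with r hr heq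
    have h0 := hb.symm_apply
    rw [hb.symm_eq] at hr h0
    rw [hs.zero] at hr h0
    beta_reduce at hr h0
    rw [heq, h0, Prod.mk.injEq] at hr
    exact hr.1.symm
  have hoffx : ∀ᶠ r in 𝓝 t, low i r ∈ L.support → r = t := by
    filter_upwards [(hlow.prodMk_nhds hup).eventually
      (hs.eventually_support_off_sheet hne.symm (hproj t).symm), hinj] with r hr hr' hmem
    exact hr' (congrArg D.proj (hr (hproj r) hmem))
  have hoffy : ∀ᶠ r in 𝓝 t, up i r ∈ L.support → r = t := by
    filter_upwards [(hup.prodMk_nhds hlow).eventually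
      (hs.eventually_support_off_sheet hne (hproj t)), hinj] with r hr hr' hmem
    exact hr' (by rw [hproj r, hproj t, hr (hproj r).symm hmem])
  have hbase : Tendsto (fun r => h i (r, 0)) (𝓝 t) (𝓝 (h i (t, 0))) := hb.tendsto.comp hline
  have hfar : ∀ᶠ r in 𝓝[≠] t, r ≠ t := self_mem_nhdsWithin
  -- A parameter `r ≠ t` so close to `t` that neither preimage of the double point lies on `L` and
  -- all three sheets are still adjacent.
  obtain ⟨r, ⟨hdr, hxr, hyr, hjr, her, hAr, hAkr⟩, hrt⟩ := (Eventually.and (Eventually.filter_mono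
    nhdsWithin_le_nhds (((hlow.prodMk_nhds hup).eventually hd.eventually).and (hoffx.and
      (hoffy.and ((hup.eventually
        ((Aj.isOpen D.isOpen_cutSurface_empty).eventually_mem hyj)).and
      ((hline.eventually hb.eventually_left_inv.eventually_nhds).and
      ((hbase.eventually hA'.eventually_nhds).and
        (hbase.eventually hAk'.eventually_nhds)))))))) hfar).exists
  have hh := hs.contMDiffAt i r 0 (hs.abs_lt hs.zero_mem)
  have h1 := adjacentOnSide_of_gt hh her (hs.inner_transverse_normal_up i r) hAr
  have h2 := adjacentOnSide_of_lt hh her (hs.inner_transverse_normal_up i r) hAkr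
  rw [hs.zero] at h1 h2
  exact hc.relation_of_not_mem hrel (hdr (hs.parametrizes.isUnderOver i r))
    (fun hmem => hrt (hxr hmem)) (fun hmem => hrt (hyr hmem)) hjr h1 h2

end Corresponds

/-- The colorings of a diagram by the associated quandle correspond to the rack colorings of the
diagram with a push-off of its double point curves. -/
theorem nonempty_coloring_equiv (hs : IsStrip L low up h δ η) :
    Nonempty (D.Coloring (AssocQuandle R) ≃ L.Coloring R) := by
  have h1 : ∀ c : D.Coloring (AssocQuandle R), ∃ c' : L.Coloring R,
      hs.Corresponds (R := R) c.1 c'.1 := fun c => by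
    obtain ⟨c', hc'⟩ := hs.exists_corresponds_of_coloring (R := R) c.1
    exact ⟨⟨c', hc'.doubleCurveRelation c.2, hc'.curveRelation⟩, hc'⟩
  have h2 : ∀ c' : L.Coloring R, ∃ c : D.Coloring (AssocQuandle R),
      hs.Corresponds (R := R) c.1 c'.1 := fun c' => by
    obtain ⟨c, hc⟩ := hs.exists_corresponds_of_curveRelation c'.2.2
    exact ⟨⟨c, hc.doubleCurveRelation_symm c'.2.1⟩, hc⟩
  choose f hf using h1
  choose g hg using h2
  exact ⟨{ toFun := f
           invFun := g
           left_inv := fun c => Subtype.ext ((hg (f c)).eq_left (hf c))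
           right_inv := fun c' => Subtype.ext ((hf (g c')).eq_right (hg c')) }⟩

end IsStrip

end RegularDiagram

theorem theorem5p1 {M : Type u} [TopologicalSpace M] [T2Space M] [CompactSpace M]
    [ConnectedSpace M] [ChartedSpace (EuclideanSpace ℝ (Fin 2)) M] [IsManifold (𝓡 2) ∞ M]
    (D : RegularDiagram M) (ε : ℝ) (hε : 0 < ε) :
    ∃ L : D.ImmersedCurves, D.IsPushOff L ε ∧
      ∀ (R : Type v) [Rack R], Nonempty (D.Coloring (AssocQuandle R) ≃ L.Coloring R) := by
  obtain ⟨L, low, up, h, δ, η, hs, hL⟩ := D.exists_pushOff hε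
  exact ⟨L, hL, fun R _ => hs.nonempty_coloring_equiv⟩
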